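/- Let $n\ge 1$. Let $\mathcal P_m\le U(2^m)$ be the $m$-qubit Pauli group (all $m$-fold tensor products of elements of $\langle X,Z,iI_2\rangle$), $\mathrm{Cliff}(m)$ its normalizer in $U(2^m)$, $\mathcal C_m=\mathrm{Cliff}(m)/U(1)$ the projective Clifford group, and $\widetilde{\mathcal P}_m\trianglelefteq\mathcal C_m$ the image of $\mathcal P_m$. For $\mathbf x=(\mathbf p,\mathbf q)\in\mathbb Z_2^{2m}$ put $W_{\mathbf x}=i^{-\mathbf p\cdot\mathbf q}\bigotimes_j Z^{p_j}X^{q_j}$; then $\mathbf x\mapsto[W_{\mathbf x}]$ is an isomorphism $\mathbb Z_2^{2m}\cong\widetilde{\mathcal P}_m$, and conjugation on $\widetilde{\mathcal P}_m$ gives a surjection $\mathcal C_m\to Sp(2m,2)$ with kernel $\widetilde{\mathcal P}_m$, sending $[U]$ to the $\Gamma$ with $UW_{\mathbf x}U^\dagger=\pm W_{\Gamma\mathbf x}$. Let $\sigma_1$ be the character of $\widetilde{\mathcal P}_m$ with $\sigma_1([X_1])=\sigma_1([Z_1])=-1$ and $\sigma_1([X_i])=\sigma_1([Z_i])=1$ for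 $i\ge2$, and let $IN_m=\{g\in\mathcal C_m:{}^g\sigma_1=\sigma_1\}$ be its inertia group. (a) With $M=CX_{1,2}(Z_1H_1X_2)CX_{1,2}$ one has $IN_{n+1}=\langle[M],[H_1],[X_1],[I\otimes A]: A\in\mathrm{Cliff}(n)\rangle$. With $\mathcal H_{1,n+1}=\langle[H_1],[X_i],[Z_i]:1\le i\le n+1\rangle$, there is a surjective homomorphism $\pi:IN_{n+1}\to Sp(2n,2)\ltimes\mathbb Z_2^{2n}$ with kernel $\mathcal H_{1,n+1}$. (b) For $m\in\{n,n+1\}$, $\sigma_1$ extends to a linear character of $IN_m$; one extension is $[U]\mapsto\varepsilon(U)$, where $UY_1U^\dagger=\varepsilon(U)Y_1$. (c) Call a map $t:Sp(2n,2)\to\mathcal C_n$ *adapted* to a linear character $\tau$ of $IN_n$ extending $\sigma_1$ if $t$ is a normalized section of $\mathcal C_n\to Sp(2n,2)$ and $\tau(r^{-1}t(\Gamma)r)=1$ for all $\Gamma\in Sp(2n,2)$ and all $r\in\mathcal C_n$ with $r^{-1}t(\Gamma)r\in IN_n$. A section adapted to the extension $\tau=\varepsilon$ in (b) exists. (d)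 Let $\pi$ be any homomorphism as in (a), let $\sigma_1'$ be any linear character of $IN_{n+1}$ extending $\sigma_1$, let $\tau$ be any linear character of $IN_n$ extending $\sigma_1$, let $t$ be any section adapted to $\tau$, and define $\phi:Sp(2n,2)\ltimes\mathbb Z_2^{2n}\to\mathcal C_n$ by $\phi(\mathbf x,\Gamma)=[W_{\mathbf x}]\,t(\Gamma)$. Then $\phi$ is a bijection, and for every irreducible (complex) character $\chi$ of $\mathcal C_n$ the function $\chi\circ\phi$ is an irreducible character of $Sp(2n,2)\ltimes\mathbb Z_2^{2n}$ and $$\mathrm{Ind}^{\mathcal C_{n+1}}_{IN_{n+1}}\bigl(\widetilde{(\chi\circ\phi)}\otimes\sigma_1'\bigr),\qquad \widetilde{(\chi\circ\phi)}=\chi\circ\phi\circ\pi,$$ is an irreducible character of $\mathcal C_{n+1}$. The map sending $\chi$ to this character is injective on the set of irreducible characters of $\mathcal C_n$. -/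

import Mathlib

open scoped Matrix Kronecker

set_option linter.unusedSimpArgs false

namespace CliffordLift

/-! ## Characters of a finite group -/

/-- `f` is the character of an irreducible finite-dimensional complex representation of `G`. -/
def IsIrrChar {G : Type} [Group G] (f : G → ℂ) : Prop :=
  ∃ V : FDRep ℂ G, CategoryTheory.Simple V ∧ V.character = f

open Classical in
/-- The induced character (class function)
`(Ind_H^G f)(g) = |H|⁻¹ ∑_{r ∈ G, r⁻¹ g r ∈ H} f (r⁻¹ g r)` of a finite group `G`. -/
noncomputable def indChar {G : Type} [Group G] (H : Subgroup G) (f : H → ℂ) (g : G) : ℂ :=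
  (Nat.card H : ℂ)⁻¹ * ∑ᶠ r : G, if h : r⁻¹ * g * r ∈ H then f ⟨r⁻¹ * g * r, h⟩ else 0

/-- The inertia subgroup `I_G(σ) = {g ∈ G : ᵍσ = σ}`, `ᵍσ(x) = σ(g⁻¹ x g)`, of a linear character
`σ` of a normal subgroup `N` of `G`. -/
def inertiaSubgroup {G : Type} [Group G] (N : Subgroup G) [N.Normal] (σ : N →* ℂˣ) :
    Subgroup G where
  carrier := {g | ∀ x : N, σ (MulAut.conjNormal g⁻¹ x) = σ x}
  one_mem' := by intro x; simp
  mul_mem' := by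
    intro a b ha hb x
    have h : MulAut.conjNormal (a * b)⁻¹ x
        = MulAut.conjNormal b⁻¹ (MulAut.conjNormal a⁻¹ x) := by
      rw [mul_inv_rev, map_mul, MulAut.mul_apply]
    rw [h, hb, ha]
  inv_mem' := by
    intro a ha x
    have h := ha (MulAut.conjNormal a x)
    rw [← MulAut.mul_apply, ← map_mul, inv_mul_cancel, map_one, MulAut.one_apply] at h
    rw [inv_inv, ← h]

lemma le_inertiaSubgroup {G : Type} [Group G] (N : Subgroup G) [N.Normal] (σ : N →* ℂˣ) :
    N ≤ inertiaSubgroup N σ := by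
  intro g hg x
  have h : MulAut.conjNormal g⁻¹ x = (⟨g, hg⟩ : N)⁻¹ * x * ⟨g, hg⟩ := by
    ext; simp
  rw [h, map_mul, map_mul, map_inv, mul_right_comm, inv_mul_cancel, one_mul]

/-! ## The Pauli and Clifford groups -/

/-- The Pauli matrix `X`. -/
def matX : Matrix (Fin 2) (Fin 2) ℂ := !![0, 1; 1, 0]

/-- The Pauli matrix `Z`. -/
def matZ : Matrix (Fin 2) (Fin 2) ℂ := !![1, 0; 0, -1]

/-- The Pauli matrix `Y = -i Z X`. -/
def matY : Matrix (Fin 2) (Fin 2) ℂ := !![0, -Complex.I; Complex.I, 0]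

/-- The Hadamard matrix. -/
noncomputable def matH : Matrix (Fin 2) (Fin 2) ℂ :=
  ((Real.sqrt 2 : ℝ) : ℂ)⁻¹ • !![1, 1; 1, -1]

/-- Operators on `n` qubits, in the basis `v_{a 0} ⊗ ⋯ ⊗ v_{a (n-1)}`, `a : Fin n → Fin 2`. -/
abbrev QMat (n : ℕ) := Matrix (Fin n → Fin 2) (Fin n → Fin 2) ℂ

/-- The unitary group `U(2ⁿ)`. -/
abbrev QU (n : ℕ) := Matrix.unitaryGroup (Fin n → Fin 2) ℂ

/-- The tensor product `A 0 ⊗ ⋯ ⊗ A (n-1)` of `2 × 2` matrices. -/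
def tensor {n : ℕ} (A : Fin n → Matrix (Fin 2) (Fin 2) ℂ) : QMat n :=
  Matrix.of fun a b => ∏ k, A k (a k) (b k)

lemma tensor_mul {n : ℕ} (A B : Fin n → Matrix (Fin 2) (Fin 2) ℂ) :
    tensor A * tensor B = tensor (fun k => A k * B k) := by
  ext a b
  simp only [tensor, Matrix.mul_apply, Matrix.of_apply, ← Finset.prod_mul_distrib]
  rw [Finset.prod_univ_sum, Fintype.piFinset_univ]

lemma tensor_smul {n : ℕ} (c : Fin n → ℂ) (A : Fin n → Matrix (Fin 2) (Fin 2) ℂ) :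
    tensor (fun k => c k • A k) = (∏ k, c k) • tensor A := by
  ext a b
  simp [tensor, Finset.prod_mul_distrib]

lemma tensor_one {n : ℕ} : tensor (fun _ : Fin n => (1 : Matrix (Fin 2) (Fin 2) ℂ)) = 1 := by
  ext a b
  by_cases h : a = b
  · subst h; simp [tensor]
  · obtain ⟨k, hk⟩ := Function.ne_iff.mp h
    rw [Matrix.one_apply_ne h]
    exact Finset.prod_eq_zero (Finset.mem_univ k) (Matrix.one_apply_ne hk)

lemma tensor_star {n : ℕ} (A : Fin n → Matrix (Fin 2) (Fin 2) ℂ) :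
    star (tensor A) = tensor (fun k => star (A k)) := by
  ext a b
  simp [tensor, Matrix.star_apply]

/-- The tensor product of unitary `2 × 2` matrices, as a homomorphism into `U(2ⁿ)`. -/
def tensorHom (n : ℕ) : (Fin n → Matrix.unitaryGroup (Fin 2) ℂ) →* QU n where
  toFun A := ⟨tensor (fun k => (A k : Matrix (Fin 2) (Fin 2) ℂ)), by
    rw [Matrix.mem_unitaryGroup_iff, tensor_star, tensor_mul, ← tensor_one]
    congr 1; funext k
    exact Matrix.mem_unitaryGroup_iff.mp (A k).2⟩
  map_one' := Subtype.ext (by simpa using tensor_one)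
  map_mul' A B := Subtype.ext (by simp [tensor_mul])

/-- `X` as a unitary. -/
def uX : Matrix.unitaryGroup (Fin 2) ℂ := ⟨matX, by
  rw [Matrix.mem_unitaryGroup_iff]
  ext i j; fin_cases i <;> fin_cases j <;>
    simp [matX, Matrix.mul_apply, Fin.sum_univ_two, Matrix.star_apply]⟩

/-- `Z` as a unitary. -/
def uZ : Matrix.unitaryGroup (Fin 2) ℂ := ⟨matZ, by
  rw [Matrix.mem_unitaryGroup_iff]
  ext i j; fin_cases i <;> fin_cases j <;>
    simp [matZ, Matrix.mul_apply, Fin.sum_univ_two, Matrix.star_apply]⟩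

/-- The scalar matrix `i I₂` as a unitary. -/
noncomputable def uI : Matrix.unitaryGroup (Fin 2) ℂ := ⟨Complex.I • 1, by
  rw [Matrix.mem_unitaryGroup_iff]
  ext i j; fin_cases i <;> fin_cases j <;>
    simp [Matrix.mul_apply, Fin.sum_univ_two, Matrix.star_apply]⟩

/-- The one-qubit Pauli group `𝒫₁ = ⟨X, Z, i I₂⟩`. -/
noncomputable def pauliOne : Subgroup (Matrix.unitaryGroup (Fin 2) ℂ) :=
  Subgroup.closure {uX, uZ, uI}

/-- The `n`-qubit Pauli group: all `n`-fold tensor products of elements of `𝒫₁`. -/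
noncomputable def pauliGroup (n : ℕ) : Subgroup (QU n) :=
  (Subgroup.pi Set.univ fun _ : Fin n => pauliOne).map (tensorHom n)

/-- The Clifford group `Cliff(n)`: the normalizer of the Pauli group in `U(2ⁿ)`. -/
noncomputable def cliff (n : ℕ) : Subgroup (QU n) :=
  Subgroup.normalizer (pauliGroup n : Set (QU n))

/-- The global phases `U(1)` in `Cliff(n)`. -/
noncomputable def phases (n : ℕ) : Subgroup (cliff n) where
  carrier := {U | ∃ c : ℂ, ((U : QU n) : QMat n) = c • 1}
  one_mem' := ⟨1, by simp⟩
  mul_mem' := by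
    rintro U V ⟨c, hc⟩ ⟨d, hd⟩
    exact ⟨c * d, by simp [hc, hd, smul_smul, mul_comm]⟩
  inv_mem' := by
    rintro U ⟨c, hc⟩
    exact ⟨star c, by simp [hc]⟩

instance phases_normal (n : ℕ) : (phases n).Normal where
  conj_mem := by
    rintro U ⟨c, hc⟩ V
    refine ⟨c, ?_⟩
    have h : (V : QU n).1 * (star (V : QU n).1) = 1 := Matrix.mem_unitaryGroup_iff.mp (V : QU n).2
    simp [hc, h]

/-- The `n`-qubit projective Clifford group `𝒞ₙ = Cliff(n) / U(1)`. -/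
abbrev C (n : ℕ) := cliff n ⧸ phases n

/-- The projective Pauli group `𝒫̃ₙ`, as a subgroup of `𝒞ₙ`. -/
noncomputable def projPauli (n : ℕ) : Subgroup (C n) :=
  ((pauliGroup n).subgroupOf (cliff n)).map (QuotientGroup.mk' (phases n))

instance projPauli_normal (n : ℕ) : (projPauli n).Normal := by
  have : ((pauliGroup n).subgroupOf (cliff n)).Normal := Subgroup.normal_in_normalizer
  exact this.map _ (QuotientGroup.mk'_surjective _)

/-! ## Weyl operators -/

/-- The space `ℤ₂²ⁿ`; the `inl` coordinates are `p`, the `inr` coordinates are `q`. -/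
abbrev V (n : ℕ) := (Fin n ⊕ Fin n) → ZMod 2

/-- The one-qubit Weyl operator `i^{-pq} Z^p X^q`. -/
noncomputable def weylOne (p q : ZMod 2) : Matrix.unitaryGroup (Fin 2) ℂ :=
  uI⁻¹ ^ (p.val * q.val) * (uZ ^ p.val * uX ^ q.val)

lemma uI_comm (A : Matrix.unitaryGroup (Fin 2) ℂ) : A * uI = uI * A :=
  Subtype.ext (by simp [uI])

lemma uZ_sq : uZ * uZ = 1 := Subtype.ext (by
  ext i j; fin_cases i <;> fin_cases j <;> simp [uZ, matZ, Matrix.mul_apply, Fin.sum_univ_two])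

lemma uX_sq : uX * uX = 1 := Subtype.ext (by
  ext i j; fin_cases i <;> fin_cases j <;> simp [uX, matX, Matrix.mul_apply, Fin.sum_univ_two])

lemma uX_uZ : uX * uZ = uI ^ 2 * (uZ * uX) := Subtype.ext (by
  ext i j; fin_cases i <;> fin_cases j <;>
    simp [uX, uZ, uI, matX, matZ, Matrix.mul_apply, Fin.sum_univ_two, pow_two, smul_smul])

/-- The Weyl operator `W_x = i^{-p·q} (Z^{p₁}X^{q₁}) ⊗ ⋯ ⊗ (Z^{pₙ}X^{qₙ})`, `x = (p, q)`. -/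
noncomputable def weylU {n : ℕ} (x : V n) : QU n :=
  tensorHom n fun k => weylOne (x (Sum.inl k)) (x (Sum.inr k))

lemma zmod_two_cases (z : ZMod 2) : z = 0 ∨ z = 1 := by
  revert z; decide

lemma weylOne_mul (p q p' q' : ZMod 2) :
    ∃ l : ℤ, weylOne p q * weylOne p' q' = uI ^ l * weylOne (p + p') (q + q') := by
  have hz : (0 : ZMod 2).val = 0 := rfl
  have ho : (1 : ZMod 2).val = 1 := rfl
  have h11 : (1 + 1 : ZMod 2) = 0 := rfl
  have cm : ∀ (l : ℤ) (A : Matrix.unitaryGroup (Fin 2) ℂ), A * uI ^ l = uI ^ l * A :=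
    fun l A => ((show Commute A uI from uI_comm A).zpow_right l).eq
  have key : ∀ a b c d : ℕ, ∃ l : ℤ, uZ ^ a * uX ^ b * (uZ ^ c * uX ^ d)
      = uI ^ l * (uZ ^ (a + c) * uX ^ (b + d)) := by
    intro a b c d
    have h1 : ∀ b : ℕ, ∃ l : ℤ, uX ^ b * uZ = uI ^ l * (uZ * uX ^ b) := by
      intro b
      induction b with
      | zero => exact ⟨0, by simp⟩
      | succ b ih =>
        obtain ⟨l, hl⟩ := ih
        refine ⟨2 + l, ?_⟩
        rw [pow_succ', mul_assoc, hl, ← mul_assoc, cm, mul_assoc, ← mul_assoc uX, uX_uZ, zpow_add,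
          mul_assoc, mul_assoc, ← zpow_natCast uI 2, ← mul_assoc, ← mul_assoc]
        simp only [mul_assoc]
        rw [← mul_assoc (uI ^ l), ← mul_assoc (uI ^ (2 : ℤ)), ← zpow_add, ← zpow_add, add_comm]
        rfl
    have h2 : ∀ c : ℕ, ∃ l : ℤ, uX ^ b * uZ ^ c = uI ^ l * (uZ ^ c * uX ^ b) := by
      intro c
      induction c with
      | zero => exact ⟨0, by simp⟩
      | succ c ih =>
        obtain ⟨l, hl⟩ := ih
        obtain ⟨m, hm⟩ := h1 b
        refine ⟨l + m, ?_⟩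
        rw [pow_succ, ← mul_assoc, hl, mul_assoc, mul_assoc, hm, ← mul_assoc (uZ ^ c), cm,
          zpow_add]
        simp only [mul_assoc]
    obtain ⟨l, hl⟩ := h2 c
    refine ⟨l, ?_⟩
    calc uZ ^ a * uX ^ b * (uZ ^ c * uX ^ d) = uZ ^ a * (uX ^ b * uZ ^ c) * uX ^ d := by
          simp only [mul_assoc]
      _ = uI ^ l * (uZ ^ (a + c) * uX ^ (b + d)) := by
          rw [hl, ← mul_assoc, cm, pow_add, pow_add]; simp only [mul_assoc]
  have red : ∀ (a : ZMod 2) (b : ZMod 2), uZ ^ (a.val + b.val) = uZ ^ (a + b).val := by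
    intro a b
    rcases zmod_two_cases a with rfl | rfl <;> rcases zmod_two_cases b with rfl | rfl <;>
      simp [hz, ho, h11, pow_two, uZ_sq]
  have red' : ∀ (a : ZMod 2) (b : ZMod 2), uX ^ (a.val + b.val) = uX ^ (a + b).val := by
    intro a b
    rcases zmod_two_cases a with rfl | rfl <;> rcases zmod_two_cases b with rfl | rfl <;>
      simp [hz, ho, h11, pow_two, uX_sq]
  obtain ⟨l, hl⟩ := key p.val q.val p'.val q'.val
  rw [red, red'] at hl
  have inv : ∀ k : ℕ, uI⁻¹ ^ k = uI ^ (-(k : ℤ)) := fun k => by simp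
  refine ⟨-((p.val * q.val : ℕ) : ℤ) - ((p'.val * q'.val : ℕ) : ℤ) + l
    + (((p + p').val * (q + q').val : ℕ) : ℤ), ?_⟩
  unfold weylOne
  rw [inv, inv, inv]
  generalize -((p.val * q.val : ℕ) : ℤ) = u
  generalize ((p'.val * q'.val : ℕ) : ℤ) = v
  generalize (((p + p').val * (q + q').val : ℕ) : ℤ) = w
  calc uI ^ u * (uZ ^ p.val * uX ^ q.val) * (uI ^ (-v) * (uZ ^ p'.val * uX ^ q'.val))
      = uI ^ u * (((uZ ^ p.val * uX ^ q.val) * uI ^ (-v)) * (uZ ^ p'.val * uX ^ q'.val)) := by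
        simp only [mul_assoc]
    _ = uI ^ u * (uI ^ (-v) * (uI ^ l * (uZ ^ (p + p').val * uX ^ (q + q').val))) := by
        rw [cm, mul_assoc (uI ^ (-v)), hl]
    _ = uI ^ (u - v + l + w) * (uI ^ (-w) * (uZ ^ (p + p').val * uX ^ (q + q').val)) := by
        generalize uZ ^ (p + p').val * uX ^ (q + q').val = B
        rw [← mul_assoc, ← mul_assoc, ← mul_assoc, ← zpow_add, ← zpow_add, ← zpow_add]
        congr 2; ring

lemma uX_mem : uX ∈ pauliOne := Subgroup.subset_closure (by simp)
lemma uZ_mem : uZ ∈ pauliOne := Subgroup.subset_closure (by simp)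
lemma uI_mem : uI ∈ pauliOne := Subgroup.subset_closure (by simp)

lemma weylOne_mem (p q : ZMod 2) : weylOne p q ∈ pauliOne :=
  mul_mem (pow_mem (inv_mem uI_mem) _) (mul_mem (pow_mem uZ_mem _) (pow_mem uX_mem _))

lemma weylOne_zero : weylOne 0 0 = 1 := by simp [weylOne]

/-- Every element of `𝒫₁` is a power of `i` times a Weyl operator. -/
lemma exists_of_mem_pauliOne {A : Matrix.unitaryGroup (Fin 2) ℂ} (hA : A ∈ pauliOne) :
    ∃ (l : ℤ) (p q : ZMod 2), A = uI ^ l * weylOne p q := by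
  have cm : ∀ (l : ℤ) (A : Matrix.unitaryGroup (Fin 2) ℂ), A * uI ^ l = uI ^ l * A :=
    fun l A => ((show Commute A uI from uI_comm A).zpow_right l).eq
  have ho : (1 : ZMod 2).val = 1 := rfl
  induction hA using Subgroup.closure_induction with
  | mem x hx =>
    rcases hx with rfl | rfl | rfl
    · exact ⟨0, 0, 1, by simp [weylOne, ho]⟩
    · exact ⟨0, 1, 0, by simp [weylOne, ho]⟩
    · exact ⟨1, 0, 0, by simp [weylOne]⟩
  | one => exact ⟨0, 0, 0, by simp [weylOne]⟩
  | mul x y _ _ hx hy =>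
    obtain ⟨l, p, q, rfl⟩ := hx
    obtain ⟨l', p', q', rfl⟩ := hy
    obtain ⟨m, hm⟩ := weylOne_mul p q p' q'
    refine ⟨l + l' + m, p + p', q + q', ?_⟩
    rw [zpow_add, zpow_add, mul_assoc (uI ^ l * uI ^ l'), ← hm, mul_assoc, ← mul_assoc (weylOne p q),
      cm]
    simp only [mul_assoc]
  | inv x _ hx =>
    obtain ⟨l, p, q, rfl⟩ := hx
    obtain ⟨m, hm⟩ := weylOne_mul p q p q
    have hp : ∀ z : ZMod 2, z + z = 0 := by decide
    rw [hp, hp, weylOne_zero, mul_one] at hm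
    refine ⟨-l - m, p, q, ?_⟩
    rw [inv_eq_iff_mul_eq_one, mul_assoc, ← mul_assoc (weylOne p q), cm, mul_assoc, hm, ← zpow_add,
      ← zpow_add]
    simp

lemma weylU_mem_pauli {n : ℕ} (x : V n) : weylU x ∈ pauliGroup n :=
  ⟨_, fun _ _ => weylOne_mem _ _, rfl⟩

lemma weylU_mem {n : ℕ} (x : V n) : weylU x ∈ cliff n :=
  Subgroup.le_normalizer (weylU_mem_pauli x)

lemma coe_uI_zpow (l : ℤ) : ∃ c : ℂ, ((uI ^ l : Matrix.unitaryGroup (Fin 2) ℂ) :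
    Matrix (Fin 2) (Fin 2) ℂ) = c • 1 := by
  have h : ∀ k : ℕ, ((uI ^ k : Matrix.unitaryGroup (Fin 2) ℂ) : Matrix (Fin 2) (Fin 2) ℂ)
      = Complex.I ^ k • 1 := by
    intro k
    rw [SubmonoidClass.coe_pow]
    simp [uI, smul_pow]
  cases l with
  | ofNat k => exact ⟨Complex.I ^ k, by simpa using h k⟩
  | negSucc k =>
    refine ⟨star (Complex.I ^ (k + 1)), ?_⟩
    rw [zpow_negSucc, Matrix.UnitaryGroup.inv_val, h]
    simp

/-- A tensor product that agrees with `W_x` up to powers of `i` on every qubit is a multiple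
of `W_x`. -/
lemma tensorHom_eq_smul {n : ℕ} (A : Fin n → Matrix.unitaryGroup (Fin 2) ℂ) (x : V n)
    (h : ∀ k, ∃ l : ℤ, A k = uI ^ l * weylOne (x (Sum.inl k)) (x (Sum.inr k))) :
    ∃ c : ℂ, (tensorHom n A : QMat n) = c • (weylU x : QMat n) := by
  choose l hl using h
  choose c hc using fun k => coe_uI_zpow (l k)
  refine ⟨∏ k, c k, ?_⟩
  have e : (tensorHom n A : QMat n) = tensor fun k => (A k : Matrix (Fin 2) (Fin 2) ℂ) := rfl
  have e' : (weylU x : QMat n) = tensor fun k =>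
    (weylOne (x (Sum.inl k)) (x (Sum.inr k)) : Matrix (Fin 2) (Fin 2) ℂ) := rfl
  rw [e, e', ← tensor_smul]
  congr 1; funext k
  rw [hl k, Matrix.UnitaryGroup.mul_val, hc k]
  simp

lemma mk_eq_of_smul {n : ℕ} {U W : cliff n} {c : ℂ}
    (h : ((U : QU n) : QMat n) = c • ((W : QU n) : QMat n)) : (U : C n) = (W : C n) := by
  symm
  rw [QuotientGroup.eq]
  refine ⟨c, ?_⟩
  have h' : star (W : QU n).1 * (W : QU n).1 = 1 := Matrix.mem_unitaryGroup_iff'.mp (W : QU n).2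
  simp [h, h']

/-- The class `[W_x] ∈ 𝒞ₙ`, a homomorphism `ℤ₂²ⁿ → 𝒞ₙ`. -/
noncomputable def weyl (n : ℕ) : Multiplicative (V n) →* C n :=
  MonoidHom.mk' (fun x => ((⟨weylU x.toAdd, weylU_mem _⟩ : cliff n) : C n)) (by
    intro x y
    rw [← QuotientGroup.mk_mul]
    symm
    obtain ⟨c, hc⟩ := tensorHom_eq_smul
      (fun k => weylOne (x.toAdd (Sum.inl k)) (x.toAdd (Sum.inr k))
        * weylOne (y.toAdd (Sum.inl k)) (y.toAdd (Sum.inr k))) (x.toAdd + y.toAdd)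
      (fun k => weylOne_mul _ _ _ _)
    refine mk_eq_of_smul (c := c) ?_
    rw [toAdd_mul, ← hc]
    have := congrArg (Subtype.val) (map_mul (tensorHom n)
      (fun k => weylOne (x.toAdd (Sum.inl k)) (x.toAdd (Sum.inr k)))
      (fun k => weylOne (y.toAdd (Sum.inl k)) (y.toAdd (Sum.inr k))))
    exact this.symm)

lemma weylOne_apply (p q : ZMod 2) (a b : Fin 2) :
    (weylOne p q : Matrix (Fin 2) (Fin 2) ℂ) a b ≠ 0 ↔ (a = b ↔ q = 0) := by
  have ho : (1 : ZMod 2).val = 1 := rfl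
  rcases zmod_two_cases p with rfl | rfl <;> rcases zmod_two_cases q with rfl | rfl <;>
    fin_cases a <;> fin_cases b <;>
    simp [weylOne, ho, uI, uX, uZ, matX, matZ, Matrix.mul_apply, Fin.sum_univ_two,
      Matrix.star_apply]

lemma weyl_injective (n : ℕ) : Function.Injective (weyl n) := by
  rw [injective_iff_map_eq_one]
  intro x hx
  have hx' : ((⟨weylU x.toAdd, weylU_mem _⟩ : cliff n) : C n) = 1 := hx
  rw [QuotientGroup.eq_one_iff] at hx'
  obtain ⟨c, hc⟩ := hx'
  have e : ∀ a b, (∏ k, (weylOne (x.toAdd (Sum.inl k)) (x.toAdd (Sum.inr k)) :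
      Matrix (Fin 2) (Fin 2) ℂ) (a k) (b k)) = (c • (1 : QMat n)) a b :=
    fun a b => congrFun (congrFun hc a) b
  have hq : ∀ k, x.toAdd (Sum.inr k) = 0 := by
    by_contra! hne
    obtain ⟨k, hk⟩ := hne
    have h1 := e (fun k => if x.toAdd (Sum.inr k) = 0 then 0 else 1) 0
    have h2 : (fun k => if x.toAdd (Sum.inr k) = 0 then (0 : Fin 2) else 1) ≠ 0 := by
      intro h; have := congrFun h k; simp [hk] at this
    rw [Matrix.smul_apply, Matrix.one_apply_ne h2, smul_zero, Finset.prod_eq_zero_iff] at h1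
    obtain ⟨j, -, hj⟩ := h1
    refine (weylOne_apply _ _ _ _).mpr ?_ hj
    by_cases h : x.toAdd (Sum.inr j) = 0 <;> simp [h]
  have hp : ∀ k, x.toAdd (Sum.inl k) = 0 := by
    intro k
    have h0 := e 0 0
    have h1 := e (Pi.single k 1) (Pi.single k 1)
    rw [Matrix.smul_apply, Matrix.one_apply_eq] at h0 h1
    rw [← h0] at h1
    have z0 : ∀ p : ZMod 2, (weylOne p 0 : Matrix (Fin 2) (Fin 2) ℂ) 0 0 = 1 := by
      have ho : (1 : ZMod 2).val = 1 := rfl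
      intro p
      rcases zmod_two_cases p with rfl | rfl <;>
        simp [weylOne, ho, uZ, matZ]
    rw [Finset.prod_eq_single k] at h1
    · simp only [hq, Pi.single_eq_same, Pi.zero_apply, z0, Finset.prod_const_one] at h1
      rcases zmod_two_cases (x.toAdd (Sum.inl k)) with h | h
      · exact h
      · have ho : (1 : ZMod 2).val = 1 := rfl
        exfalso
        rw [h] at h1
        simp [weylOne, ho, uZ, matZ] at h1
        norm_num at h1
    · intro j _ hj
      simp [hq, Pi.single_eq_of_ne hj, z0]
    · simp
  apply Multiplicative.toAdd.injective
  funext k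
  rcases k with k | k
  · exact hp k
  · exact hq k

/-- The projective Pauli group is `{[W_x] : x ∈ ℤ₂²ⁿ}`. -/
lemma range_weyl (n : ℕ) : (weyl n).range = projPauli n := by
  ext g
  constructor
  · rintro ⟨x, rfl⟩
    exact ⟨⟨weylU x.toAdd, weylU_mem _⟩, weylU_mem_pauli _, rfl⟩
  · rintro ⟨⟨U, hU⟩, ⟨A, hA, hAU⟩, rfl⟩
    choose l p q h using fun k => exists_of_mem_pauliOne (hA k (Set.mem_univ k))
    refine ⟨Multiplicative.ofAdd (Sum.elim p q), ?_⟩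
    obtain ⟨c, hc⟩ := tensorHom_eq_smul A (Sum.elim p q) (fun k => ⟨l k, h k⟩)
    symm
    refine mk_eq_of_smul (c := c) ?_
    change (U : QMat n) = _
    rw [show U = tensorHom n A from hAU.symm]
    exact hc

/-- The isomorphism `ℤ₂²ⁿ ≅ 𝒫̃ₙ`, `x ↦ [W_x]`. -/
noncomputable def weylEquiv (n : ℕ) : Multiplicative (V n) ≃* projPauli n :=
  (MonoidHom.ofInjective (weyl_injective n)).trans (MulEquiv.subgroupCongr (range_weyl n))

/-! ## The character `σ₁` and its inertia group -/

/-- The character `x ↦ (-1)^{p₁ + q₁}` of `ℤ₂²ⁿ`. -/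
noncomputable def signV (n : ℕ) [NeZero n] : Multiplicative (V n) →* ℂˣ where
  toFun x := (-1) ^ (x.toAdd (Sum.inl 0) + x.toAdd (Sum.inr 0)).val
  map_one' := by simp
  map_mul' x y := by
    rw [← pow_add]
    simp only [toAdd_mul, Pi.add_apply]
    generalize x.toAdd (Sum.inl 0) = a
    generalize x.toAdd (Sum.inr 0) = b
    generalize y.toAdd (Sum.inl 0) = c
    generalize y.toAdd (Sum.inr 0) = d
    have h : (a + c + (b + d)).val % 2 = ((a + b).val + (c + d).val) % 2 := by
      revert a b c d; decide
    have key : ∀ k : ℕ, (-1 : ℂˣ) ^ k = (-1) ^ (k % 2) := fun k => by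
      conv_lhs => rw [← Nat.div_add_mod k 2, pow_add, pow_mul]
      simp
    rw [key, h, ← key]

/-- The character `σ₁` of `𝒫̃ₙ`: `σ₁([X₁]) = σ₁([Z₁]) = -1`, `σ₁([Xᵢ]) = σ₁([Zᵢ]) = 1` for
`i ≠ 1`. -/
noncomputable def sigma1 (n : ℕ) [NeZero n] : projPauli n →* ℂˣ :=
  (signV n).comp (weylEquiv n).symm.toMonoidHom

/-- The inertia group `IN_n = I_{𝒞ₙ}(σ₁)`. -/
noncomputable def IN (n : ℕ) [NeZero n] : Subgroup (C n) :=
  inertiaSubgroup (projPauli n) (sigma1 n)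

/-- `τ` is an extension of `σ₁` to a linear character of `IN_n`. -/
def ExtendsSigma1 {n : ℕ} [NeZero n] (τ : IN n →* ℂˣ) : Prop :=
  τ.comp (Subgroup.inclusion (le_inertiaSubgroup (projPauli n) (sigma1 n))) = sigma1 n

/-! ## Generators of the inertia group -/

/-- The (at most one) element `[A]` of `𝒞ₙ` represented by the matrix `A`. -/
def classOf {n : ℕ} (A : QMat n) : Set (C n) :=
  {g | ∃ U : cliff n, ((U : QU n) : QMat n) = A ∧ (U : C n) = g}

/-- `A_j`: the matrix `A` acting on the qubit `j`. -/
def onQubit {n : ℕ} (j : Fin n) (A : Matrix (Fin 2) (Fin 2) ℂ) : QMat n :=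
  tensor (Function.update (fun _ => 1) j A)

/-- `τ` is the linear character `[U] ↦ ε(U)` of `IN_n` given by `U Y₁ U† = ε(U) Y₁`. -/
def IsSignChar {n : ℕ} [NeZero n] (τ : IN n →* ℂˣ) : Prop :=
  ∀ (U : cliff n) (h : (U : C n) ∈ IN n),
    ((U : QU n) : QMat n) * onQubit 0 matY * star ((U : QU n) : QMat n)
      = ((τ ⟨(U : C n), h⟩ : ℂˣ) : ℂ) • onQubit 0 matY

/-- The controlled-`X` gate with control `c` and target `d`. -/
def cnot {n : ℕ} (c d : Fin n) : QMat n :=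
  Matrix.of fun a b => if a = Function.update b d (b d + b c) then 1 else 0

/-- `M = CX_{1,2} (Z₁ H₁ X₂) CX_{1,2}`. -/
noncomputable def matM (n : ℕ) : QMat (n + 1) :=
  cnot 0 1 * (onQubit 0 matZ * onQubit 0 matH * onQubit 1 matX) * cnot 0 1

/-- `I ⊗ A` for an operator `A` on the last `n` of `n + 1` qubits. -/
def idTensor {n : ℕ} (A : QMat n) : QMat (n + 1) :=
  Matrix.of fun a b => if a 0 = b 0 then A (Fin.tail a) (Fin.tail b) else 0

/-- The subgroup `⟨[M], [H₁], [X₁], [I ⊗ A] : A ∈ Cliff(n)⟩` of `𝒞ₙ₊₁`. -/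
noncomputable def genIN (n : ℕ) : Subgroup (C (n + 1)) :=
  Subgroup.closure (classOf (matM n) ∪ classOf (onQubit 0 matH) ∪ classOf (onQubit 0 matX) ∪
    ⋃ A : cliff n, classOf (idTensor ((A : QU n) : QMat n)))

/-- `ℋ_{1,n} = ⟨[H₁], [Xᵢ], [Zᵢ] : i = 1, …, n⟩`. -/
noncomputable def hadSubgroup (n : ℕ) [NeZero n] : Subgroup (C n) :=
  Subgroup.closure (classOf (onQubit 0 matH) ∪
    ⋃ i : Fin n, (classOf (onQubit i matX) ∪ classOf (onQubit i matZ)))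

/-! ## The affine symplectic group and the bijection `φ` -/

/-- The symplectic group `Sp(2n,2)`. -/
abbrev Sp (n : ℕ) := Matrix.symplecticGroup (Fin n) (ZMod 2)

/-- The action of `Sp(2n,2)` on (the multiplicative copy of) `ℤ₂²ⁿ`. -/
def sympAct (n : ℕ) : Sp n →* MulAut (Multiplicative (V n)) where
  toFun Γ := AddEquiv.toMultiplicative
    { toFun := fun x => Γ.1 *ᵥ x
      invFun := fun x => (Γ⁻¹).1 *ᵥ x
      left_inv := fun x => by
        beta_reduce
        rw [Matrix.mulVec_mulVec, ← Submonoid.coe_mul, inv_mul_cancel, Submonoid.coe_one,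
          Matrix.one_mulVec]
      right_inv := fun x => by
        beta_reduce
        rw [Matrix.mulVec_mulVec, ← Submonoid.coe_mul, mul_inv_cancel, Submonoid.coe_one,
          Matrix.one_mulVec]
      map_add' := fun x y => Matrix.mulVec_add _ _ _ }
  map_one' := by
    ext x : 1
    exact congrArg Multiplicative.ofAdd (Matrix.one_mulVec x.toAdd)
  map_mul' Γ Δ := by
    ext x : 1
    exact congrArg Multiplicative.ofAdd (Matrix.mulVec_mulVec x.toAdd Γ.1 Δ.1).symm

/-- The affine symplectic group `Sp(2n,2) ⋉ ℤ₂²ⁿ`, with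
`(x, Γ)(y, Δ) = (x + Γ y, Γ Δ)`. -/
abbrev AffSp (n : ℕ) := Multiplicative (V n) ⋊[sympAct n] Sp n

/-- `t` is a normalized section of `𝒞ₙ → Sp(2n,2)` (the class `[U]` maps to the `Γ` with
`U W_x U† = ± W_{Γ x}`) on which the linear character `τ` of `IN_n`, and every conjugate
`ʳτ` of it (a linear character of `r IN_n r⁻¹`), takes no value but `1`. -/
def IsAdaptedSection {n : ℕ} [NeZero n] (τ : IN n →* ℂˣ) (t : Sp n → C n) : Prop :=
  t 1 = 1 ∧
  (∀ (Γ : Sp n) (x : Multiplicative (V n)),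
    t Γ * weyl n x * (t Γ)⁻¹ = weyl n (sympAct n Γ x)) ∧
  ∀ (Γ : Sp n) (r : C n) (h : r⁻¹ * t Γ * r ∈ IN n), τ ⟨r⁻¹ * t Γ * r, h⟩ = 1

/-- The map `φ : Sp(2n,2) ⋉ ℤ₂²ⁿ → 𝒞ₙ`, `φ(x, Γ) = [W_x] t(Γ)`. -/
noncomputable def phi {n : ℕ} (t : Sp n → C n) (s : AffSp n) : C n :=
  weyl n s.left * t s.right

/-- `π` is a surjection `IN_{n+1} → Sp(2n,2) ⋉ ℤ₂²ⁿ` with kernel `ℋ_{1,n+1}`, that is, it induces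
an isomorphism `IN_{n+1} / ℋ_{1,n+1} ≅ Sp(2n,2) ⋉ ℤ₂²ⁿ`. -/
def IsAffineProjection {n : ℕ} (π : IN (n + 1) →* AffSp n) : Prop :=
  Function.Surjective π ∧ π.ker.map (IN (n + 1)).subtype = hadSubgroup (n + 1)

/-- The lift `Ind_{IN_{n+1}}^{𝒞ₙ₊₁} ((χ ∘ φ)~ ⊗ σ₁')` of a class function `χ` of `𝒞ₙ`, where `~`
is inflation along `π`. -/
noncomputable def liftChar {n : ℕ} (π : IN (n + 1) →* AffSp n) (σ' : IN (n + 1) →* ℂˣ)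
    (t : Sp n → C n) (χ : C n → ℂ) : C (n + 1) → ℂ :=
  indChar (IN (n + 1)) fun g => χ (phi t (π g)) * (σ' g : ℂ)

end CliffordLift

open CliffordLift

namespace CliffordLift

section

/-! ## Irreducible characters and unbundled representations -/

section Rep

open CategoryTheory Representation

variable {G : Type} [Group G]

/-! The group `C n` acts on the index space `V n` of Weyl classes through the symplectic group, and
`sigma1` is the character `[W_x] ↦ (-1)^{ω(x, y1)}`, where `y1` is the vector of `Y₁`. By
nondegeneracy of `ω`, the inertia group `IN n` is therefore the stabilizer of `y1` (`mem_IN`). The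
sign with which an element of this stabilizer conjugates `Y₁` is a linear character, and it extends
`sigma1` because `W_x` and `Y₁` commute up to `(-1)^{ω(x, y1)}`.

The stabilizer of `y1` acts on `y1^⊥ / y1`, a copy of `V n`, by symplectic maps. The image of a
vector `f1` with `ω(f1, y1) = 1` supplies a translation, and the two together give `affProj`. Its
kernel acts by the identity or by the transvection of `y1`, so it consists of Weyl classes and their
products with `Z₁H₁`. The operators `I ⊗ A` give the whole symplectic part, since transvections
generate it. `M` gives one nonzero translation, and transitivity on nonzero vectors gives the rest.

An adapted section exists because the signs of a lift of `Γ` form a character of the space fixed by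
`Γ`. This character has the form `(-1)^{ω(z, ·)}`, and multiplying the lift by `W_z` removes it
(`exists_positive_lift`).

The map `φ` need not be a homomorphism: `φ(a) φ(b) = [W_z] φ(ab)` for some `z` depending on `a` and
`b`. In a representation of `C n`, however, the Pauli classes act by scalars on their isotypic
components, which are indexed by `y ∈ V n`, and there `[W_z]` is a sign. Scalars built from `τ`, one
for each group element and component, absorb these signs (`IsAdaptedSection.twistDatum`), so `ρ ∘ φ`
becomes a genuine representation. Components that are moved contribute nothing to the trace. On
those that are fixed the scalar is 1, which is exactly what adaptedness provides. Hence the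
character of the new representation is `χ ∘ φ`. It is irreducible because its invariant subspaces
are stable under the isotypic projections, and hence under `ρ`.

The lift to `C (n + 1)` is then the Clifford correspondence: inflate along `π`, twist by an
extension of `sigma1` so as to lie over `sigma1`, and induce from the inertia group
(`isIrreducible_indRep`). Averaging the induced character over the projective Pauli group against
`sigma1` recovers the inflated one (`indChar_average`), which gives injectivity. -/

lemma isIrreducible_of_forall {W : Type*} [AddCommGroup W] [Module ℂ W] [Nontrivial W]
    (ρ : Representation ℂ G W)
    (h : ∀ M : Submodule ℂ W, (∀ g, ∀ v ∈ M, ρ g v ∈ M) → M ≠ ⊥ → M = ⊤) :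
    ρ.IsIrreducible where
  exists_pair_ne := ⟨⊥, ⊤, fun e => bot_ne_top (α := Submodule ℂ W)
    (congrArg Subrepresentation.toSubmodule e)⟩
  eq_bot_or_eq_top M := by
    by_cases hM : M.toSubmodule = ⊥
    · exact Or.inl (Subrepresentation.toSubmodule_injective hM)
    · exact Or.inr (Subrepresentation.toSubmodule_injective
        (h M.toSubmodule (fun g v hv => M.apply_mem_toSubmodule g hv) hM))

lemma eq_top_of_isIrreducible {W : Type*} [AddCommGroup W] [Module ℂ W]
    (ρ : Representation ℂ G W) [hρ : ρ.IsIrreducible] (M : Submodule ℂ W)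
    (hM : ∀ g, ∀ v ∈ M, ρ g v ∈ M) (hb : M ≠ ⊥) : M = ⊤ := by
  rcases hρ.eq_bot_or_eq_top ⟨M, fun g v hv => hM g v hv⟩ with h | h
  · exact absurd (congrArg Subrepresentation.toSubmodule h) hb
  · exact congrArg Subrepresentation.toSubmodule h

lemma nontrivial_of_isIrreducible {W : Type*} [AddCommGroup W] [Module ℂ W]
    (ρ : Representation ℂ G W) [hρ : ρ.IsIrreducible] : Nontrivial W := by
  obtain ⟨M, M', h⟩ := hρ.exists_pair_ne
  by_contra hW
  rw [not_nontrivial_iff_subsingleton] at hW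
  exact h (Subrepresentation.toSubmodule_injective (Subsingleton.elim _ _))

/-- The inclusion of a nonzero invariant subspace is a nonzero monomorphism into a simple object,
hence an isomorphism, hence onto. -/
lemma isIrreducible_of_simple (V : FDRep ℂ G) [Simple V] :
    IsIrreducible (V.ρ : Representation ℂ G V) := by
  have : Nontrivial V := by
    by_contra hW
    rw [not_nontrivial_iff_subsingleton] at hW
    refine id_nonzero V ?_
    ext x
    exact Subsingleton.elim _ _
  refine isIrreducible_of_forall _ fun M hM hb => ?_
  let ρM : Representation ℂ G M := Subrepresentation.toRepresentation ⟨M, fun g v hv => hM g v hv⟩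
  let ι : FDRep.of ρM ⟶ V := ⟨FGModuleCat.ofHom M.subtype, fun g => by ext x; rfl⟩
  have hinj : Function.Injective ι.hom := fun x y h => Subtype.ext h
  have : Mono ι := by
    have : Mono ι.hom := ConcreteCategory.mono_of_injective _ hinj
    exact (Action.forget (FGModuleCat ℂ) G).mono_of_mono_map this
  have hne : ι ≠ 0 := by
    intro h0
    apply hb
    rw [Submodule.eq_bot_iff]
    intro x hx
    have : ι.hom ⟨x, hx⟩ = (0 : FDRep.of ρM ⟶ V).hom ⟨x, hx⟩ := by rw [h0]
    exact this
  have hiso : IsIso ι := (Simple.mono_isIso_iff_nonzero ι).mpr hne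
  rw [Submodule.eq_top_iff']
  intro x
  have hx : ι.hom ((inv ι).hom x) = x := by
    have : (inv ι ≫ ι).hom x = x := by rw [IsIso.inv_hom_id]; rfl
    exact this
  rw [← hx]
  exact ((inv ι).hom x : M).2

/-- This moves between simple objects of `FDRep` and concrete representations, on which the twist
and the induction are built. The converse direction uses that a character of norm one is that of a
simple object. -/
lemma isIrrChar_iff [Finite G] (f : G → ℂ) :
    IsIrrChar f ↔ ∃ (W : Type) (_ : AddCommGroup W) (_ : Module ℂ W) (_ : FiniteDimensional ℂ W)
      (ρ : Representation ℂ G W), ρ.IsIrreducible ∧ ρ.character = f := by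
  constructor
  · rintro ⟨V, hV, rfl⟩
    exact ⟨V, inferInstance, inferInstance, inferInstance, V.ρ, isIrreducible_of_simple V, rfl⟩
  · rintro ⟨W, _, _, _, ρ, hρ, rfl⟩
    refine ⟨FDRep.of ρ, ?_, rfl⟩
    have := Fintype.ofFinite G
    have : Invertible (Nat.card G : ℂ) := invertibleOfNonzero (by simp)
    rw [FDRep.simple_iff_char_is_norm_one]
    have h := char_orthonormal ρ ρ
    rw [if_pos ⟨Representation.Equiv.refl ρ⟩, inv_mul_eq_one₀ (by simp)] at h
    exact h.symm

lemma isIrreducible_comp {Q : Type} [Group Q] {W : Type*} [AddCommGroup W] [Module ℂ W]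
    (ρ : Representation ℂ Q W) [ρ.IsIrreducible] (π : G →* Q) (hπ : Function.Surjective π) :
    IsIrreducible (ρ.comp π : Representation ℂ G W) := by
  have := nontrivial_of_isIrreducible ρ
  refine isIrreducible_of_forall _ fun M hM hb => eq_top_of_isIrreducible ρ M ?_ hb
  intro q v hv
  obtain ⟨g, rfl⟩ := hπ q
  exact hM g v hv

/-- The tensor product of a representation with a linear character. -/
def linTwist {W : Type*} [AddCommGroup W] [Module ℂ W]
    (ρ : Representation ℂ G W) (σ : G →* ℂˣ) : Representation ℂ G W where
  toFun g := (σ g : ℂ) • ρ g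
  map_one' := by simp
  map_mul' g h := by
    ext v
    simp [smul_smul, mul_comm]

lemma isIrreducible_linTwist {W : Type*} [AddCommGroup W] [Module ℂ W]
    (ρ : Representation ℂ G W) [ρ.IsIrreducible] (σ : G →* ℂˣ) :
    (linTwist ρ σ).IsIrreducible := by
  have := nontrivial_of_isIrreducible ρ
  refine isIrreducible_of_forall _ fun M hM hb => eq_top_of_isIrreducible ρ M ?_ hb
  intro g v hv
  have h := M.smul_mem ((σ g : ℂ)⁻¹) (hM g v hv)
  simpa [linTwist, smul_smul] using h

lemma character_linTwist {W : Type*} [AddCommGroup W] [Module ℂ W]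
    (ρ : Representation ℂ G W) (σ : G →* ℂˣ) (g : G) :
    (linTwist ρ σ).character g = ρ.character g * σ g := by
  simp [Representation.character, linTwist, mul_comm]

end Rep

/-! ## Twisting a representation along a bijection of groups -/

section Twist

variable {A B Y : Type} [Group A] [Group B] [MulAction A Y] [Fintype Y] [DecidableEq Y]
  {W : Type} [AddCommGroup W] [Module ℂ W]

/-- Data for twisting a representation `ρ` of `B` to a representation of `A` along a map
`φ : A → B`: a system of orthogonal projections permuted by `A`, and scalars correcting the failure
of `φ` to be multiplicative on the range of each projection. -/
structure TwistDatum (ρ : Representation ℂ B W) (φ : A → B) (P : Y → Module.End ℂ W)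
    (c : A → Y → ℂ) : Prop where
  mul : ∀ y z, P y * P z = if y = z then P y else 0
  sum : ∑ y, P y = 1
  equivariant : ∀ a y, ρ (φ a) * P y = P (a • y) * ρ (φ a)
  cocycle : ∀ a b y, c (a * b) y • (ρ (φ (a * b)) * P y)
    = (c a (b • y) * c b y) • (ρ (φ a) * ρ (φ b) * P y)
  fixed : ∀ a y, a • y = y → c a y = 1
  ne_zero : ∀ a y, c a y ≠ 0
  one : φ 1 = 1

variable {ρ : Representation ℂ B W} {φ : A → B} {P : Y → Module.End ℂ W} {c : A → Y → ℂ}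

lemma TwistDatum.mul_sum (D : TwistDatum ρ φ P c) (f : Y → ℂ) (y : Y) :
    (∑ z, f z • P z) * P y = f y • P y := by
  rw [Finset.sum_mul, Finset.sum_eq_single y]
  · rw [smul_mul_assoc, D.mul, if_pos rfl]
  · intro z _ hz
    rw [smul_mul_assoc, D.mul, if_neg hz, smul_zero]
  · simp

lemma TwistDatum.ext (D : TwistDatum ρ φ P c) {S T : Module.End ℂ W}
    (h : ∀ y, S * P y = T * P y) : S = T := by
  rw [← mul_one S, ← mul_one T, ← D.sum, Finset.mul_sum, Finset.mul_sum]
  exact Finset.sum_congr rfl fun y _ => h y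

/-- The twisted representation. -/
noncomputable def TwistDatum.rep (D : TwistDatum ρ φ P c) : Representation ℂ A W where
  toFun a := ρ (φ a) * ∑ y, c a y • P y
  map_one' := by
    simp [D.one, D.fixed 1 _ (one_smul A _), D.sum]
  map_mul' a b := by
    -- On the range of one projection each correcting sum is a single scalar, so multiplicativity
    -- becomes the `cocycle` identity.
    refine D.ext fun y => ?_
    simp only [mul_assoc]
    rw [D.mul_sum, D.mul_sum, mul_smul_comm, D.cocycle, mul_smul_comm, mul_smul_comm,
      mul_smul_comm, D.equivariant b, ← mul_assoc _ (P _) (ρ _), D.mul_sum, smul_mul_assoc,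
      mul_smul_comm, smul_smul, ← D.equivariant, mul_comm, mul_assoc]

lemma TwistDatum.rep_apply (D : TwistDatum ρ φ P c) (a : A) :
    D.rep a = ρ (φ a) * ∑ y, c a y • P y := rfl

/-- Since `P y` is idempotent, cyclicity of the trace brings `P y` next to `P (a • y)`, and these
are orthogonal. -/
lemma TwistDatum.trace_eq_zero (D : TwistDatum ρ φ P c) [FiniteDimensional ℂ W] {a : A} {y : Y}
    (h : a • y ≠ y) : LinearMap.trace ℂ W (ρ (φ a) * P y) = 0 := by
  have h1 : ρ (φ a) * P y = ρ (φ a) * P y * P y := by rw [mul_assoc, D.mul, if_pos rfl]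
  rw [h1, LinearMap.trace_mul_comm, D.equivariant, ← mul_assoc, D.mul, if_neg h.symm, zero_mul,
    map_zero]

/-- Only the blocks fixed by `a` contribute to the trace, and there the correcting scalar is 1. -/
lemma TwistDatum.character_rep (D : TwistDatum ρ φ P c) [FiniteDimensional ℂ W] :
    D.rep.character = ρ.character ∘ φ := by
  funext a
  have h1 : ρ (φ a) = ρ (φ a) * ∑ y, P y := by rw [D.sum, mul_one]
  simp only [Representation.character, D.rep_apply, Function.comp_apply]
  conv_rhs => rw [h1]
  rw [Finset.mul_sum, Finset.mul_sum, map_sum, map_sum]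
  refine Finset.sum_congr rfl fun y _ => ?_
  by_cases h : a • y = y
  · rw [D.fixed a y h, one_smul]
  · rw [mul_smul_comm, map_smul, D.trace_eq_zero h, smul_zero]

/-- The operators `ρ (φ a)` and `D.rep a` differ by an invertible scalar on each block, so a
subspace stable under `D.rep` and all projections is stable under `ρ`. -/
lemma TwistDatum.isIrreducible_rep (D : TwistDatum ρ φ P c) [hρ : ρ.IsIrreducible]
    (hφ : Function.Surjective φ)
    (hP : ∀ M : Submodule ℂ W, (∀ a, ∀ v ∈ M, D.rep a v ∈ M) → ∀ y, ∀ v ∈ M, P y v ∈ M) :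
    D.rep.IsIrreducible := by
  have := nontrivial_of_isIrreducible ρ
  refine isIrreducible_of_forall _ fun M hM hb => eq_top_of_isIrreducible ρ M ?_ hb
  intro b v hv
  obtain ⟨a, rfl⟩ := hφ b
  have key : ρ (φ a) = D.rep a * ∑ y, (c a y)⁻¹ • P y := by
    refine D.ext fun y => ?_
    rw [mul_assoc, D.mul_sum, mul_smul_comm, D.rep_apply, mul_assoc, D.mul_sum, mul_smul_comm,
      smul_smul, inv_mul_cancel₀ (D.ne_zero a y), one_smul]
  rw [key, Module.End.mul_apply, LinearMap.sum_apply]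
  exact hM _ _ (M.sum_mem fun y _ => M.smul_mem _ (hP M hM y v hv))

end Twist

end

section

/-! ## Induction from an inertia group -/

section Ind

variable {G : Type} [Group G]

open Classical in
/-- The extension by zero of a function on a subgroup. -/
noncomputable def extendZero (H : Subgroup G) {R : Type*} [Zero R] (f : H → R) (g : G) : R :=
  if h : g ∈ H then f ⟨g, h⟩ else 0

lemma extendZero_of_mem {H : Subgroup G} {R : Type*} [Zero R] (f : H → R) {g : G} (h : g ∈ H) :
    extendZero H f g = f ⟨g, h⟩ := dif_pos h

lemma extendZero_of_notMem {H : Subgroup G} {R : Type*} [Zero R] (f : H → R) {g : G}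
    (h : g ∉ H) : extendZero H f g = 0 := dif_neg h

lemma extendZero_mul {H : Subgroup G} {R : Type*} [MonoidWithZero R] (f : H →* R) {g h : G}
    (hg : g ∈ H) (hh : h ∈ H) :
    extendZero H f (g * h) = extendZero H f g * extendZero H f h := by
  rw [extendZero_of_mem f hg, extendZero_of_mem f hh, extendZero_of_mem f (mul_mem hg hh),
    ← map_mul]
  rfl

lemma extendZero_conj {H : Subgroup G} {R : Type*} [Zero R] {f : H → R}
    (hf : ∀ x y : H, f (y⁻¹ * x * y) = f x) (g : G) {h : G} (hh : h ∈ H) :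
    extendZero H f (h⁻¹ * g * h) = extendZero H f g := by
  by_cases hg : g ∈ H
  · rw [extendZero_of_mem f hg, extendZero_of_mem f (mul_mem (mul_mem (inv_mem hh) hg) hh)]
    exact hf ⟨g, hg⟩ ⟨h, hh⟩
  · rw [extendZero_of_notMem f hg, extendZero_of_notMem]
    intro hc
    apply hg
    have := mul_mem (mul_mem hh hc) (inv_mem hh)
    simpa [mul_assoc] using this

lemma indChar_eq_sum [Fintype G] (H : Subgroup G) (f : H → ℂ) (g : G) :
    indChar H f g = (Nat.card H : ℂ)⁻¹ * ∑ r : G, extendZero H f (r⁻¹ * g * r) := by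
  unfold indChar
  rw [finsum_eq_sum_of_fintype]
  rfl

/-- For a class function on `H` the summand is constant on each left coset, and each coset has `|H|`
elements. -/
lemma indChar_eq_sum_quotient [Finite G] (H : Subgroup G) [Fintype (G ⧸ H)] (f : H → ℂ)
    (hf : ∀ x y : H, f (y⁻¹ * x * y) = f x) (g : G) :
    indChar H f g = ∑ c : G ⧸ H, extendZero H f (c.out⁻¹ * g * c.out) := by
  classical
  have := Fintype.ofFinite G
  rw [indChar_eq_sum, inv_mul_eq_iff_eq_mul₀ (by simp), Finset.mul_sum,
    ← Finset.sum_fiberwise _ (fun r : G => (r : G ⧸ H))]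
  refine Finset.sum_congr rfl fun c _ => ?_
  rw [Finset.sum_congr rfl (g := fun _ => extendZero H f (c.out⁻¹ * g * c.out)), Finset.sum_const,
    nsmul_eq_mul]
  · congr 2
    rw [← Nat.card_congr (Subgroup.leftCosetEquivSubgroup (c.out : G)), ← Fintype.card_subtype,
      Fintype.card_eq_nat_card]
    refine Nat.card_congr (Equiv.subtypeEquivRight fun r => ?_)
    rw [mem_leftCoset_iff, SetLike.mem_coe, ← QuotientGroup.eq, QuotientGroup.out_eq', eq_comm]
  · intro r hr
    rw [Finset.mem_filter_univ] at hr
    have hm : c.out⁻¹ * r ∈ H := by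
      rw [← QuotientGroup.eq, hr, QuotientGroup.out_eq']
    rw [← extendZero_conj hf (c.out⁻¹ * g * c.out) hm]
    congr 1
    group

variable {W : Type} [AddCommGroup W] [Module ℂ W]

/-- `T` is a sum of block maps from position `σ c` to position `c`, and only diagonal blocks have a
trace. -/
lemma trace_permuted_blocks {ι : Type} [Fintype ι] [DecidableEq ι] [FiniteDimensional ℂ W]
    (σ : ι → ι) (A : ι → Module.End ℂ W) (T : Module.End ℂ (ι → W))
    (hT : ∀ f c, T f c = A c (f (σ c))) :
    LinearMap.trace ℂ (ι → W) T = ∑ c, if σ c = c then LinearMap.trace ℂ W (A c) else 0 := by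
  have h : T = ∑ c, LinearMap.single ℂ (fun _ : ι => W) c ∘ₗ (A c ∘ₗ LinearMap.proj (σ c)) := by
    refine LinearMap.ext fun f => funext fun d => ?_
    rw [hT, LinearMap.sum_apply, Finset.sum_apply, Finset.sum_eq_single d]
    · simp
    · intro c _ hc
      simp [Pi.single_eq_of_ne hc.symm]
    · simp
  rw [h, map_sum]
  refine Finset.sum_congr rfl fun c _ => ?_
  rw [LinearMap.trace_comp_comm']
  split_ifs with hc
  · congr 1
    ext w
    simp [hc]
  · rw [← map_zero (LinearMap.trace ℂ W)]
    congr 1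
    ext w
    simp [Pi.single_eq_of_ne hc]

lemma out_mul_out_mem_iff (H : Subgroup G) (g : G) (c d : G ⧸ H) :
    d.out⁻¹ * g * c.out ∈ H ↔ d = g • c := by
  rw [mul_assoc, ← QuotientGroup.eq, QuotientGroup.out_eq', ← smul_eq_mul,
    ← MulAction.Quotient.smul_coe, QuotientGroup.out_eq']

lemma out_conj_mem_iff (H : Subgroup G) (g : G) (c : G ⧸ H) :
    c.out⁻¹ * g * c.out ∈ H ↔ g⁻¹ • c = c := by
  rw [out_mul_out_mem_iff, inv_smul_eq_iff]

/-- The induced representation, realised on functions on the coset space. -/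
noncomputable def indRep {H : Subgroup G} (ρ : Representation ℂ H W) :
    Representation ℂ G (G ⧸ H → W) where
  toFun g :=
    { toFun := fun f c => extendZero H ρ (c.out⁻¹ * g * (g⁻¹ • c).out) (f (g⁻¹ • c))
      map_add' := fun f f' => by ext c; simp
      map_smul' := fun a f => by ext c; simp }
  map_one' := by
    refine LinearMap.ext fun f => funext fun c => ?_
    have h : c.out⁻¹ * 1 * ((1 : G)⁻¹ • c).out = 1 := by simp
    simp only [LinearMap.coe_mk, AddHom.coe_mk]
    rw [h, extendZero_of_mem ρ (one_mem H)]
    have : (⟨1, one_mem H⟩ : H) = 1 := rfl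
    simp [this]
  map_mul' g h := by
    -- Since `g` carries the coset `g⁻¹ • c` to `c`, the comparison of representatives lies in `H`,
    -- and the zero default of `extendZero` is never reached.
    have mem : ∀ (g : G) (c : G ⧸ H), c.out⁻¹ * g * (g⁻¹ • c).out ∈ H := fun g c =>
      (out_mul_out_mem_iff H g _ _).mpr (smul_inv_smul g c).symm
    refine LinearMap.ext fun f => funext fun c => ?_
    have e : (g * h)⁻¹ • c = h⁻¹ • g⁻¹ • c := by rw [mul_inv_rev, mul_smul]
    simp only [LinearMap.coe_mk, AddHom.coe_mk, Module.End.mul_apply]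
    rw [e, ← Module.End.mul_apply, ← extendZero_mul ρ (mem _ _) (mem _ _)]
    congr 2
    group

lemma indRep_apply {H : Subgroup G} (ρ : Representation ℂ H W) (g : G) (f : G ⧸ H → W)
    (c : G ⧸ H) : indRep ρ g f c
      = extendZero H ρ (c.out⁻¹ * g * (g⁻¹ • c).out) (f (g⁻¹ • c)) := rfl

lemma character_indRep [Finite G] {H : Subgroup G} [FiniteDimensional ℂ W]
    (ρ : Representation ℂ H W) : (indRep ρ).character = indChar H ρ.character := by
  classical
  have := Fintype.ofFinite (G ⧸ H)
  funext g
  rw [indChar_eq_sum_quotient H ρ.character]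
  · rw [Representation.character, trace_permuted_blocks (fun c => g⁻¹ • c) _ _
      fun f c => indRep_apply ρ g f c]
    refine Finset.sum_congr rfl fun c _ => ?_
    split_ifs with hc
    · have hm := (out_conj_mem_iff H g c).mpr hc
      rw [hc, extendZero_of_mem ρ hm, extendZero_of_mem _ hm, Representation.character]
    · rw [extendZero_of_notMem _ fun hm => hc ((out_conj_mem_iff H g c).mp hm)]
  · intro x y
    have := ρ.char_conj x y⁻¹
    rwa [inv_inv] at this

/-! ### The Clifford correspondence over a linear character -/

variable {N : Subgroup G} [N.Normal] {σ : N →* ℂˣ}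

/-- Orthogonality of the conjugates of `σ` along different cosets of the inertia group. -/
lemma sum_conj_eq [Fintype N] (a b : G) :
    ∑ x : N, ((σ (MulAut.conjNormal a⁻¹ x) : ℂˣ) : ℂ) * ((σ (MulAut.conjNormal b⁻¹ x))⁻¹ : ℂˣ)
      = extendZero (inertiaSubgroup N σ) (fun _ => (Nat.card N : ℂ)) (b⁻¹ * a) := by
  let f : N →* ℂ := (Units.coeHom ℂ).comp
    ((σ.comp (MulAut.conjNormal a⁻¹).toMonoidHom) * (σ.comp (MulAut.conjNormal b⁻¹).toMonoidHom)⁻¹)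
  have hf : ∀ x, f x = ((σ (MulAut.conjNormal a⁻¹ x) : ℂˣ) : ℂ)
      * ((σ (MulAut.conjNormal b⁻¹ x))⁻¹ : ℂˣ) := fun x => rfl
  have hconj : ∀ y : N, MulAut.conjNormal (a⁻¹ * b) y
      = MulAut.conjNormal a⁻¹ (MulAut.conjNormal b y) := fun y => by
    rw [map_mul, MulAut.mul_apply]
  have hb : ∀ y : N, MulAut.conjNormal b (MulAut.conjNormal b⁻¹ y) = y := fun y => by
    ext; simp [mul_assoc]
  have hb' : ∀ y : N, MulAut.conjNormal b⁻¹ (MulAut.conjNormal b y) = y := fun y => by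
    ext; simp [mul_assoc]
  -- The summand is itself a linear character of `N`, trivial exactly when `a` and `b` conjugate `σ`
  -- to the same character. Otherwise its sum vanishes.
  have key : b⁻¹ * a ∈ inertiaSubgroup N σ ↔ f = 1 := by
    constructor
    · intro h
      ext x
      have h1 := h (MulAut.conjNormal b⁻¹ x)
      rw [mul_inv_rev, inv_inv, hconj, hb] at h1
      rw [hf, h1]
      simp
    · intro h x
      have h1 := DFunLike.congr_fun h (MulAut.conjNormal b x)
      rw [hf, ← Units.val_mul, MonoidHom.one_apply, Units.val_eq_one, mul_inv_eq_one,
        hb'] at h1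
      rw [mul_inv_rev, inv_inv, hconj, h1]
  rw [← Finset.sum_congr rfl fun x _ => hf x]
  by_cases h : b⁻¹ * a ∈ inertiaSubgroup N σ
  · rw [extendZero_of_mem _ h, key.mp h]
    simp
  · rw [extendZero_of_notMem _ h, sum_hom_units_eq_zero f (fun h' => h (key.mpr h'))]

/-- **Clifford correspondence**: induction from the inertia group of `σ` preserves irreducibility
for representations lying over `σ`. -/
lemma isIrreducible_indRep [Finite G] {H : Subgroup G} (hH : H = inertiaSubgroup N σ) (hNH : N ≤ H)
    (ρ : Representation ℂ H W) [hρ : ρ.IsIrreducible]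
    (hN : ∀ x : N, ρ ⟨x, hNH x.2⟩ = (σ x : ℂ) • 1) : (indRep ρ).IsIrreducible := by
  subst hH
  classical
  have := Fintype.ofFinite N
  let H := inertiaSubgroup N σ
  have := nontrivial_of_isIrreducible ρ
  have : Nonempty (G ⧸ H) := ⟨((1 : G) : G ⧸ H)⟩
  -- the action of `N`
  have actN : ∀ (x : N) (f : G ⧸ H → W) (c : G ⧸ H),
      indRep ρ x f c = (σ (MulAut.conjNormal c.out⁻¹ x) : ℂ) • f c := by
    intro x f c
    have e : c.out⁻¹ * (x : G) * c.out = (MulAut.conjNormal c.out⁻¹ x : N) := by simp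
    have hm : c.out⁻¹ * (x : G) * c.out ∈ H := by
      rw [e]; exact le_inertiaSubgroup N σ (Subtype.prop _)
    rw [indRep_apply, (out_conj_mem_iff H x c).mp hm, extendZero_of_mem ρ hm]
    have := hN (MulAut.conjNormal c.out⁻¹ x)
    simp only [← e] at this
    rw [this]
    simp
  -- the action on functions supported on one coset
  have actS : ∀ (g : G) (c d : G ⧸ H) (w : W), g • c = d →
      indRep ρ g (Pi.single c w) = Pi.single d (extendZero H ρ (d.out⁻¹ * g * c.out) w) := by
    rintro g c d w rfl
    funext e
    rw [indRep_apply]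
    by_cases h : e = g • c
    · subst h
      simp
      rfl
    · have h' : g⁻¹ • e ≠ c := fun h' => h (by rw [← h', smul_inv_smul])
      rw [Pi.single_eq_of_ne h', map_zero, Pi.single_eq_of_ne h]
  refine isIrreducible_of_forall _ fun M hM hb => ?_
  obtain ⟨f, hfM, hf⟩ := (Submodule.ne_bot_iff M).mp hb
  obtain ⟨c, hc⟩ := Function.ne_iff.mp hf
  -- Different cosets carry different conjugates of `σ`, so averaging `f` over `N` against the
  -- conjugate at `c` kills every other component.
  have hsingle : Pi.single c (f c) ∈ M := by
    have h1 : (∑ x : N, (((σ (MulAut.conjNormal c.out⁻¹ x))⁻¹ : ℂˣ) : ℂ) • indRep ρ x f) ∈ M :=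
      M.sum_mem fun x _ => M.smul_mem _ (hM _ _ hfM)
    have h2 : (∑ x : N, (((σ (MulAut.conjNormal c.out⁻¹ x))⁻¹ : ℂˣ) : ℂ) • indRep ρ x f)
        = (Nat.card N : ℂ) • Pi.single c (f c) := by
      funext d
      rw [Finset.sum_apply]
      simp only [Pi.smul_apply, actN, smul_smul]
      rw [← Finset.sum_smul]
      rw [Finset.sum_congr rfl fun x _ => mul_comm _ _, sum_conj_eq]
      by_cases hd : d = c
      · subst hd
        rw [extendZero_of_mem _ (by simp), Pi.single_eq_same]
      · rw [Pi.single_eq_of_ne hd, extendZero_of_notMem, zero_smul, smul_zero]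
        intro hm
        rw [← QuotientGroup.eq, QuotientGroup.out_eq', QuotientGroup.out_eq'] at hm
        exact hd hm.symm
    rw [h2] at h1
    exact (M.smul_mem_iff (by simp)).mp h1
  -- The vectors whose copy at `c` lies in `M` are stable under `H`, through the conjugate of `H`
  -- that stabilizes `c`. Irreducibility of `ρ` makes them everything.
  have htop : M.comap (LinearMap.single ℂ (fun _ : G ⧸ H => W) c) = ⊤ := by
    refine eq_top_of_isIrreducible ρ _ ?_ ?_
    · intro h w hw
      have hg : (c.out * (h : G) * c.out⁻¹) • c = c := by
        rw [eq_comm, ← out_mul_out_mem_iff]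
        simp [mul_assoc]
      have h1 := hM (c.out * h * c.out⁻¹) _ hw
      rw [LinearMap.single_apply, actS _ c c w hg] at h1
      have e : c.out⁻¹ * (c.out * (h : G) * c.out⁻¹) * c.out = h := by group
      rw [e, extendZero_of_mem ρ h.2] at h1
      exact h1
    · rw [Submodule.ne_bot_iff]
      exact ⟨f c, hsingle, hc⟩
  -- The element `d.out * c.out⁻¹` carries position `c` to position `d` and acts on the value as the
  -- identity.
  have hall : ∀ (d : G ⧸ H) (w : W), Pi.single d w ∈ M := by
    intro d w
    have hg : (d.out * c.out⁻¹) • c = d := by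
      rw [eq_comm, ← out_mul_out_mem_iff]
      simp [mul_assoc]
    have hw : w ∈ M.comap (LinearMap.single ℂ (fun _ : G ⧸ H => W) c) := by rw [htop]; trivial
    have h1 := hM (d.out * c.out⁻¹) _ hw
    rw [LinearMap.single_apply, actS _ c d w hg] at h1
    have e : d.out⁻¹ * (d.out * c.out⁻¹) * c.out = 1 := by group
    rw [e, extendZero_of_mem ρ (one_mem H)] at h1
    have e1 : (⟨1, one_mem H⟩ : H) = 1 := rfl
    rw [e1, map_one, Module.End.one_apply] at h1
    exact h1
  rw [Submodule.eq_top_iff']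
  intro f'
  have := Fintype.ofFinite (G ⧸ H)
  rw [← Finset.univ_sum_single f']
  exact M.sum_mem fun d _ => hall d _

/-- A class function of the inertia group lying over `σ` can be recovered from the function
induced by it. -/
lemma indChar_average [Finite G] [Fintype N] {H : Subgroup G} (hH : H = inertiaSubgroup N σ)
    (hNH : N ≤ H) (f : H → ℂ) (hf : ∀ x y, f (y⁻¹ * x * y) = f x)
    (hN : ∀ (x : N) (h : H), f (⟨x, hNH x.2⟩ * h) = σ x * f h) (h : H) :
    ∑ x : N, (((σ x)⁻¹ : ℂˣ) : ℂ) * indChar H f (x * h) = Nat.card N * f h := by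
  subst hH
  classical
  have := Fintype.ofFinite (G ⧸ inertiaSubgroup N σ)
  have hmul : ∀ (x : N) (r : G), extendZero (inertiaSubgroup N σ) f (r⁻¹ * (x * h) * r)
      = σ (MulAut.conjNormal r⁻¹ x) * extendZero (inertiaSubgroup N σ) f (r⁻¹ * h * r) := by
    intro x r
    have e : r⁻¹ * (x * h) * r = (MulAut.conjNormal r⁻¹ x : N) * (r⁻¹ * h * r) := by
      simp [mul_assoc]
    have hx : ((MulAut.conjNormal r⁻¹ x : N) : G) ∈ inertiaSubgroup N σ :=
      le_inertiaSubgroup N σ (Subtype.prop _)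
    rw [e]
    by_cases hm : r⁻¹ * (h : G) * r ∈ inertiaSubgroup N σ
    · rw [extendZero_of_mem f hm, extendZero_of_mem f (mul_mem hx hm)]
      exact hN (MulAut.conjNormal r⁻¹ x) ⟨_, hm⟩
    · rw [extendZero_of_notMem f hm, extendZero_of_notMem, mul_zero]
      intro hc
      exact hm ((Subgroup.mul_mem_cancel_left _ hx).mp hc)
  simp only [indChar_eq_sum_quotient (inertiaSubgroup N σ) f hf, Finset.mul_sum]
  rw [Finset.sum_comm]
  -- By orthogonality with the unconjugated `σ`, the average retains only cosets whose
  -- representative lies in the inertia group, that is, the trivial coset.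
  have inner : ∀ c : G ⧸ inertiaSubgroup N σ,
      ∑ x : N, (((σ x)⁻¹ : ℂˣ) : ℂ)
        * extendZero (inertiaSubgroup N σ) f (c.out⁻¹ * (x * h) * c.out)
      = extendZero (inertiaSubgroup N σ) (fun _ => (Nat.card N : ℂ)) c.out
        * extendZero (inertiaSubgroup N σ) f (c.out⁻¹ * h * c.out) := by
    intro c
    have h1 := sum_conj_eq (σ := σ) c.out 1
    simp only [inv_one, map_one, MulAut.one_apply, one_mul] at h1
    rw [← h1, Finset.sum_mul]
    refine Finset.sum_congr rfl fun x _ => ?_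
    rw [hmul]
    ring
  rw [Finset.sum_congr rfl fun c _ => inner c,
    Finset.sum_eq_single ((1 : G) : G ⧸ inertiaSubgroup N σ)]
  -- The chosen representative of the trivial coset need not be 1; it lies in the inertia group, and
  -- invariance of `f` under conjugation removes it.
  · have hm : (((1 : G) : G ⧸ inertiaSubgroup N σ)).out ∈ inertiaSubgroup N σ := by
      have : (1 : G)⁻¹ * (((1 : G) : G ⧸ inertiaSubgroup N σ)).out ∈ inertiaSubgroup N σ := by
        rw [← QuotientGroup.eq, QuotientGroup.out_eq']
      simpa using this
    rw [extendZero_conj hf _ hm, extendZero_of_mem _ hm, extendZero_of_mem _ h.2]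
  · intro c _ hc
    rw [extendZero_of_notMem, zero_mul]
    intro hm
    apply hc
    rw [← QuotientGroup.out_eq' c, eq_comm, QuotientGroup.eq]
    simpa using hm
  · simp

end Ind

end

section

/-! ## Signs and the symplectic form -/

/-- The sign `(-1)^a`, `a ∈ ℤ₂`. -/
def sg (a : ZMod 2) : ℂˣ := (-1) ^ a.val

lemma sg_zero : sg 0 = 1 := by simp [sg]

lemma sg_one : sg 1 = -1 := by
  have ho : (1 : ZMod 2).val = 1 := rfl
  simp [sg, ho]

lemma sg_add (a b : ZMod 2) : sg (a + b) = sg a * sg b := by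
  have h11 : (1 + 1 : ZMod 2) = 0 := rfl
  rcases zmod_two_cases a with rfl | rfl <;> rcases zmod_two_cases b with rfl | rfl <;>
    simp [sg_zero, sg_one, h11]

lemma sg_mul_self (a : ZMod 2) : sg a * sg a = 1 := by
  rw [← sg_add, CharTwo.add_self_eq_zero, sg_zero]

lemma sg_inv (a : ZMod 2) : (sg a)⁻¹ = sg a := inv_eq_of_mul_eq_one_left (sg_mul_self a)

lemma neg_one_ne_one_units : (-1 : ℂˣ) ≠ 1 := by
  intro h
  have := congrArg Units.val h
  norm_num at this

lemma sg_injective : Function.Injective sg := by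
  intro a b h
  rcases zmod_two_cases a with rfl | rfl <;> rcases zmod_two_cases b with rfl | rfl
  · rfl
  · rw [sg_zero, sg_one] at h; exact absurd h.symm neg_one_ne_one_units
  · rw [sg_zero, sg_one] at h; exact absurd h neg_one_ne_one_units
  · rfl

lemma sg_sum {ι : Type*} (s : Finset ι) (f : ι → ZMod 2) :
    sg (∑ i ∈ s, f i) = ∏ i ∈ s, sg (f i) := by
  classical
  induction s using Finset.induction_on with
  | empty => simp [sg_zero]
  | insert i s hi ih => rw [Finset.sum_insert hi, Finset.prod_insert hi, sg_add, ih]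

/-- A character of order two of an elementary abelian `2`-group comes from a linear functional. -/
lemma exists_functional {F : Type*} [AddCommGroup F] [Module (ZMod 2) F] (s : F → ℂˣ)
    (hadd : ∀ x y, s (x + y) = s x * s y) (hsq : ∀ x, s x * s x = 1) :
    ∃ l : F →ₗ[ZMod 2] ZMod 2, ∀ x, s x = sg (l x) := by
  classical
  have h : ∀ x, ∃ a, s x = sg a := by
    intro x
    have h1 : ((s x : ℂˣ) : ℂ) * s x = 1 := by rw [← Units.val_mul, hsq, Units.val_one]
    rcases mul_self_eq_one_iff.mp h1 with h2 | h2
    · exact ⟨0, by rw [sg_zero]; exact Units.ext h2⟩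
    · exact ⟨1, by rw [sg_one]; exact Units.ext (by rw [h2]; simp)⟩
  choose l hl using h
  let l' : F →+ ZMod 2 := AddMonoidHom.mk' l fun x y => sg_injective (by
    rw [← hl, hadd, hl, hl, sg_add])
  exact ⟨l'.toZModLinearMap 2, hl⟩

variable {n : ℕ}

/-- The symplectic form on `ℤ₂²ⁿ`. -/
def om (x y : V n) : ZMod 2 :=
  ∑ k, (x (Sum.inl k) * y (Sum.inr k) + x (Sum.inr k) * y (Sum.inl k))

lemma om_add_left (x y z : V n) : om (x + y) z = om x z + om y z := by
  simp only [om, ← Finset.sum_add_distrib, Pi.add_apply]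
  exact Finset.sum_congr rfl fun k _ => by ring

lemma om_comm (x y : V n) : om x y = om y x :=
  Finset.sum_congr rfl fun k _ => by ring

lemma om_add_right (x y z : V n) : om x (y + z) = om x y + om x z := by
  rw [om_comm, om_add_left, om_comm y, om_comm z]

lemma om_smul_left (a : ZMod 2) (x y : V n) : om (a • x) y = a * om x y := by
  simp only [om, Finset.mul_sum, Pi.smul_apply, smul_eq_mul]
  exact Finset.sum_congr rfl fun k _ => by ring

lemma om_smul_right (a : ZMod 2) (x y : V n) : om x (a • y) = a * om x y := by
  rw [om_comm, om_smul_left, om_comm]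

lemma om_self (x : V n) : om x x = 0 :=
  Finset.sum_eq_zero fun k _ => by rw [mul_comm, CharTwo.add_self_eq_zero]

lemma add_self_eq_zero (x : V n) : x + x = 0 := funext fun _ => CharTwo.add_self_eq_zero _

lemma om_zero_left (x : V n) : om 0 x = 0 := by simp [om]

lemma om_zero_right (x : V n) : om x 0 = 0 := by simp [om]

lemma om_single_inl (x : V n) (k : Fin n) : om x (Pi.single (Sum.inl k) 1) = x (Sum.inr k) := by
  simp [om, Pi.single_apply]

lemma om_single_inr (x : V n) (k : Fin n) : om x (Pi.single (Sum.inr k) 1) = x (Sum.inl k) := by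
  simp [om, Pi.single_apply]

lemma eq_zero_of_om (x : V n) (h : ∀ y, om x y = 0) : x = 0 := by
  funext k
  rcases k with k | k
  · rw [← om_single_inr x k, h]; rfl
  · rw [← om_single_inl x k, h]; rfl

/-- The form pairs each `p` coordinate with the matching `q` coordinate, so the coordinates of `z`
are the values of `l` on the basis with the two halves exchanged. -/
lemma exists_om_eq (l : V n →ₗ[ZMod 2] ZMod 2) : ∃ z : V n, ∀ x, l x = om z x := by
  refine ⟨Sum.elim (fun k => l (Pi.single (Sum.inr k) 1))
    (fun k => l (Pi.single (Sum.inl k) 1)), ?_⟩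
  intro x
  conv_lhs => rw [pi_eq_sum_univ' x, map_sum]
  rw [Fintype.sum_sum_type, add_comm, ← Finset.sum_add_distrib]
  refine Finset.sum_congr rfl fun k _ => ?_
  simp only [map_smul, smul_eq_mul, Sum.elim_inl, Sum.elim_inr]
  ring

/-- Over `ZMod 2` the sign in `Matrix.J` disappears, and `J` just exchanges the two halves. This
ties `om` to the defining condition of the symplectic group. -/
lemma om_eq_dotProduct (x y : V n) : om x y = x ⬝ᵥ (Matrix.J (Fin n) (ZMod 2) *ᵥ y) := by
  have e : Matrix.J (Fin n) (ZMod 2) *ᵥ y = Sum.elim (y ∘ Sum.inr) (y ∘ Sum.inl) := by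
    have hn : (-1 : Matrix (Fin n) (Fin n) (ZMod 2)) = 1 := by ext i j; simp [CharTwo.neg_eq]
    rw [Matrix.J, hn, ← Sum.elim_comp_inl_inr y, Matrix.fromBlocks_mulVec]
    simp
  rw [e, dotProduct, Fintype.sum_sum_type, ← Finset.sum_add_distrib]
  rfl

lemma om_mulVec (Γ : Sp n) (x y : V n) : om (Γ.1 *ᵥ x) (Γ.1 *ᵥ y) = om x y := by
  rw [om_eq_dotProduct, om_eq_dotProduct, Matrix.mulVec_mulVec, Matrix.dotProduct_mulVec,
    Matrix.vecMul_mulVec, ← Matrix.dotProduct_mulVec, ← Matrix.mul_assoc,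
    SymplecticGroup.mem_iff'.mp Γ.2]

/-- A linear map preserving the symplectic form, as an element of `Sp(2n,2)`. -/
lemma exists_symp (f : V n →ₗ[ZMod 2] V n) (hf : ∀ x y, om (f x) (f y) = om x y) :
    ∃ Γ : Sp n, ∀ x, Γ.1 *ᵥ x = f x := by
  refine ⟨⟨LinearMap.toMatrix' f, ?_⟩, fun x => LinearMap.toMatrix'_mulVec f x⟩
  rw [SymplecticGroup.mem_iff']
  ext i j
  have h := hf (Pi.single i 1) (Pi.single j 1)
  rw [← LinearMap.toMatrix'_mulVec, ← LinearMap.toMatrix'_mulVec, om_eq_dotProduct,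
    om_eq_dotProduct, Matrix.mulVec_mulVec, Matrix.dotProduct_mulVec,
    Matrix.vecMul_mulVec, ← Matrix.dotProduct_mulVec, ← Matrix.mul_assoc] at h
  simpa using h

lemma symp_ext {Γ Δ : Sp n} (h : ∀ x : V n, Γ.1 *ᵥ x = Δ.1 *ᵥ x) : Γ = Δ :=
  Subtype.ext (Matrix.ext_of_mulVec_single fun _ => h _)

lemma symp_mul_mulVec (Γ Δ : Sp n) (x : V n) : (Γ * Δ).1 *ᵥ x = Γ.1 *ᵥ (Δ.1 *ᵥ x) :=
  (Matrix.mulVec_mulVec x Γ.1 Δ.1).symm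

lemma symp_one_mulVec (x : V n) : (1 : Sp n).1 *ᵥ x = x := Matrix.one_mulVec x

lemma symp_inv_mulVec {Γ : Sp n} {x y : V n} (h : Γ.1 *ᵥ x = y) : (Γ⁻¹).1 *ᵥ y = x := by
  rw [← h, ← symp_mul_mulVec, inv_mul_cancel, symp_one_mulVec]

lemma symp_mulVec_injective (Γ : Sp n) {x y : V n} (h : Γ.1 *ᵥ x = Γ.1 *ᵥ y) : x = y := by
  rw [← symp_inv_mulVec h.symm, symp_inv_mulVec rfl]

/-! ## Weyl operators -/

lemma coe_weylU (x : V n) : (weylU x : QMat n)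
    = tensor fun k => (weylOne (x (Sum.inl k)) (x (Sum.inr k)) : Matrix (Fin 2) (Fin 2) ℂ) := rfl

lemma weylOne_comm (p q p' q' : ZMod 2) :
    (weylOne p q : Matrix (Fin 2) (Fin 2) ℂ) * (weylOne p' q' : Matrix (Fin 2) (Fin 2) ℂ)
      = (sg (p * q' + q * p') : ℂ) • ((weylOne p' q' : Matrix (Fin 2) (Fin 2) ℂ)
        * (weylOne p q : Matrix (Fin 2) (Fin 2) ℂ)) := by
  have ho : (1 : ZMod 2).val = 1 := rfl
  have h11 : (1 + 1 : ZMod 2) = 0 := rfl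
  rcases zmod_two_cases p with rfl | rfl <;> rcases zmod_two_cases q with rfl | rfl <;>
    rcases zmod_two_cases p' with rfl | rfl <;> rcases zmod_two_cases q' with rfl | rfl <;>
    ext a b <;> fin_cases a <;> fin_cases b <;>
    simp [weylOne, ho, h11, sg_zero, sg_one, uI, uX, uZ, matX, matZ, Matrix.mul_apply,
      Fin.sum_univ_two, Matrix.star_apply]

lemma weylOne_sq (p q : ZMod 2) :
    (weylOne p q : Matrix (Fin 2) (Fin 2) ℂ) * (weylOne p q : Matrix (Fin 2) (Fin 2) ℂ) = 1 := by
  have ho : (1 : ZMod 2).val = 1 := rfl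
  rcases zmod_two_cases p with rfl | rfl <;> rcases zmod_two_cases q with rfl | rfl <;>
    ext a b <;> fin_cases a <;> fin_cases b <;>
    simp [weylOne, ho, uI, uX, uZ, matX, matZ, Matrix.mul_apply,
      Fin.sum_univ_two, Matrix.star_apply]

lemma weylU_comm (x y : V n) :
    (weylU x : QMat n) * (weylU y : QMat n)
      = (sg (om x y) : ℂ) • ((weylU y : QMat n) * (weylU x : QMat n)) := by
  rw [coe_weylU, coe_weylU, tensor_mul, tensor_mul, om, sg_sum, Units.coe_prod, ← tensor_smul]
  congr 1
  funext k
  exact weylOne_comm _ _ _ _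

lemma weylU_sq (x : V n) : (weylU x : QMat n) * (weylU x : QMat n) = 1 := by
  rw [coe_weylU, tensor_mul, ← tensor_one]
  congr 1
  funext k
  exact weylOne_sq _ _

lemma star_weylU (x : V n) : star (weylU x : QMat n) = (weylU x : QMat n) := by
  have h : star (weylU x : QMat n) * (weylU x : QMat n) = 1 :=
    Matrix.mem_unitaryGroup_iff'.mp (weylU x).2
  rw [← mul_one (star _), ← weylU_sq x, ← mul_assoc, h, one_mul]

/-- The class `[W_x]`. -/
noncomputable def wl (x : V n) : C n := weyl n (Multiplicative.ofAdd x)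

lemma weyl_eq_wl (x : Multiplicative (V n)) : weyl n x = wl x.toAdd := rfl

lemma wl_eq_mk (x : V n) : wl x = ((⟨weylU x, weylU_mem x⟩ : cliff n) : C n) := rfl

lemma wl_add (x y : V n) : wl (x + y) = wl x * wl y := map_mul (weyl n) _ _

lemma wl_zero : wl (0 : V n) = 1 := map_one (weyl n)

lemma wl_injective : Function.Injective (wl (n := n)) := fun _ _ h => weyl_injective n h

lemma wl_mul_self (x : V n) : wl x * wl x = 1 := by
  rw [← wl_add, add_self_eq_zero, wl_zero]

lemma wl_inv (x : V n) : (wl x)⁻¹ = wl x := inv_eq_of_mul_eq_one_left (wl_mul_self x)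

lemma wl_mem (x : V n) : wl x ∈ projPauli n := by
  rw [← range_weyl]; exact ⟨_, rfl⟩

lemma exists_wl_of_mem {g : C n} (h : g ∈ projPauli n) : ∃ x, g = wl x := by
  rw [← range_weyl] at h
  obtain ⟨x, rfl⟩ := h
  exact ⟨x.toAdd, rfl⟩

lemma exists_smul_of_mk_eq {U W : cliff n} (h : (U : C n) = (W : C n)) :
    ∃ c : ℂ, c ≠ 0 ∧ ((U : QU n) : QMat n) = c • ((W : QU n) : QMat n) := by
  obtain ⟨c, hc⟩ := QuotientGroup.eq.mp h.symm
  have e : ((U : QU n) : QMat n) = c • ((W : QU n) : QMat n) := by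
    have : U = W * (W⁻¹ * U) := by group
    rw [this]
    change ((W : QU n) : QMat n) * (((W⁻¹ * U : cliff n) : QU n) : QMat n) = _
    rw [hc, mul_smul_comm, mul_one]
  refine ⟨c, ?_, e⟩
  rintro rfl
  have hU : ((U : QU n) : QMat n) * star ((U : QU n) : QMat n) = 1 :=
    Matrix.mem_unitaryGroup_iff.mp (U : QU n).2
  rw [e, zero_smul, zero_mul] at hU
  exact zero_ne_one hU

lemma weylU_add (x y : V n) : ∃ c : ℂ, c ≠ 0 ∧
    (weylU (x + y) : QMat n) = c • ((weylU x : QMat n) * (weylU y : QMat n)) := by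
  have h := wl_add x y
  rw [wl_eq_mk, wl_eq_mk, wl_eq_mk, ← QuotientGroup.mk_mul] at h
  obtain ⟨c, hc, e⟩ := exists_smul_of_mk_eq h
  exact ⟨c, hc, e⟩

lemma unitary_mul_star (U : QU n) : (U : QMat n) * star (U : QMat n) = 1 :=
  Matrix.mem_unitaryGroup_iff.mp U.2

lemma unitary_mul_right_cancel (U : QU n) {A B : QMat n} (h : A * (U : QMat n) = B * (U : QMat n)) :
    A = B := by
  rw [← mul_one A, ← mul_one B, ← unitary_mul_star U, ← mul_assoc, h, mul_assoc]

lemma smul_unitary_injective (U : QU n) {a b : ℂ} (h : a • (U : QMat n) = b • (U : QMat n)) :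
    a = b := by
  have h1 : a • (1 : QMat n) = b • (1 : QMat n) := by
    refine unitary_mul_right_cancel U ?_
    rw [smul_mul_assoc, smul_mul_assoc, one_mul, h]
  exact smul_left_injective ℂ (one_ne_zero (α := QMat n)) h1

lemma weylOne_p_apply (p : ZMod 2) (a b : Fin 2) : (weylOne p 0 : Matrix (Fin 2) (Fin 2) ℂ) a b
    = if a = b then (if p = 1 ∧ a = 1 then -1 else 1) else 0 := by
  have ho : (1 : ZMod 2).val = 1 := rfl
  rcases zmod_two_cases p with rfl | rfl <;> fin_cases a <;> fin_cases b <;>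
    simp [weylOne, ho, uZ, matZ]

lemma weylOne_q_apply (q a b : Fin 2) :
    (weylOne 0 (q.val : ZMod 2) : Matrix (Fin 2) (Fin 2) ℂ) a b = if a = b + q then 1 else 0 := by
  have ho : (1 : ZMod 2).val = 1 := rfl
  fin_cases q <;> fin_cases a <;> fin_cases b <;> simp [weylOne, ho, uX, matX]

/-- A matrix commuting with all Weyl operators is scalar. -/
lemma eq_smul_one_of_commute (A : QMat n)
    (h : ∀ x : V n, A * (weylU x : QMat n) = (weylU x : QMat n) * A) : ∃ c : ℂ, A = c • 1 := by
  have hZ : ∀ (k : Fin n) (a b : Fin n → Fin 2), (weylU (Pi.single (Sum.inl k) 1) : QMat n) a b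
      = if a = b then (if a k = 1 then -1 else 1) else 0 := by
    intro k a b
    rw [coe_weylU]
    simp only [tensor, Matrix.of_apply]
    have e : ∀ j, (Pi.single (Sum.inl k) 1 : V n) (Sum.inr j) = 0 := fun j => by simp
    simp only [e, weylOne_p_apply]
    split_ifs with hab ha
    · subst hab
      rw [Finset.prod_eq_single k]
      · simp [ha]
      · intro j _ hj; simp [hj]
      · simp
    · subst hab
      refine Finset.prod_eq_one fun j _ => ?_
      by_cases hj : j = k
      · subst hj; simp [ha]
      · simp [hj]
    · obtain ⟨j, hj⟩ := Function.ne_iff.mp hab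
      exact Finset.prod_eq_zero (Finset.mem_univ j) (by simp [hj])
  have hX : ∀ (q a b : Fin n → Fin 2),
      (weylU (Sum.elim 0 fun k => ((q k).val : ZMod 2) : V n) : QMat n) a b
      = if a = b + q then 1 else 0 := by
    intro q a b
    rw [coe_weylU]
    simp only [tensor, Matrix.of_apply, Sum.elim_inl, Sum.elim_inr, Pi.zero_apply, weylOne_q_apply]
    split_ifs with hab
    · subst hab
      exact Finset.prod_eq_one fun j _ => if_pos rfl
    · obtain ⟨j, hj⟩ := Function.ne_iff.mp hab
      exact Finset.prod_eq_zero (Finset.mem_univ j) (if_neg hj)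
  refine ⟨A 0 0, ?_⟩
  ext a b
  by_cases hab : a = b
  -- The `X`-type Weyl operator with exponents `a` sends basis vector 0 to `a`; comparing entry `(a,
  -- 0)` of the two products equates the diagonal entries at `a` and at 0.
  · subst hab
    have h1 := congrFun (congrFun (h (Sum.elim 0 fun k => ((a k).val : ZMod 2))) a) 0
    rw [Matrix.mul_apply, Matrix.mul_apply, Finset.sum_eq_single a, Finset.sum_eq_single 0,
      hX, if_pos (zero_add a).symm] at h1
    · simpa using h1
    · intro c _ hc
      rw [hX, if_neg, zero_mul]
      intro h'
      exact hc (by simpa using h'.symm)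
    · simp
    · intro c _ hc
      rw [hX, if_neg, mul_zero]
      simpa using hc
    · simp
  · rw [Matrix.smul_apply, Matrix.one_apply_ne hab, smul_zero]
    -- On a qubit where the two indices differ, `Z_k` has opposite signs at `a` and `b`, which
    -- forces the entry to vanish.
    obtain ⟨k, hk⟩ := Function.ne_iff.mp hab
    have h1 := congrFun (congrFun (h (Pi.single (Sum.inl k) 1)) a) b
    rw [Matrix.mul_apply, Matrix.mul_apply, Finset.sum_eq_single b, Finset.sum_eq_single a,
      hZ, hZ, if_pos rfl, if_pos rfl] at h1
    · have e : ∀ i j : Fin 2, i ≠ j → (i = 1 ∧ j ≠ 1) ∨ (i ≠ 1 ∧ j = 1) := by decide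
      rcases e _ _ hk with ⟨ha, hb⟩ | ⟨ha, hb⟩
      · rw [if_pos ha, if_neg hb] at h1
        linear_combination h1 / 2
      · rw [if_neg ha, if_pos hb] at h1
        linear_combination -h1 / 2
    · intro c _ hc
      rw [hZ, if_neg hc.symm, zero_mul]
    · simp
    · intro c _ hc
      rw [hZ, if_neg hc, mul_zero]
    · simp

end

section

variable {n : ℕ}

/-! ## The action of the Clifford group on the Weyl operators -/

lemma exists_conj_wl (g : C n) (x : V n) : ∃ y : V n, g * wl x * g⁻¹ = wl y :=
  exists_wl_of_mem ((projPauli_normal n).conj_mem _ (wl_mem x) g)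

/-- The action of `𝒞ₙ` on `ℤ₂²ⁿ`. -/
noncomputable def act (g : C n) (x : V n) : V n := (exists_conj_wl g x).choose

lemma wl_act (g : C n) (x : V n) : wl (act g x) = g * wl x * g⁻¹ :=
  (exists_conj_wl g x).choose_spec.symm

lemma act_eq_iff {g : C n} {x y : V n} : act g x = y ↔ g * wl x = wl y * g := by
  rw [← wl_injective.eq_iff, wl_act, mul_inv_eq_iff_eq_mul]

lemma act_add (g : C n) (x y : V n) : act g (x + y) = act g x + act g y := by
  apply wl_injective
  rw [wl_act, wl_add, wl_add, wl_act, wl_act]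
  group

lemma act_mul (g h : C n) (x : V n) : act (g * h) x = act g (act h x) := by
  apply wl_injective
  rw [wl_act, wl_act, wl_act]
  group

lemma act_one (x : V n) : act (1 : C n) x = x := by
  rw [act_eq_iff, one_mul, mul_one]

lemma act_wl (z x : V n) : act (wl z) x = x := by
  rw [act_eq_iff, ← wl_add, ← wl_add, add_comm]

lemma act_inv_act (g : C n) (x : V n) : act g⁻¹ (act g x) = x := by
  rw [← act_mul, inv_mul_cancel, act_one]

lemma act_act_inv (g : C n) (x : V n) : act g (act g⁻¹ x) = x := by
  rw [← act_mul, mul_inv_cancel, act_one]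

lemma act_zero (g : C n) : act g 0 = 0 := by
  rw [act_eq_iff, wl_zero, one_mul, mul_one]

/-- A change of representative multiplies both sides by the same phase, so one scalar serves for the
whole class. -/
lemma exists_sgn (g : C n) (x : V n) : ∃ s : ℂˣ, ∀ U : cliff n, (U : C n) = g →
    ((U : QU n) : QMat n) * (weylU x : QMat n)
      = (s : ℂ) • ((weylU (act g x) : QMat n) * ((U : QU n) : QMat n)) := by
  obtain ⟨U₀, rfl⟩ := QuotientGroup.mk_surjective g
  have h := act_eq_iff.mp (rfl : act (U₀ : C n) x = _)
  rw [wl_eq_mk, wl_eq_mk, ← QuotientGroup.mk_mul, ← QuotientGroup.mk_mul] at h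
  obtain ⟨c, hc, e⟩ := exists_smul_of_mk_eq h
  refine ⟨Units.mk0 c hc, fun U hU => ?_⟩
  obtain ⟨d, -, hd⟩ := exists_smul_of_mk_eq hU
  rw [hd, smul_mul_assoc, mul_smul_comm, smul_comm _ d]
  exact congrArg (d • ·) e

/-- The scalar `s` with `U W_x U† = s W_{g x}`, `g = [U]`. -/
noncomputable def sgn (g : C n) (x : V n) : ℂˣ := (exists_sgn g x).choose

lemma mul_weylU (U : cliff n) (x : V n) : ((U : QU n) : QMat n) * (weylU x : QMat n)
    = (sgn (U : C n) x : ℂ) • ((weylU (act (U : C n) x) : QMat n) * ((U : QU n) : QMat n)) :=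
  (exists_sgn _ x).choose_spec U rfl

lemma coe_mul_weylU_injective (U : cliff n) (x : V n) {a b : ℂ}
    (h : a • ((weylU x : QMat n) * ((U : QU n) : QMat n))
      = b • ((weylU x : QMat n) * ((U : QU n) : QMat n))) : a = b :=
  smul_unitary_injective (weylU x * (U : QU n)) h

lemma sgn_unique (U : cliff n) (x y : V n) (s : ℂ)
    (h : ((U : QU n) : QMat n) * (weylU x : QMat n)
      = s • ((weylU y : QMat n) * ((U : QU n) : QMat n))) :
    act (U : C n) x = y ∧ (sgn (U : C n) x : ℂ) = s := by
  have h1 : act (U : C n) x = y := by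
    rw [act_eq_iff, wl_eq_mk, wl_eq_mk, ← QuotientGroup.mk_mul, ← QuotientGroup.mk_mul]
    exact mk_eq_of_smul h
  refine ⟨h1, coe_mul_weylU_injective U y ?_⟩
  rw [← h, mul_weylU, h1]

/-- Conjugation preserves the commutation sign of two Weyl operators, and that sign determines `om`.
-/
lemma om_act (g : C n) (x y : V n) : om (act g x) (act g y) = om x y := by
  obtain ⟨U, rfl⟩ := QuotientGroup.mk_surjective g
  set W := ((U : QU n) : QMat n)
  have key : ∀ x y : V n, W * ((weylU x : QMat n) * (weylU y : QMat n))
      = ((sgn (U : C n) x : ℂ) * (sgn (U : C n) y : ℂ)) •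
        ((weylU (act (U : C n) x) : QMat n) * (weylU (act (U : C n) y) : QMat n) * W) := by
    intro x y
    rw [← mul_assoc, mul_weylU, smul_mul_assoc, mul_assoc, mul_weylU, mul_smul_comm, smul_smul,
      mul_assoc]
  have h1 := key x y
  rw [weylU_comm x y, weylU_comm (act _ x), mul_smul_comm, key, smul_mul_assoc, smul_smul,
    smul_smul] at h1
  have h2 := smul_unitary_injective
    (weylU (act (U : C n) y) * weylU (act (U : C n) x) * (U : QU n)) h1
  have h3 : (sg (om x y) : ℂ) = sg (om (act (U : C n) x) (act (U : C n) y)) := by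
    have ha := (sgn (U : C n) x).ne_zero
    have hb := (sgn (U : C n) y).ne_zero
    have : (sgn (U : C n) x : ℂ) * (sgn (U : C n) y : ℂ) ≠ 0 := mul_ne_zero ha hb
    apply mul_left_cancel₀ this
    linear_combination h2
  exact (sg_injective (Units.ext h3)).symm

lemma sgn_mul_self (g : C n) (x : V n) : sgn g x * sgn g x = 1 := by
  obtain ⟨U, rfl⟩ := QuotientGroup.mk_surjective g
  set W := ((U : QU n) : QMat n)
  have h : W * ((weylU x : QMat n) * (weylU x : QMat n))
      = ((sgn (U : C n) x : ℂ) * (sgn (U : C n) x : ℂ)) • W := by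
    rw [← mul_assoc, mul_weylU, smul_mul_assoc, mul_assoc, mul_weylU, mul_smul_comm, smul_smul,
      ← mul_assoc, weylU_sq, one_mul]
  rw [weylU_sq, mul_one] at h
  refine Units.ext (smul_unitary_injective (U : QU n) ?_)
  rw [Units.val_mul, ← h, Units.val_one, one_smul]

lemma sgn_mul (g h : C n) (x : V n) : sgn (g * h) x = sgn g (act h x) * sgn h x := by
  obtain ⟨U, rfl⟩ := QuotientGroup.mk_surjective g
  obtain ⟨T, rfl⟩ := QuotientGroup.mk_surjective h
  rw [← QuotientGroup.mk_mul]
  refine Units.ext (sgn_unique (U * T) x (act (U : C n) (act (T : C n) x)) _ ?_).2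
  change ((U : QU n) : QMat n) * ((T : QU n) : QMat n) * _
    = _ • (_ * (((U : QU n) : QMat n) * ((T : QU n) : QMat n)))
  rw [mul_assoc, mul_weylU, mul_smul_comm, ← mul_assoc, mul_weylU, smul_mul_assoc, smul_smul,
    Units.val_mul, mul_comm, mul_assoc]

lemma sgn_one (x : V n) : sgn (1 : C n) x = 1 := by
  refine Units.ext (sgn_unique (1 : cliff n) x x _ ?_).2
  simp

lemma sgn_wl (z x : V n) : sgn (wl z) x = sg (om z x) := by
  rw [wl_eq_mk]
  refine Units.ext (sgn_unique (⟨weylU z, weylU_mem z⟩ : cliff n) x x _ ?_).2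
  exact weylU_comm z x

/-- The phase relating `W_{x+y}` to `W_x W_y` appears on both sides and cancels because `x` and `y`
are fixed; for moved vectors two different phases would be compared. -/
lemma sgn_add {g : C n} {x y : V n} (hx : act g x = x) (hy : act g y = y) :
    sgn g (x + y) = sgn g x * sgn g y := by
  obtain ⟨U, rfl⟩ := QuotientGroup.mk_surjective g
  obtain ⟨c, -, hc⟩ := weylU_add x y
  refine Units.ext (sgn_unique U (x + y) (x + y) _ ?_).2
  rw [hc, mul_smul_comm, ← mul_assoc, mul_weylU, hx, smul_mul_assoc, mul_assoc, mul_weylU, hy,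
    mul_smul_comm, smul_mul_assoc, Units.val_mul, mul_assoc]
  simp only [smul_smul]
  congr 1
  ring

/-- The projective Pauli group is its own centralizer. -/
lemma exists_wl_of_act_eq (g : C n) (h : ∀ x, act g x = x) : ∃ z : V n, g = wl z := by
  -- All vectors being fixed, the signs form a character of the form `(-1)^{ω(z, ·)}`. Multiplying
  -- by `[W_z]` removes it and leaves an operator commuting with every Weyl operator.
  obtain ⟨l, hl⟩ := exists_functional (sgn g) (fun x y => sgn_add (h x) (h y)) (sgn_mul_self g)
  obtain ⟨z, hz⟩ := exists_om_eq l
  refine ⟨z, ?_⟩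
  have hact : ∀ x, act (wl z * g) x = x := fun x => by rw [act_mul, h, act_wl]
  have hsgn : ∀ x, sgn (wl z * g) x = 1 := fun x => by
    rw [sgn_mul, h, sgn_wl, hl, hz, sg_mul_self]
  obtain ⟨U, hU⟩ := QuotientGroup.mk_surjective (wl z * g)
  obtain ⟨c, hc⟩ := eq_smul_one_of_commute ((U : QU n) : QMat n) (fun x => by
    rw [mul_weylU]
    erw [hU]
    rw [hact, hsgn, Units.val_one, one_smul])
  have h1 : (U : C n) = 1 := (QuotientGroup.eq_one_iff U).mpr ⟨c, hc⟩
  have h2 : wl z * g = 1 := hU.symm.trans h1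
  rw [← wl_inv]
  exact (inv_eq_of_mul_eq_one_right h2).symm

/-- The action of `𝒞ₙ` as a linear map. -/
noncomputable def actLin (g : C n) : V n →ₗ[ZMod 2] V n :=
  (AddMonoidHom.mk' (act g) (act_add g)).toZModLinearMap 2

lemma exists_symp_act (g : C n) : ∃ Γ : Sp n, ∀ x, Γ.1 *ᵥ x = act g x :=
  exists_symp (actLin g) (om_act g)

/-- The homomorphism `𝒞ₙ → Sp(2n,2)`. -/
noncomputable def cliffSymp (n : ℕ) : C n →* Sp n :=
  MonoidHom.mk' (fun g => (exists_symp_act g).choose) fun g h => symp_ext fun x => by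
    rw [(exists_symp_act (g * h)).choose_spec, symp_mul_mulVec, (exists_symp_act g).choose_spec,
      (exists_symp_act h).choose_spec, act_mul]

lemma cliffSymp_mulVec (g : C n) (x : V n) : (cliffSymp n g).1 *ᵥ x = act g x :=
  (exists_symp_act g).choose_spec x

lemma cliffSymp_wl (z : V n) : cliffSymp n (wl z) = 1 :=
  symp_ext fun x => by rw [cliffSymp_mulVec, act_wl, symp_one_mulVec]

lemma cliffSymp_eq_iff {g h : C n} : cliffSymp n g = cliffSymp n h ↔ ∃ z, g = wl z * h := by
  constructor
  · intro e
    obtain ⟨z, hz⟩ := exists_wl_of_act_eq (g * h⁻¹) fun x => by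
      rw [← cliffSymp_mulVec, map_mul, e, ← map_mul, mul_inv_cancel, map_one, symp_one_mulVec]
    exact ⟨z, by rw [← hz, inv_mul_cancel_right]⟩
  · rintro ⟨z, rfl⟩
    rw [map_mul, cliffSymp_wl, one_mul]

/-! ## Transvections -/

/-- Conjugating by a transvection produces the factor `i`, which must itself be a Pauli element. It
is placed on the first qubit, which is why at least one qubit is required. -/
lemma scalarI_mem [NeZero n] : ∃ J : QU n, J ∈ pauliGroup n ∧ (J : QMat n) = Complex.I • 1 := by
  refine ⟨tensorHom n (Pi.mulSingle 0 uI), ⟨_, fun k _ => ?_, rfl⟩, ?_⟩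
  · by_cases hk : k = 0
    · subst hk; rw [Pi.mulSingle_eq_same]; exact uI_mem
    · rw [Pi.mulSingle_eq_of_ne hk]; exact pauliOne.one_mem
  · change tensor _ = _
    have e : (fun k : Fin n => ((Pi.mulSingle 0 uI : Fin n → Matrix.unitaryGroup (Fin 2) ℂ) k :
        Matrix (Fin 2) (Fin 2) ℂ))
        = fun k => (Pi.mulSingle 0 Complex.I : Fin n → ℂ) k • (1 : Matrix (Fin 2) (Fin 2) ℂ) := by
      funext k
      by_cases hk : k = 0
      · subst hk; simp [uI]
      · simp [Pi.mulSingle_eq_of_ne hk]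
    rw [e, tensor_smul, tensor_one, Fintype.prod_eq_single 0 fun k hk => Pi.mulSingle_eq_of_ne hk _,
      Pi.mulSingle_eq_same]

/-- The unitary `(1 + i W_y)/√2`. -/
noncomputable def tvU (y : V n) : QU n :=
  ⟨((Real.sqrt 2 : ℝ) : ℂ)⁻¹ • (1 + Complex.I • (weylU y : QMat n)), by
    have h2 : ((Real.sqrt 2 : ℝ) : ℂ)⁻¹ * ((Real.sqrt 2 : ℝ) : ℂ)⁻¹ = 1 / 2 := by
      rw [← mul_inv, ← Complex.ofReal_mul, Real.mul_self_sqrt (by norm_num)]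
      norm_num
    have hs : star (((Real.sqrt 2 : ℝ) : ℂ)⁻¹) = ((Real.sqrt 2 : ℝ) : ℂ)⁻¹ := by
      rw [star_inv₀]
      simp
    rw [Matrix.mem_unitaryGroup_iff, star_smul, star_add, star_smul, star_one, star_weylU, hs,
      smul_mul_smul_comm, h2, add_mul, mul_add, mul_add, one_mul, one_mul, mul_one,
      smul_mul_smul_comm, weylU_sq]
    simp only [Complex.star_def, Complex.conj_I, mul_neg, Complex.I_mul_I, neg_neg, neg_smul,
      one_smul]
    rw [show (1 : QMat n) + -(Complex.I • (weylU y : QMat n))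
      + (Complex.I • (weylU y : QMat n) + 1) = (2 : ℂ) • 1 by rw [two_smul]; abel, smul_smul]
    norm_num⟩

lemma coe_tvU (y : V n) : (tvU y : QMat n)
    = ((Real.sqrt 2 : ℝ) : ℂ)⁻¹ • (1 + Complex.I • (weylU y : QMat n)) := rfl

lemma tvU_mul_of_commute (y : V n) {A : QMat n}
    (h : (weylU y : QMat n) * A = A * (weylU y : QMat n)) : (tvU y : QMat n) * A = A * tvU y := by
  rw [coe_tvU, smul_mul_assoc, mul_smul_comm, add_mul, mul_add, smul_mul_assoc, h, mul_smul_comm,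
    one_mul, mul_one]

/-- From `W A W = -A` one gets `i W A (1 + i W) = (1 + i W) A`: conjugation multiplies `A` by `i
W_y`. -/
lemma tvU_mul_of_anticommute (y : V n) {A : QMat n}
    (h : (weylU y : QMat n) * A = -(A * (weylU y : QMat n))) :
    (tvU y : QMat n) * A = Complex.I • ((weylU y : QMat n) * A * tvU y) := by
  have h' : (weylU y : QMat n) * A * (weylU y : QMat n) = -A := by
    rw [h, neg_mul, mul_assoc, weylU_sq, mul_one]
  rw [coe_tvU, smul_mul_assoc, mul_smul_comm, smul_comm Complex.I, add_mul, mul_add, one_mul,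
    mul_one, smul_mul_assoc, mul_smul_comm, h', smul_add Complex.I, smul_smul, Complex.I_mul_I,
    neg_smul, one_smul, neg_neg, add_comm]

lemma exists_weylU_of_mem {h : QU n} (hh : h ∈ pauliGroup n) :
    ∃ (c : ℂ) (x : V n), (h : QMat n) = c • (weylU x : QMat n) := by
  have h1 : ((⟨h, Subgroup.le_normalizer hh⟩ : cliff n) : C n) ∈ projPauli n := ⟨_, hh, rfl⟩
  obtain ⟨x, hx⟩ := exists_wl_of_mem h1
  rw [wl_eq_mk] at hx
  obtain ⟨c, -, hc⟩ := exists_smul_of_mk_eq hx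
  exact ⟨c, x, hc⟩

lemma mem_cliff_of_forall {U : QU n} (h1 : ∀ h ∈ pauliGroup n, U * h * U⁻¹ ∈ pauliGroup n)
    (h2 : ∀ h ∈ pauliGroup n, U⁻¹ * h * U ∈ pauliGroup n) : U ∈ cliff n := by
  refine Subgroup.mem_normalizer_iff.mpr fun h => ⟨h1 h, fun hh => ?_⟩
  have := h2 _ hh
  simpa [mul_assoc] using this

lemma tvU_mem [NeZero n] (y : V n) : tvU y ∈ cliff n := by
  obtain ⟨J, hJ, hJc⟩ := scalarI_mem (n := n)
  -- Conjugation multiplies a Pauli element by a Pauli element `j`, either 1 or `i W_y`. Because `j`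
  -- commutes with `tvU y`, conjugation by the inverse multiplies by `j⁻¹`.
  have key : ∀ h ∈ pauliGroup n, ∃ j ∈ pauliGroup n, tvU y * h = j * h * tvU y
      ∧ j * (tvU y) = tvU y * j := by
    intro h hh
    obtain ⟨c, x, hx⟩ := exists_weylU_of_mem hh
    have hc : (weylU y : QMat n) * (h : QMat n)
        = (sg (om y x) : ℂ) • ((h : QMat n) * (weylU y : QMat n)) := by
      rw [hx, mul_smul_comm, smul_mul_assoc, weylU_comm, smul_comm]
    rcases zmod_two_cases (om y x) with h0 | h0
    · rw [h0, sg_zero, Units.val_one, one_smul] at hc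
      refine ⟨1, one_mem _, Subtype.ext ?_, by simp⟩
      rw [one_mul]
      exact tvU_mul_of_commute y hc
    · rw [h0, sg_one, Units.val_neg, Units.val_one, neg_one_smul] at hc
      refine ⟨J * weylU y, mul_mem hJ (weylU_mem_pauli y), Subtype.ext ?_, Subtype.ext ?_⟩
      · refine (tvU_mul_of_anticommute y hc).trans ?_
        change _ = (J : QMat n) * (weylU y : QMat n) * (h : QMat n) * (tvU y : QMat n)
        rw [hJc, smul_mul_assoc, one_mul, smul_mul_assoc, smul_mul_assoc]
      · refine (tvU_mul_of_commute y ?_).symm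
        change _ * ((J : QMat n) * (weylU y : QMat n)) = (J : QMat n) * (weylU y : QMat n) * _
        rw [hJc, smul_mul_assoc, one_mul, mul_smul_comm, smul_mul_assoc]
  refine mem_cliff_of_forall (fun h hh => ?_) fun h hh => ?_
  · obtain ⟨j, hj, e, -⟩ := key h hh
    rw [e, mul_inv_cancel_right]
    exact mul_mem hj hh
  · obtain ⟨j, hj, e, e'⟩ := key h hh
    have : (tvU y)⁻¹ * h * tvU y = j⁻¹ * h := by
      have e1 : j * (tvU y)⁻¹ = (tvU y)⁻¹ * j := (show Commute j (tvU y) from e').inv_right.eq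
      rw [eq_inv_mul_iff_mul_eq, ← mul_assoc, ← mul_assoc, e1, mul_assoc, mul_assoc, ← mul_assoc j,
        ← e, inv_mul_cancel_left]
    rw [this]
    exact mul_mem (inv_mem hj) hh

/-- The class of `(1 + i W_y)/√2`. -/
noncomputable def tv [NeZero n] (y : V n) : C n := ((⟨tvU y, tvU_mem y⟩ : cliff n) : C n)

/-- When `W_x` and `W_y` commute nothing changes; when they anticommute, `W_x` becomes `i W_y W_x`,
a multiple of `W_{x+y}`. -/
lemma act_tv [NeZero n] (y x : V n) : act (tv y) x = x + om x y • y := by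
  have hc : (weylU y : QMat n) * (weylU x : QMat n) = _ := weylU_comm y x
  rw [om_comm] at hc
  rcases zmod_two_cases (om x y) with h0 | h0
  · rw [h0, sg_zero, Units.val_one, one_smul] at hc
    rw [h0, zero_smul, add_zero]
    refine (sgn_unique (⟨tvU y, tvU_mem y⟩ : cliff n) x x 1 ?_).1
    rw [one_smul]
    exact tvU_mul_of_commute y hc
  · rw [h0, sg_one, Units.val_neg, Units.val_one, neg_one_smul] at hc
    rw [h0, one_smul]
    obtain ⟨c, hc0, e⟩ := weylU_add y x
    refine (sgn_unique (⟨tvU y, tvU_mem y⟩ : cliff n) x (x + y) (Complex.I * c⁻¹) ?_).1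
    refine (tvU_mul_of_anticommute y hc).trans ?_
    rw [add_comm x, e, smul_mul_assoc, smul_smul, mul_assoc Complex.I, inv_mul_cancel₀ hc0, mul_one]

end

section

variable {n : ℕ}

/-! ## Surjectivity onto the symplectic group -/

lemma om_single (x : V n) (s : Fin n ⊕ Fin n) : om x (Pi.single s 1) = x s.swap := by
  rcases s with k | k
  · exact om_single_inl x k
  · exact om_single_inr x k

/-- `x` is orthogonal to the standard basis vectors of all qubits `≥ k`. -/
def SuppBelow (k : ℕ) (x : V n) : Prop :=
  ∀ s : Fin n ⊕ Fin n, k ≤ (Sum.elim id id s : Fin n) → om x (Pi.single s 1) = 0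

/-- `g` fixes the standard basis vectors of all qubits `≥ k`. -/
def FixesAbove (k : ℕ) (g : C n) : Prop :=
  ∀ s : Fin n ⊕ Fin n, k ≤ (Sum.elim id id s : Fin n) → act g (Pi.single s 1) = Pi.single s 1

lemma SuppBelow.add {k : ℕ} {x y : V n} (hx : SuppBelow k x) (hy : SuppBelow k y) :
    SuppBelow k (x + y) := fun s hs => by rw [om_add_left, hx s hs, hy s hs, add_zero]

lemma FixesAbove.mul {k : ℕ} {g h : C n} (hg : FixesAbove k g) (hh : FixesAbove k h) :
    FixesAbove k (g * h) := fun s hs => by rw [act_mul, hh s hs, hg s hs]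

lemma SuppBelow.act {k : ℕ} {g : C n} {x : V n} (hg : FixesAbove k g) (hx : SuppBelow k x) :
    SuppBelow k (act g x) := fun s hs => by rw [← hx s hs, ← om_act g x, hg s hs]

lemma SuppBelow.fixesAbove_tv [NeZero n] {k : ℕ} {y : V n} (hy : SuppBelow k y) :
    FixesAbove k (tv y) := fun s hs => by
  rw [act_tv, om_comm, hy s hs, zero_smul, add_zero]

/-- Nondegeneracy on the first `k` qubits: the partner of a nonzero coordinate of `x` belongs to the
same qubit, so it is again below `k`. -/
lemma SuppBelow.exists_om_eq_one {k : ℕ} {x : V n} (hx : SuppBelow k x) (h : x ≠ 0) :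
    ∃ z : V n, SuppBelow k z ∧ om x z = 1 := by
  obtain ⟨s, hs⟩ := Function.ne_iff.mp h
  have h1 : om x (Pi.single s.swap 1) = 1 := by
    rw [om_single, Sum.swap_swap]
    exact (zmod_two_cases _).resolve_left hs
  refine ⟨_, fun s' hs' => ?_, h1⟩
  rw [om_single]
  by_cases e : s'.swap = s.swap
  · rw [Sum.swap_leftInverse.injective e] at hs'
    have := hx s.swap (by rcases s with j | j <;> exact hs')
    rw [h1] at this
    exact absurd this one_ne_zero
  · exact Pi.single_eq_of_ne e _

lemma exists_act_eq_of_om [NeZero n] {k : ℕ} {x y : V n} (hx : SuppBelow k x) (hy : SuppBelow k y)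
    (h : om x y = 1) : act (tv (x + y)) x = y ∧ FixesAbove k (tv (x + y)) := by
  refine ⟨?_, (hx.add hy).fixesAbove_tv⟩
  rw [act_tv, om_add_right, om_self, h, zero_add, one_smul, ← add_assoc, add_self_eq_zero, zero_add]

/-- Products of transvections act transitively on nonzero vectors. -/
lemma exists_act_eq [NeZero n] {k : ℕ} {x y : V n} (hx : SuppBelow k x) (hy : SuppBelow k y)
    (hx0 : x ≠ 0) (hy0 : y ≠ 0) : ∃ g : C n, act g x = y ∧ FixesAbove k g := by
  -- An intermediate vector pairing to 1 with both `x` and `y` allows one transvection from `x` to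
  -- `z` and another from `z` to `y`. If neither partner works for both, their sum does.
  have hz : ∃ z : V n, SuppBelow k z ∧ om x z = 1 ∧ om y z = 1 := by
    obtain ⟨a, ha, hxa⟩ := hx.exists_om_eq_one hx0
    obtain ⟨b, hb, hyb⟩ := hy.exists_om_eq_one hy0
    rcases zmod_two_cases (om y a) with h1 | h1
    · rcases zmod_two_cases (om x b) with h2 | h2
      · exact ⟨a + b, ha.add hb, by rw [om_add_right, hxa, h2, add_zero],
          by rw [om_add_right, hyb, h1, zero_add]⟩
      · exact ⟨b, hb, h2, hyb⟩
    · exact ⟨a, ha, hxa, h1⟩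
  obtain ⟨z, hz, hxz, hyz⟩ := hz
  obtain ⟨h1, h1'⟩ := exists_act_eq_of_om hx hz hxz
  obtain ⟨h2, h2'⟩ := exists_act_eq_of_om hz hy (by rw [om_comm, hyz])
  exact ⟨_, by rw [act_mul, h1, h2], h2'.mul h1'⟩

/-- Products of transvections act transitively on hyperbolic pairs. -/
lemma exists_act_eq_pair [NeZero n] {k : ℕ} {e x y : V n} (he : SuppBelow k e) (hx : SuppBelow k x)
    (hy : SuppBelow k y) (hex : om e x = 1) (hey : om e y = 1) :
    ∃ g : C n, act g e = e ∧ act g x = y ∧ FixesAbove k g := by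
  -- The transvection of `x + y` moves `x` to `y` and fixes `e`, because `ω(e, x + y) = 1 + 1 = 0`.
  have step : ∀ {x y : V n}, SuppBelow k x → SuppBelow k y → om e x = 1 → om e y = 1 →
      om x y = 1 → ∃ g : C n, act g e = e ∧ act g x = y ∧ FixesAbove k g := by
    intro x y hx hy hex hey h
    obtain ⟨h1, h2⟩ := exists_act_eq_of_om hx hy h
    refine ⟨_, ?_, h1, h2⟩
    rw [act_tv, om_add_right, hex, hey, CharTwo.add_self_eq_zero, zero_smul, add_zero]
  -- If `ω(x, y) = 0`, the detour through `x + e` works: it pairs to 1 with `e`, with `x` and with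
  -- `y`.
  rcases zmod_two_cases (om x y) with h | h
  · obtain ⟨g, hg1, hg2, hg3⟩ := step hx (hx.add he) hex
      (by rw [om_add_right, hex, om_self, add_zero])
      (by rw [om_add_right, om_self, om_comm, hex, zero_add])
    obtain ⟨g', hg1', hg2', hg3'⟩ := step (hx.add he) hy
      (by rw [om_add_right, hex, om_self, add_zero])
      hey (by rw [om_add_left, h, hey, zero_add])
    exact ⟨g' * g, by rw [act_mul, hg1, hg1'], by rw [act_mul, hg2, hg2'], hg3'.mul hg3⟩
  · exact step hx hy hex hey h

/-- Induction on the number `k` of leading qubits on which `Γ` may act nontrivially. Transvections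
that fix the later qubits bring the images under `Γ` of the hyperbolic pair of the last such qubit
(index `k` in the step to `k + 1`) back to the pair itself. -/
lemma cliffSymp_surjective [NeZero n] : Function.Surjective (cliffSymp n) := by
  have main : ∀ k : ℕ, k ≤ n → ∀ Γ : Sp n,
      (∀ s : Fin n ⊕ Fin n, k ≤ (Sum.elim id id s : Fin n) →
        Γ.1 *ᵥ Pi.single s 1 = Pi.single s 1) → Γ ∈ (cliffSymp n).range := by
    intro k
    induction k with
    | zero =>
      intro _ Γ hΓ
      have : Γ = 1 := Subtype.ext (Matrix.ext_of_mulVec_single fun s => by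
        rw [hΓ s (Nat.zero_le _)]; exact (symp_one_mulVec _).symm)
      rw [this]
      exact one_mem _
    | succ k ih =>
      intro hk Γ hΓ
      have supp : ∀ x : V n, SuppBelow (k + 1) x → SuppBelow (k + 1) (Γ.1 *ᵥ x : V n) :=
        fun x hx s hs => by
          rw [← hx s hs, ← om_mulVec Γ x, hΓ s hs]
      let i : Fin n := ⟨k, hk⟩
      let e : V n := Pi.single (Sum.inl i) 1
      let f : V n := Pi.single (Sum.inr i) 1
      have hsupp : ∀ s : Fin n ⊕ Fin n, (Sum.elim id id s : Fin n) = i →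
          SuppBelow (k + 1) (Pi.single s 1 : V n) := by
        intro s hs s' hs'
        rw [om_single]
        refine Pi.single_eq_of_ne ?_ _
        rintro rfl
        rw [← show (Sum.elim id id s' : Fin n) = Sum.elim id id s'.swap by
          rcases s' with j | j <;> rfl] at hs
        rw [hs] at hs'
        exact absurd hs' (by simp [i])
      have he : SuppBelow (k + 1) e := hsupp _ rfl
      have hf : SuppBelow (k + 1) f := hsupp _ rfl
      have hef : om e f = 1 := by rw [om_single]; exact Pi.single_eq_same _ _
      have he0 : e ≠ 0 := by
        intro h0
        rw [h0, om_zero_left] at hef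
        exact zero_ne_one hef
      have hΓe0 : (Γ.1 *ᵥ e : V n) ≠ 0 := by
        intro h0
        apply he0
        apply symp_mulVec_injective Γ
        rw [h0, Matrix.mulVec_zero]
      obtain ⟨g, hg1, hg2⟩ := exists_act_eq (supp e he) he hΓe0 he0
      have hef' : om e (act g (Γ.1 *ᵥ f)) = 1 := by
        rw [← hef, ← om_mulVec Γ e f, ← om_act g (Γ.1 *ᵥ e), hg1]
      obtain ⟨g', hg1', hg2', hg3'⟩ := exists_act_eq_pair he ((supp f hf).act hg2) hf hef' hef
      have hmem : cliffSymp n (g' * g) * Γ ∈ (cliffSymp n).range := by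
        refine ih (Nat.le_of_succ_le hk) _ fun s hs => ?_
        rw [symp_mul_mulVec, cliffSymp_mulVec, act_mul]
        rcases hs.eq_or_lt with h | h
        · have hi : (Sum.elim id id s : Fin n) = i := Fin.ext h.symm
          rcases s with j | j
          · obtain rfl : j = i := hi
            exact (congrArg _ hg1).trans hg1'
          · obtain rfl : j = i := hi
            exact hg2'
        · rw [hΓ s h, hg2 s h, hg3' s h]
      have := mul_mem (inv_mem (⟨_, rfl⟩ : cliffSymp n (g' * g) ∈ (cliffSymp n).range)) hmem
      rwa [inv_mul_cancel_left] at this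
  intro Γ
  exact main n le_rfl Γ fun s hs => absurd hs (not_le.mpr (Fin.is_lt _))

lemma exists_act_eq_of_ne_zero [NeZero n] {x y : V n} (hx : x ≠ 0) (hy : y ≠ 0) :
    ∃ g : C n, act g x = y := by
  have h : ∀ x : V n, SuppBelow n x := fun x s hs => absurd hs (not_le.mpr (Fin.is_lt _))
  obtain ⟨g, hg, -⟩ := exists_act_eq (h x) (h y) hx hy
  exact ⟨g, hg⟩

instance finite_C [NeZero n] : Finite (C n) := by
  let t := Function.surjInv (cliffSymp_surjective (n := n))
  refine Finite.of_surjective (fun p : V n × Sp n => wl p.1 * t p.2) fun g => ?_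
  obtain ⟨z, hz⟩ := cliffSymp_eq_iff.mp
    (Function.surjInv_eq cliffSymp_surjective (cliffSymp n g)).symm
  exact ⟨(z, cliffSymp n g), hz.symm⟩

end

section

variable {n : ℕ}

/-! ## The inertia group and the sign character -/

/-- The vector of the Weyl operator `Y₁`. -/
def y1 (n : ℕ) [NeZero n] : V n := Pi.single (Sum.inl 0) 1 + Pi.single (Sum.inr 0) 1

lemma om_y1 [NeZero n] (x : V n) : om x (y1 n) = x (Sum.inl 0) + x (Sum.inr 0) := by
  rw [y1, om_add_right, om_single_inl, om_single_inr, add_comm]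

lemma y1_ne_zero [NeZero n] : y1 n ≠ 0 := by
  intro h
  have := om_y1 (Pi.single (Sum.inl 0) 1 : V n)
  rw [h, om_zero_right] at this
  simp at this

lemma sigma1_wl [NeZero n] (x : V n) (h : wl x ∈ projPauli n) :
    sigma1 n ⟨wl x, h⟩ = sg (om x (y1 n)) := by
  have e : (⟨wl x, h⟩ : projPauli n) = weylEquiv n (Multiplicative.ofAdd x) := rfl
  rw [sigma1, MonoidHom.comp_apply, e]
  change signV n ((weylEquiv n).symm (weylEquiv n _)) = _
  rw [MulEquiv.symm_apply_apply, om_y1]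
  rfl

lemma conj_wl (g : C n) (x : V n) : g⁻¹ * wl x * g = wl (act g⁻¹ x) := by
  rw [wl_act, inv_inv]

lemma om_act_inv (g : C n) (x y : V n) : om (act g⁻¹ x) y = om x (act g y) := by
  rw [← om_act g, act_act_inv]

/-- The character is `[W_x] ↦ (-1)^{ω(x, y1)}` and `ω` is nondegenerate and invariant, so fixing the
character means fixing `y1`. -/
lemma mem_IN [NeZero n] {g : C n} : g ∈ IN n ↔ act g (y1 n) = y1 n := by
  have key : ∀ x : V n, ∀ h : wl x ∈ projPauli n,
      sigma1 n (MulAut.conjNormal g⁻¹ ⟨wl x, h⟩) = sg (om x (act g (y1 n))) := by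
    intro x h
    have e : MulAut.conjNormal g⁻¹ (⟨wl x, h⟩ : projPauli n) = ⟨wl (act g⁻¹ x), wl_mem _⟩ :=
      Subtype.ext (by rw [MulAut.conjNormal_apply, inv_inv]; exact conj_wl g x)
    rw [e, sigma1_wl, om_act_inv]
  constructor
  · intro hg
    have h1 : act g (y1 n) + y1 n = 0 := by
      refine eq_zero_of_om _ fun x => ?_
      have h := hg ⟨wl x, wl_mem x⟩
      rw [key, sigma1_wl] at h
      rw [om_comm, om_add_right, sg_injective h, CharTwo.add_self_eq_zero]
    rw [← add_zero (act g _), ← add_self_eq_zero (y1 n), ← add_assoc, h1, zero_add]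
  · rintro hg ⟨p, hp⟩
    obtain ⟨x, rfl⟩ := exists_wl_of_mem hp
    rw [key, hg, sigma1_wl]

/-- The sign character `[U] ↦ ε(U)`, `U Y₁ U† = ε(U) Y₁`. -/
noncomputable def signChar (n : ℕ) [NeZero n] : IN n →* ℂˣ :=
  MonoidHom.mk' (fun g => sgn (g : C n) (y1 n)) fun g h => by
    rw [Subgroup.coe_mul, sgn_mul, mem_IN.mp h.2]

lemma signChar_apply [NeZero n] (g : IN n) : signChar n g = sgn (g : C n) (y1 n) := rfl

/-- Conjugating `Y₁` by `W_x` gives precisely the commutation sign `(-1)^{ω(x, y1)}`. -/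
lemma extendsSigma1_signChar [NeZero n] : ExtendsSigma1 (signChar n) := by
  refine MonoidHom.ext fun p => ?_
  obtain ⟨p, hp⟩ := p
  obtain ⟨x, rfl⟩ := exists_wl_of_mem hp
  rw [sigma1_wl, ← sgn_wl]
  rfl

lemma onQubit_eq_weylU {A : Matrix (Fin 2) (Fin 2) ℂ} (j : Fin n) (p q : ZMod 2)
    (hA : (weylOne p q : Matrix (Fin 2) (Fin 2) ℂ) = A) :
    onQubit j A = weylU (p • Pi.single (Sum.inl j) 1 + q • Pi.single (Sum.inr j) 1 : V n) := by
  rw [coe_weylU, onQubit]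
  congr 1
  funext k
  by_cases hk : k = j
  · subst hk
    simp [← hA]
  · simp [hk, weylOne_zero]

lemma onQubit_matY [NeZero n] : onQubit (0 : Fin n) matY = weylU (y1 n) := by
  rw [onQubit_eq_weylU 0 1 1, one_smul, one_smul]
  · rfl
  · have ho : (1 : ZMod 2).val = 1 := rfl
    ext a b
    fin_cases a <;> fin_cases b <;>
      simp [weylOne, ho, uI, uX, uZ, matX, matZ, matY, Matrix.mul_apply, Fin.sum_univ_two,
        Matrix.star_apply]

lemma isSignChar_signChar [NeZero n] : IsSignChar (signChar n) := by
  intro U h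
  rw [onQubit_matY, mul_weylU, mem_IN.mp h, smul_mul_assoc, mul_assoc, unitary_mul_star, mul_one]
  rfl

/-- An element of `𝒞ₙ` over `Γ` acting with positive signs on the vectors fixed by `Γ`. -/
lemma exists_positive_lift [NeZero n] (Γ : Sp n) : ∃ g : C n, (∀ x, act g x = Γ.1 *ᵥ x) ∧
    (∀ y, act g y = y → sgn g y = 1) ∧ (Γ = 1 → g = 1) := by
  -- The identity is treated apart so that the resulting section is normalized.
  by_cases h1 : Γ = 1
  · subst h1
    exact ⟨1, fun x => by rw [act_one, symp_one_mulVec], fun y _ => sgn_one y, fun _ => rfl⟩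
  obtain ⟨g, rfl⟩ := cliffSymp_surjective Γ
  let F : Submodule (ZMod 2) (V n) := LinearMap.eqLocus (actLin g) LinearMap.id
  have hF : ∀ y : F, act g (y : V n) = y := fun y => y.2
  obtain ⟨l, hl⟩ := exists_functional (fun y : F => sgn g (y : V n))
    (fun x y => sgn_add (hF x) (hF y)) (fun x => sgn_mul_self g x)
  -- The sign functional lives only on the fixed space; it must be extended to all of `V n` before
  -- it can be represented by a vector `z`.
  obtain ⟨l', hl'⟩ := LinearMap.exists_extend l
  obtain ⟨z, hz⟩ := exists_om_eq l'
  refine ⟨wl z * g, fun x => by rw [act_mul, act_wl, cliffSymp_mulVec], fun y hy => ?_,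
    fun h => absurd h h1⟩
  rw [act_mul, act_wl] at hy
  have h2 : l ⟨y, hy⟩ = om z y := by rw [← hz, ← hl']; rfl
  rw [sgn_mul, hy, sgn_wl, hl ⟨y, hy⟩, h2, sg_mul_self]

/-- If `r⁻¹ t(Γ) r` fixes `y1`, then `t(Γ)` fixes `r y1`. The signs of `r` and `r⁻¹` cancel, leaving
the sign of `t(Γ)` at a fixed vector, which is 1. -/
lemma exists_isAdaptedSection [NeZero n] : ∃ t : Sp n → C n, IsAdaptedSection (signChar n) t := by
  choose t h1 h2 h3 using exists_positive_lift (n := n)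
  refine ⟨t, h3 1 rfl, fun Γ x => ?_, fun Γ r h => ?_⟩
  · rw [weyl_eq_wl, ← wl_act, h1]
    rfl
  · have hf := mem_IN.mp h
    have hfix : act (t Γ) (act r (y1 n)) = act r (y1 n) := by
      rw [act_mul, act_mul] at hf
      conv_rhs => rw [← hf, act_act_inv]
    rw [signChar_apply, sgn_mul, sgn_mul, hfix, h2 Γ _ hfix, mul_one, ← sgn_mul, inv_mul_cancel,
      sgn_one]

/-! ## The twist of a representation of `𝒞ₙ` -/

lemma IsAdaptedSection.act_eq [NeZero n] {τ : IN n →* ℂˣ} {t : Sp n → C n}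
    (ht : IsAdaptedSection τ t) (Γ : Sp n) (x : V n) : act (t Γ) x = Γ.1 *ᵥ x := by
  rw [act_eq_iff, ← mul_inv_eq_iff_eq_mul]
  exact ht.2.1 Γ (Multiplicative.ofAdd x)

/-- Here `V n` indexes the Pauli characters `[W_x] ↦ (-1)^{ω(x, y)}`, on which translations act
trivially; it is not the affine action on points. -/
instance affSpAction : MulAction (AffSp n) (V n) where
  smul a y := a.right.1 *ᵥ y
  one_smul y := symp_one_mulVec y
  mul_smul a b y := symp_mul_mulVec a.right b.right y

lemma affSp_smul_def (a : AffSp n) (y : V n) : a • y = a.right.1 *ᵥ y := rfl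

/-! ### The bijection `φ` and its failure to be multiplicative -/

section Section

variable [NeZero n] {τ : IN n →* ℂˣ} {t : Sp n → C n}

lemma IsAdaptedSection.act_phi (ht : IsAdaptedSection τ t) (a : AffSp n) (x : V n) :
    act (phi t a) x = a • x := by
  rw [phi, weyl_eq_wl, act_mul, act_wl, ht.act_eq, affSp_smul_def]

lemma IsAdaptedSection.phi_bijective (ht : IsAdaptedSection τ t) :
    Function.Bijective (phi t) := by
  constructor
  · intro a b h
    have hr : a.right = b.right := symp_ext fun x => by
      rw [← affSp_smul_def, ← ht.act_phi, h, ht.act_phi, affSp_smul_def]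
    refine SemidirectProduct.ext ?_ hr
    rw [phi, phi, hr] at h
    exact weyl_injective n (mul_right_cancel h)
  · intro g
    have h : cliffSymp n g = cliffSymp n (t (cliffSymp n g)) := symp_ext fun x => by
      rw [cliffSymp_mulVec, cliffSymp_mulVec, ht.act_eq, cliffSymp_mulVec]
    obtain ⟨z, hz⟩ := cliffSymp_eq_iff.mp h
    exact ⟨⟨Multiplicative.ofAdd z, cliffSymp n g⟩, hz.symm⟩

/-- `φ` is multiplicative up to the defect of `t`. -/
lemma IsAdaptedSection.exists_defect (ht : IsAdaptedSection τ t) (a b : AffSp n) :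
    ∃ z : V n, t a.right * t b.right = wl z * t (a * b).right ∧
      phi t a * phi t b = wl z * phi t (a * b) := by
  have h : cliffSymp n (t a.right * t b.right) = cliffSymp n (t (a * b).right) :=
    symp_ext fun x => by
      rw [cliffSymp_mulVec, cliffSymp_mulVec, act_mul, ht.act_eq, ht.act_eq, ht.act_eq,
        SemidirectProduct.mul_right, symp_mul_mulVec]
  obtain ⟨z, hz⟩ := cliffSymp_eq_iff.mp h
  refine ⟨z, hz, ?_⟩
  have e : t a.right * weyl n b.left = weyl n (sympAct n a.right b.left) * t a.right := by
    rw [← mul_inv_eq_iff_eq_mul, ht.2.1]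
  have e2 : weyl n a.left * weyl n (sympAct n a.right b.left) * wl z
      = wl z * weyl n (a * b).left := by
    rw [SemidirectProduct.mul_left, map_mul, weyl_eq_wl, weyl_eq_wl, ← wl_add, ← wl_add, ← wl_add,
      add_comm]
  rw [phi, phi, phi, mul_assoc, ← mul_assoc (t a.right), e, mul_assoc, ← mul_assoc, hz,
    ← mul_assoc, e2, mul_assoc]

end Section

/-! ### Isotypic projections for the projective Pauli group -/

section IsoProj

/-- Orthogonality of characters: by nondegeneracy only `y = 0` gives the trivial character. -/
lemma sum_sg_om (y : V n) :
    ∑ x : V n, (sg (om x y) : ℂ) = if y = 0 then (Nat.card (V n) : ℂ) else 0 := by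
  let f : Multiplicative (V n) →* ℂ :=
    { toFun := fun x => (sg (om x.toAdd y) : ℂ)
      map_one' := by simp [om_zero_left, sg_zero]
      map_mul' := fun a b => by rw [toAdd_mul, om_add_left, sg_add, Units.val_mul] }
  split_ifs with h
  · subst h
    simp [om_zero_right, sg_zero]
  · have hf : f ≠ 1 := by
      intro hf
      apply h
      refine eq_zero_of_om y fun x => ?_
      have h1 : (sg (om x y) : ℂ) = 1 := DFunLike.congr_fun hf (Multiplicative.ofAdd x)
      rw [om_comm]
      exact sg_injective (by rw [sg_zero]; exact Units.ext h1)
    exact (Fintype.sum_equiv Multiplicative.ofAdd _ f fun _ => rfl).trans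
      (sum_hom_units_eq_zero f hf)

variable {W : Type} [AddCommGroup W] [Module ℂ W] (ρ : Representation ℂ (C n) W)

/-- The projection onto the isotypic component of the character `[W_x] ↦ (-1)^{ω(x, y)}`. -/
noncomputable def isoProj (y : V n) : Module.End ℂ W :=
  (Nat.card (V n) : ℂ)⁻¹ • ∑ x : V n, (sg (om x y) : ℂ) • ρ (wl x)

lemma wl_mul_isoProj (z y : V n) : ρ (wl z) * isoProj ρ y = (sg (om z y) : ℂ) • isoProj ρ y := by
  rw [isoProj, mul_smul_comm, smul_comm (sg (om z y) : ℂ)]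
  congr 1
  rw [Finset.mul_sum, Finset.smul_sum]
  refine Fintype.sum_equiv (Equiv.addLeft z) _ _ fun x => ?_
  rw [Equiv.coe_addLeft, mul_smul_comm, ← map_mul, ← wl_add, smul_smul, om_add_left, sg_add,
    ← Units.val_mul, ← mul_assoc, sg_mul_self, one_mul]

/-- Conjugation by `g` permutes the Weyl classes by `act g`, and invariance of the form lets the sum
be reindexed. -/
lemma mul_isoProj (g : C n) (y : V n) : ρ g * isoProj ρ y = isoProj ρ (act g y) * ρ g := by
  rw [isoProj, isoProj, mul_smul_comm, smul_mul_assoc, Finset.mul_sum, Finset.sum_mul]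
  congr 1
  refine Fintype.sum_equiv ⟨act g, act g⁻¹, act_inv_act g, act_act_inv g⟩ _ _ fun x => ?_
  rw [Equiv.coe_fn_mk, om_act, mul_smul_comm, smul_mul_assoc, ← map_mul, ← map_mul, wl_act,
    inv_mul_cancel_right]

lemma isoProj_mul (y z : V n) : isoProj ρ y * isoProj ρ z = if y = z then isoProj ρ y else 0 := by
  conv_lhs => rw [isoProj]
  rw [smul_mul_assoc, Finset.sum_mul]
  simp only [smul_mul_assoc, wl_mul_isoProj, smul_smul, ← Units.val_mul, ← sg_add, ← om_add_right]
  rw [← Finset.sum_smul, sum_sg_om, smul_smul]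
  by_cases h : y = z
  · subst h
    rw [if_pos (add_self_eq_zero y), if_pos rfl, inv_mul_cancel₀ (by simp), one_smul]
  · rw [if_neg, if_neg h, mul_zero, zero_smul]
    intro h0
    apply h
    rw [← add_zero y, ← add_self_eq_zero z, ← add_assoc, h0, zero_add]

lemma sum_isoProj : ∑ y, isoProj ρ y = 1 := by
  simp only [isoProj]
  rw [← Finset.smul_sum, Finset.sum_comm]
  have h : ∀ x : V n, ∑ y : V n, (sg (om x y) : ℂ) • ρ (wl x)
      = (if x = 0 then (Nat.card (V n) : ℂ) else 0) • ρ (wl x) := fun x => by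
    rw [← Finset.sum_smul, ← sum_sg_om x]
    simp only [om_comm x]
  rw [Finset.sum_congr rfl fun x _ => h x, Finset.sum_eq_single 0]
  · rw [if_pos rfl, smul_smul, inv_mul_cancel₀ (by simp), one_smul, wl_zero, map_one]
  · intro x _ hx
    rw [if_neg hx, zero_smul]
  · simp

end IsoProj

end

section

variable {n : ℕ}

lemma affSp_smul_ne_zero (a : AffSp n) {y : V n} (hy : y ≠ 0) : a • y ≠ 0 := by
  intro h
  apply hy
  rw [← inv_smul_smul a y, h]
  exact Matrix.mulVec_zero _

/-! ### The twist that makes `χ ∘ φ` a character -/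

section Twisting

variable [NeZero n] {τ : IN n →* ℂˣ} {t : Sp n → C n}

lemma exists_transporter : ∃ r : V n → C n, ∀ y, y ≠ 0 → act (r y) (y1 n) = y := by
  have h : ∀ y : V n, ∃ r : C n, y ≠ 0 → act r (y1 n) = y := fun y => by
    by_cases hy : y = 0
    · exact ⟨1, fun h => absurd hy h⟩
    · obtain ⟨g, hg⟩ := exists_act_eq_of_ne_zero y1_ne_zero hy
      exact ⟨g, fun _ => hg⟩
  exact ⟨fun y => (h y).choose, fun y => (h y).choose_spec⟩

/-- An element of `𝒞ₙ` whose action moves `Y₁` to a given nonzero vector. -/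
noncomputable def transporter (y : V n) : C n := exists_transporter.choose y

lemma act_transporter {y : V n} (hy : y ≠ 0) : act (transporter y) (y1 n) = y :=
  exists_transporter.choose_spec y hy

/-- The element of `IN_n` which `t(Γ)` induces between the isotypic components at `y` and `Γ y`. -/
noncomputable def transition (t : Sp n → C n) (a : AffSp n) (y : V n) : C n :=
  (transporter (a • y))⁻¹ * t a.right * transporter y

open Classical in
/-- The scalars correcting `ρ ∘ φ` to a representation. -/
noncomputable def correction (τ : IN n →* ℂˣ) (t : Sp n → C n) (a : AffSp n) (y : V n) : ℂ :=
  if y = 0 then 1 else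
    (extendZero (IN n) ((Units.coeHom ℂ).comp τ) (transition t a y))⁻¹

/-- The path `y1 → y → a • y → y1` is closed. Hence the zero default in `correction` is never
reached for nonzero `y`. -/
lemma IsAdaptedSection.transition_mem (ht : IsAdaptedSection τ t) (a : AffSp n) {y : V n}
    (hy : y ≠ 0) : transition t a y ∈ IN n := by
  rw [mem_IN, transition, act_mul, act_mul, act_transporter hy, ht.act_eq, ← affSp_smul_def]
  conv_lhs => rw [← act_transporter (affSp_smul_ne_zero a hy),
    act_transporter (affSp_smul_ne_zero a hy)]
  rw [← (act_inv_act (transporter (a • y)) (y1 n)), act_transporter (affSp_smul_ne_zero a hy)]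

lemma extendsSigma1_wl (hτ : ExtendsSigma1 τ) (z : V n) (h : wl z ∈ IN n) :
    τ ⟨wl z, h⟩ = sg (om z (y1 n)) := by
  rw [← sigma1_wl z (wl_mem z), ← hτ]
  rfl

/-- The defect `[W_z]` of `φ` acts on the component at `(a * b) • y` by `(-1)^{ω(z, (a * b) • y)}`.
Carried back to `y1`, this is the value of `τ` on a Weyl class, so the values of `τ` on the
transitions have exactly the cocycle needed. -/
lemma IsAdaptedSection.twistDatum (ht : IsAdaptedSection τ t) (hτ : ExtendsSigma1 τ)
    {W : Type} [AddCommGroup W] [Module ℂ W] (ρ : Representation ℂ (C n) W) :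
    TwistDatum ρ (phi t) (isoProj ρ) (correction τ t) where
  mul := isoProj_mul ρ
  sum := sum_isoProj ρ
  equivariant a y := by rw [mul_isoProj, ht.act_phi]
  cocycle a b y := by
    obtain ⟨z, hz, hφ⟩ := ht.exists_defect a b
    rw [← map_mul, hφ, map_mul, mul_assoc, mul_isoProj, ht.act_phi, ← mul_assoc, wl_mul_isoProj,
      smul_mul_assoc, ← ht.act_phi, ← mul_isoProj, smul_smul, ht.act_phi]
    congr 1
    -- On the component at 0 the Weyl operators act trivially, so no correction is required.
    by_cases hy : y = 0
    · subst hy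
      have h0 : ∀ c : AffSp n, c • (0 : V n) = 0 := fun c => Matrix.mulVec_zero _
      simp [correction, h0, om_zero_right, sg_zero]
    · have hby := affSp_smul_ne_zero b hy
      have haby : (a * b) • y ≠ 0 := affSp_smul_ne_zero _ hy
      -- Transitions compose up to the defect conjugated into `IN n`; applying `τ` turns this into
      -- the cocycle identity.
      have e : transition t a (b • y) * transition t b y
          = wl (act (transporter ((a * b) • y))⁻¹ z) * transition t (a * b) y := by
        rw [wl_act, transition, transition, transition, ← mul_smul, inv_inv]
        calc _ = (transporter ((a * b) • y))⁻¹ * (t a.right * t b.right) * transporter y := by group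
          _ = _ := by rw [hz]; group
      have hw : wl (act (transporter ((a * b) • y))⁻¹ z) ∈ IN n := by rw [mem_IN, act_wl]
      have e' := congrArg (extendZero (IN n) ((Units.coeHom ℂ).comp τ)) e
      rw [extendZero_mul _ (ht.transition_mem a hby) (ht.transition_mem b hy),
        extendZero_mul _ hw (ht.transition_mem (a * b) hy), extendZero_of_mem _ hw,
        MonoidHom.comp_apply, extendsSigma1_wl hτ, om_act_inv, act_transporter haby] at e'
      rw [correction, correction, correction, if_neg hy, if_neg hby, if_neg hy, ← mul_inv, e',
        mul_inv]
      have hs : ((sg (om z ((a * b) • y)) : ℂˣ) : ℂ)⁻¹ = sg (om z ((a * b) • y)) := by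
        rw [← Units.val_inv_eq_inv_val, sg_inv]
      rw [Units.coeHom_apply, hs, mul_right_comm, ← Units.val_mul, sg_mul_self, Units.val_one,
        one_mul]
  fixed a y hay := by
    by_cases hy : y = 0
    · rw [correction, if_pos hy]
    · have hm := ht.transition_mem a hy
      rw [correction, if_neg hy, extendZero_of_mem _ hm]
      -- For a fixed `y` the two transporters coincide, so the transition is a conjugate of `t(Γ)`
      -- and adaptedness applies.
      have h1 : τ ⟨transition t a y, hm⟩ = 1 := by
        have e : transition t a y = (transporter y)⁻¹ * t a.right * transporter y := by
          rw [transition, hay]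
        simp only [e] at hm ⊢
        exact ht.2.2 a.right (transporter y) hm
      rw [MonoidHom.comp_apply, h1]
      simp
  ne_zero a y := by
    by_cases hy : y = 0
    · rw [correction, if_pos hy]
      exact one_ne_zero
    · rw [correction, if_neg hy, extendZero_of_mem _ (ht.transition_mem a hy)]
      exact inv_ne_zero (Units.ne_zero _)
  one := by
    rw [phi, SemidirectProduct.one_left, SemidirectProduct.one_right, map_one, ht.1, mul_one]

/-- Composition with `φ` is not a pullback of representations, but the twisted representation has
the same trace. -/
lemma IsAdaptedSection.isIrrChar_comp_phi (ht : IsAdaptedSection τ t) (hτ : ExtendsSigma1 τ)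
    {χ : C n → ℂ} (hχ : IsIrrChar χ) : IsIrrChar (χ ∘ phi t) := by
  have : Finite (AffSp n) := Finite.of_injective _ ht.phi_bijective.injective
  obtain ⟨W, _, _, _, ρ, hρ, rfl⟩ := (isIrrChar_iff χ).mp hχ
  have D := ht.twistDatum hτ ρ
  refine (isIrrChar_iff _).mpr ⟨W, inferInstance, inferInstance, inferInstance, D.rep, ?_,
    D.character_rep⟩
  refine D.isIrreducible_rep ht.phi_bijective.surjective fun M hM y v hv => ?_
  -- Translations fix every component, so their correction is 1 and the twist leaves the Weyl
  -- operators unchanged. The isotypic projections are therefore combinations of operators of the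
  -- twisted representation.
  have hwl : ∀ x : V n, ρ (wl x) = D.rep ⟨Multiplicative.ofAdd x, 1⟩ := fun x => by
    have hfix : ∀ y : V n, (⟨Multiplicative.ofAdd x, 1⟩ : AffSp n) • y = y :=
      fun y => symp_one_mulVec y
    rw [D.rep_apply]
    simp only [D.fixed _ _ (hfix _), one_smul]
    rw [D.sum, mul_one, phi, ht.1, mul_one]
    rfl
  rw [isoProj, LinearMap.smul_apply, LinearMap.sum_apply]
  refine M.smul_mem _ (M.sum_mem fun x _ => ?_)
  rw [LinearMap.smul_apply, hwl]
  exact M.smul_mem _ (hM _ v hv)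

end Twisting

end

section

variable {n : ℕ}

/-! ## The projection onto the affine symplectic group -/

/-- The restriction of a vector to the last `n` qubits. -/
def rest (n : ℕ) : V (n + 1) →ₗ[ZMod 2] V n :=
  LinearMap.funLeft (ZMod 2) (ZMod 2) (Sum.map Fin.succ Fin.succ)

/-- The extension of a vector by zero on the first qubit. -/
def emb (n : ℕ) : V n →ₗ[ZMod 2] V (n + 1) where
  toFun x := Sum.elim (Fin.cons 0 fun k => x (Sum.inl k)) (Fin.cons 0 fun k => x (Sum.inr k))
  map_add' x y := by
    funext s
    rcases s with k | k <;> cases k using Fin.cases <;> simp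
  map_smul' a x := by
    funext s
    rcases s with k | k <;> cases k using Fin.cases <;> simp

lemma rest_inl (x : V (n + 1)) (k : Fin n) : rest n x (Sum.inl k) = x (Sum.inl k.succ) := rfl

lemma rest_inr (x : V (n + 1)) (k : Fin n) : rest n x (Sum.inr k) = x (Sum.inr k.succ) := rfl

lemma emb_inl_zero (x : V n) : emb n x (Sum.inl 0) = 0 := rfl

lemma emb_inr_zero (x : V n) : emb n x (Sum.inr 0) = 0 := rfl

lemma rest_emb (x : V n) : rest n (emb n x) = x := by
  funext s
  rcases s with k | k <;> rfl

/-- The vector of the Weyl operator `Z₁`. -/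
def f1 (n : ℕ) : V (n + 1) := Pi.single (Sum.inl 0) 1

lemma rest_f1 : rest n (f1 n) = 0 := by
  funext s
  rcases s with k | k
  · rw [rest_inl]; exact Pi.single_eq_of_ne (by simp) _
  · rw [rest_inr]; exact Pi.single_eq_of_ne (by simp) _

lemma rest_y1 : rest n (y1 (n + 1)) = 0 := by
  rw [y1, map_add]
  funext s
  rcases s with k | k
  · rw [Pi.add_apply, rest_inl, rest_inl]; simp
  · rw [Pi.add_apply, rest_inr, rest_inr]; simp

lemma om_f1_y1 : om (f1 n) (y1 (n + 1)) = 1 := by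
  rw [om_y1, f1]; simp

lemma om_succ (x y : V (n + 1)) : om x y = x (Sum.inl 0) * y (Sum.inr 0)
    + x (Sum.inr 0) * y (Sum.inl 0) + om (rest n x) (rest n y) := by
  rw [om, Fin.sum_univ_succ]
  rfl

lemma om_emb (x y : V n) : om (emb n x) (emb n y) = om x y := by
  rw [om_succ, emb_inl_zero, emb_inr_zero x, rest_emb, rest_emb, zero_mul, zero_mul, zero_add,
    zero_add]

lemma om_emb_y1 (x : V n) : om (emb n x) (y1 (n + 1)) = 0 := by
  rw [om_y1, emb_inl_zero, emb_inr_zero, add_zero]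

/-- On `y1^⊥` the two coordinates of the first qubit agree, so its contribution to the form occurs
twice and cancels: the form descends to `y1^⊥ / y1`. -/
lemma om_rest {x y : V (n + 1)} (hx : om x (y1 (n + 1)) = 0) (hy : om y (y1 (n + 1)) = 0) :
    om (rest n x) (rest n y) = om x y := by
  rw [om_y1, CharTwo.add_eq_zero] at hx hy
  rw [om_succ, hx, hy, CharTwo.add_self_eq_zero, zero_add]

/-- The space splits into the hyperbolic plane spanned by `f1` and `y1` and the copy of `V n` on the
remaining qubits. -/
lemma eq_decomposition (x : V (n + 1)) : x = om x (y1 (n + 1)) • f1 n + x (Sum.inr 0) • y1 (n + 1)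
    + emb n (rest n x) := by
  rw [om_y1]
  have h : ∀ a b : ZMod 2, a = a + b + b := fun a b => by
    rw [add_assoc, CharTwo.add_self_eq_zero, add_zero]
  funext s
  rcases s with k | k <;> cases k using Fin.cases with
  | zero => simp [f1, y1, emb, ← h]
  | succ k => simp [f1, y1, emb, rest_inl, rest_inr]

lemma act_smul (g : C n) (a : ZMod 2) (x : V n) : act g (a • x) = a • act g x :=
  map_smul (actLin g) a x

lemma om_act_y1 [NeZero n] {g : C n} (hg : g ∈ IN n) (x : V n) :
    om (act g x) (y1 n) = om x (y1 n) := by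
  conv_lhs => rw [← mem_IN.mp hg, om_act]

/-- Modulo `y1`, the action of `g` is determined by its values on `f1` and on the last `n` qubits.
This is the source of the semidirect product law. -/
lemma rest_act {g : C (n + 1)} (hg : g ∈ IN (n + 1)) (x : V (n + 1)) :
    rest n (act g x) = om x (y1 (n + 1)) • rest n (act g (f1 n))
      + rest n (act g (emb n (rest n x))) := by
  conv_lhs => rw [eq_decomposition x]
  rw [act_add, act_add, act_smul, act_smul, mem_IN.mp hg, map_add, map_add, map_smul, map_smul,
    rest_y1, smul_zero, add_zero]

lemma exists_restSymp (g : IN (n + 1)) :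
    ∃ Γ : Sp n, ∀ x, Γ.1 *ᵥ x = rest n (act (g : C (n + 1)) (emb n x)) :=
  exists_symp (rest n ∘ₗ actLin (g : C (n + 1)) ∘ₗ emb n) fun x y => by
    change om (rest n (act (g : C (n + 1)) (emb n x))) (rest n (act (g : C (n + 1)) (emb n y))) = _
    rw [om_rest, om_act, om_emb]
    · rw [om_act_y1 g.2, om_emb_y1]
    · rw [om_act_y1 g.2, om_emb_y1]

/-- The action of `IN_{n+1}` on `Y₁^⊥ / Y₁`. -/
noncomputable def restSymp (g : IN (n + 1)) : Sp n := (exists_restSymp g).choose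

lemma restSymp_mulVec (g : IN (n + 1)) (x : V n) :
    (restSymp g).1 *ᵥ x = rest n (act (g : C (n + 1)) (emb n x)) :=
  (exists_restSymp g).choose_spec x

/-- The projection `IN_{n+1} → Sp(2n,2) ⋉ ℤ₂²ⁿ`. -/
noncomputable def affProj (n : ℕ) : IN (n + 1) →* AffSp n :=
  MonoidHom.mk' (fun g => ⟨Multiplicative.ofAdd (rest n (act (g : C (n + 1)) (f1 n))), restSymp g⟩)
    fun g h => by
      refine SemidirectProduct.ext ?_ ?_
      · rw [SemidirectProduct.mul_left]
        change Multiplicative.ofAdd _ = Multiplicative.ofAdd (_ + (restSymp g).1 *ᵥ _)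
        -- The vector `h f1` still pairs to 1 with `y1`, so the translation part of `g` enters
        -- exactly once.
        rw [Subgroup.coe_mul, act_mul, rest_act g.2, om_act_y1 h.2, om_f1_y1, one_smul,
          restSymp_mulVec]
        rfl
      · rw [SemidirectProduct.mul_right]
        refine symp_ext fun x => ?_
        rw [symp_mul_mulVec, restSymp_mulVec, restSymp_mulVec, restSymp_mulVec, Subgroup.coe_mul,
          act_mul, rest_act g.2, om_act_y1 h.2, om_emb_y1, zero_smul, zero_add]

lemma affProj_left (g : IN (n + 1)) : (affProj n g).left
    = Multiplicative.ofAdd (rest n (act (g : C (n + 1)) (f1 n))) := rfl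

lemma affProj_right (g : IN (n + 1)) : (affProj n g).right = restSymp g := rfl

lemma tv_y1_mem [NeZero n] {y : V n} (hy : om y (y1 n) = 0) : tv y ∈ IN n := by
  rw [mem_IN, act_tv, om_comm, hy, zero_smul, add_zero]

lemma wl_mem_IN [NeZero n] (x : V n) : wl x ∈ IN n := by rw [mem_IN, act_wl]

lemma affProj_eq_one_of {g : IN (n + 1)} (h1 : rest n (act (g : C (n + 1)) (f1 n)) = 0)
    (h2 : ∀ x, rest n (act (g : C (n + 1)) (emb n x)) = x) : affProj n g = 1 := by
  refine SemidirectProduct.ext ?_ ?_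
  · rw [affProj_left, h1]; rfl
  · rw [affProj_right]
    exact symp_ext fun x => by rw [restSymp_mulVec, h2]; exact (symp_one_mulVec x).symm

lemma affProj_wl (x : V (n + 1)) : affProj n ⟨wl x, wl_mem_IN x⟩ = 1 :=
  affProj_eq_one_of (by rw [act_wl, rest_f1]) fun y => by rw [act_wl, rest_emb]

lemma affProj_tv_y1 : affProj n ⟨tv (y1 (n + 1)), tv_y1_mem (om_self _)⟩ = 1 :=
  affProj_eq_one_of (by rw [act_tv, map_add, map_smul, rest_f1, rest_y1, smul_zero, add_zero])
    fun y => by rw [act_tv, map_add, map_smul, rest_emb, rest_y1, smul_zero, add_zero]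

/-- The kernel of `affProj` is generated by the Weyl operators and the transvection of `Y₁`. -/
lemma exists_of_affProj_eq_one {g : IN (n + 1)} (h : affProj n g = 1) :
    ∃ z, (g : C (n + 1)) = wl z ∨ (g : C (n + 1)) = wl z * tv (y1 (n + 1)) := by
  obtain ⟨g, hg⟩ := g
  have hl : rest n (act g (f1 n)) = 0 :=
    Multiplicative.ofAdd.injective (congrArg SemidirectProduct.left h)
  have hr : ∀ x, rest n (act g (emb n x)) = x := fun x => by
    rw [← restSymp_mulVec ⟨g, hg⟩, ← affProj_right, h]
    exact symp_one_mulVec x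
  -- A trivial translation part leaves `g f1 = f1 + c • y1`; the bit `c` is the only freedom left.
  have hf := eq_decomposition (act g (f1 n))
  rw [om_act_y1 hg, om_f1_y1, one_smul, hl, map_zero, add_zero] at hf
  -- A priori a multiple of `y1` could be added; pairing with `g f1` shows that its coefficient is
  -- 0.
  have he : ∀ x, act g (emb n x) = emb n x := by
    intro x
    have h1 := eq_decomposition (act g (emb n x))
    rw [om_act_y1 hg, om_emb_y1, zero_smul, zero_add, hr] at h1
    have h2 := om_act g (f1 n) (emb n x)
    rw [hf, h1, om_add_right, om_add_left, om_smul_left, om_smul_right, om_smul_right, om_self,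
      om_f1_y1, om_add_left, om_smul_left, om_comm (y1 _), om_emb_y1] at h2
    have h3 : act g (emb n x) (Sum.inr 0) = 0 := by linear_combination h2
    rw [h1, h3, zero_smul, zero_add]
  have hg1 := mem_IN.mp hg
  -- Thus `g` acts as the identity or as the transvection of `y1`, according to the bit `c`.
  have hall : ∀ x, act g x = x + (act g (f1 n) (Sum.inr 0) * om x (y1 (n + 1))) • y1 (n + 1) := by
    intro x
    conv_lhs => rw [eq_decomposition x, act_add, act_add, act_smul, act_smul, hg1, he, hf]
    conv_rhs => rw [eq_decomposition x]
    simp only [om_add_left, om_smul_left, om_self, om_f1_y1, om_emb_y1]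
    module
  rcases zmod_two_cases (act g (f1 n) (Sum.inr 0)) with h0 | h0
  · obtain ⟨z, hz⟩ := exists_wl_of_act_eq g fun x => by
      rw [hall, h0, zero_mul, zero_smul, add_zero]
    exact ⟨z, Or.inl hz⟩
  · have hc : cliffSymp (n + 1) g = cliffSymp (n + 1) (tv (y1 (n + 1))) := symp_ext fun x => by
      rw [cliffSymp_mulVec, cliffSymp_mulVec, act_tv, hall, h0, one_mul]
    obtain ⟨z, hz⟩ := cliffSymp_eq_iff.mp hc
    exact ⟨z, Or.inr hz⟩

/-! ## The generators -/

lemma classOf_coe (U : cliff n) : classOf ((U : QU n) : QMat n) = {(U : C n)} := by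
  ext g
  constructor
  · rintro ⟨T, hT, rfl⟩
    rw [Set.mem_singleton_iff, Subtype.ext (Subtype.ext hT)]
  · rintro rfl
    exact ⟨U, rfl, rfl⟩

lemma classOf_weylU (x : V n) : classOf (weylU x : QMat n) = {wl x} :=
  classOf_coe ⟨weylU x, weylU_mem x⟩

lemma weylOne_one_zero : (weylOne 1 0 : Matrix (Fin 2) (Fin 2) ℂ) = matZ := by
  have ho : (1 : ZMod 2).val = 1 := rfl
  simp [weylOne, ho, uZ]

lemma weylOne_zero_one : (weylOne 0 1 : Matrix (Fin 2) (Fin 2) ℂ) = matX := by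
  have ho : (1 : ZMod 2).val = 1 := rfl
  simp [weylOne, ho, uX]

lemma onQubit_matZ (j : Fin n) : onQubit j matZ = weylU (Pi.single (Sum.inl j) 1 : V n) := by
  rw [onQubit_eq_weylU j 1 0 weylOne_one_zero, one_smul, zero_smul, add_zero]

lemma onQubit_matX (j : Fin n) : onQubit j matX = weylU (Pi.single (Sum.inr j) 1 : V n) := by
  rw [onQubit_eq_weylU j 0 1 weylOne_zero_one, one_smul, zero_smul, zero_add]

lemma onQubit_add (j : Fin n) (A B : Matrix (Fin 2) (Fin 2) ℂ) :
    onQubit j (A + B) = onQubit j A + onQubit j B := by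
  ext a b
  simp only [onQubit, tensor, Matrix.of_apply, Matrix.add_apply]
  rw [← Finset.mul_prod_erase _ _ (Finset.mem_univ j),
    ← Finset.mul_prod_erase _ _ (Finset.mem_univ j),
    ← Finset.mul_prod_erase _ _ (Finset.mem_univ j)]
  have h : ∀ M : Matrix (Fin 2) (Fin 2) ℂ, ∏ k ∈ Finset.univ.erase j,
      Function.update (fun _ => (1 : Matrix (Fin 2) (Fin 2) ℂ)) j M k (a k) (b k)
      = ∏ k ∈ Finset.univ.erase j, (1 : Matrix (Fin 2) (Fin 2) ℂ) (a k) (b k) := fun M =>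
    Finset.prod_congr rfl fun k hk => by rw [Function.update_of_ne (Finset.ne_of_mem_erase hk)]
  rw [h, h, h, Function.update_self, Function.update_self, Function.update_self, Matrix.add_apply,
    add_mul]

lemma onQubit_smul (j : Fin n) (c : ℂ) (A : Matrix (Fin 2) (Fin 2) ℂ) :
    onQubit j (c • A) = c • onQubit j A := by
  ext a b
  simp only [onQubit, tensor, Matrix.of_apply, Matrix.smul_apply]
  rw [← Finset.mul_prod_erase _ _ (Finset.mem_univ j),
    ← Finset.mul_prod_erase _ _ (Finset.mem_univ j),
    Function.update_self, Function.update_self, Matrix.smul_apply, smul_eq_mul, smul_eq_mul,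
    mul_assoc]
  congr 2
  exact Finset.prod_congr rfl fun k hk => by
    rw [Function.update_of_ne (Finset.ne_of_mem_erase hk),
      Function.update_of_ne (Finset.ne_of_mem_erase hk)]

lemma onQubit_mul (j : Fin n) (A B : Matrix (Fin 2) (Fin 2) ℂ) :
    onQubit j A * onQubit j B = onQubit j (A * B) := by
  rw [onQubit, onQubit, tensor_mul, onQubit]
  congr 1
  funext k
  by_cases hk : k = j
  · subst hk; simp
  · simp [hk]

lemma onQubit_one (j : Fin n) : onQubit j (1 : Matrix (Fin 2) (Fin 2) ℂ) = 1 := by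
  rw [onQubit, Function.update_eq_self_iff.mpr rfl, tensor_one]

/-- This identifies `Z₁H₁` with the transvection unitary of `Y₁`, so that `[H₁]` is `[Z₁]` times a
transvection. -/
lemma matZ_mul_matH : matZ * matH = ((Real.sqrt 2 : ℝ) : ℂ)⁻¹ • (1 + Complex.I • matY) := by
  ext a b
  fin_cases a <;> fin_cases b <;> simp [matZ, matH, matY, Matrix.mul_apply, Fin.sum_univ_two]

lemma matZ_mul_self : matZ * matZ = 1 := congrArg Subtype.val uZ_sq

lemma onQubit_ZH [NeZero n] :
    onQubit (0 : Fin n) (matZ * matH) = (tvU (y1 n) : QMat n) := by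
  rw [matZ_mul_matH, onQubit_smul, onQubit_add, onQubit_smul, onQubit_one, onQubit_matY, coe_tvU]

lemma onQubit_matH [NeZero n] : onQubit (0 : Fin n) matH
    = (weylU (Pi.single (Sum.inl 0) 1 : V n) : QMat n) * (tvU (y1 n) : QMat n) := by
  rw [← onQubit_matZ, ← onQubit_ZH, onQubit_mul, ← mul_assoc, matZ_mul_self, one_mul]

lemma classOf_matH [NeZero n] : classOf (onQubit (0 : Fin n) matH)
    = {wl (Pi.single (Sum.inl 0) 1) * tv (y1 n)} := by
  rw [onQubit_matH]
  exact classOf_coe (⟨weylU (Pi.single (Sum.inl 0) 1 : V n), weylU_mem _⟩ * ⟨tvU (y1 n), tvU_mem _⟩)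

/-- A subgroup containing the classes of all `X_i` and `Z_i` contains the projective Pauli group. -/
lemma wl_mem_of_forall {S : Subgroup (C n)} (h : ∀ s : Fin n ⊕ Fin n, wl (Pi.single s 1) ∈ S)
    (x : V n) : wl x ∈ S := by
  have h1 : Multiplicative.ofAdd x ∈ S.comap (weyl n) := by
    have e : Multiplicative.ofAdd x = ∏ s, Multiplicative.ofAdd (Pi.single s (x s)) := by
      rw [← ofAdd_sum, Finset.univ_sum_single]
    rw [e]
    refine Subgroup.prod_mem _ fun s _ => ?_
    rcases zmod_two_cases (x s) with h0 | h0
    · rw [h0, Pi.single_zero]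
      exact one_mem _
    · rw [h0]
      exact h s
  exact h1

lemma wl_mem_hadSubgroup [NeZero n] (x : V n) : wl x ∈ hadSubgroup n := by
  refine wl_mem_of_forall (fun s => ?_) x
  apply Subgroup.subset_closure
  right
  rw [Set.mem_iUnion]
  rcases s with i | i
  · exact ⟨i, Or.inr (by rw [onQubit_matZ, classOf_weylU]; rfl)⟩
  · exact ⟨i, Or.inl (by rw [onQubit_matX, classOf_weylU]; rfl)⟩

lemma tv_y1_mem_hadSubgroup [NeZero n] : tv (y1 n) ∈ hadSubgroup n := by
  have h : wl (Pi.single (Sum.inl 0) 1) * tv (y1 n) ∈ hadSubgroup n :=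
    Subgroup.subset_closure (Or.inl (by rw [classOf_matH]; rfl))
  exact (Subgroup.mul_mem_cancel_left _ (wl_mem_hadSubgroup _)).mp h

lemma hadSubgroup_le_ker : hadSubgroup (n + 1) ≤ (affProj n).ker.map (IN (n + 1)).subtype := by
  have hw : ∀ x, wl x ∈ (affProj n).ker.map (IN (n + 1)).subtype := fun x =>
    ⟨⟨wl x, wl_mem_IN x⟩, affProj_wl x, rfl⟩
  rw [hadSubgroup, Subgroup.closure_le]
  rintro g (hg | hg)
  · rw [classOf_matH, Set.mem_singleton_iff] at hg
    rw [hg]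
    exact mul_mem (hw _) ⟨_, affProj_tv_y1, rfl⟩
  · obtain ⟨i, hg | hg⟩ := Set.mem_iUnion.mp hg
    · rw [onQubit_matX, classOf_weylU, Set.mem_singleton_iff] at hg
      rw [hg]; exact hw _
    · rw [onQubit_matZ, classOf_weylU, Set.mem_singleton_iff] at hg
      rw [hg]; exact hw _

lemma ker_affProj : (affProj n).ker.map (IN (n + 1)).subtype = hadSubgroup (n + 1) := by
  refine le_antisymm ?_ hadSubgroup_le_ker
  rintro _ ⟨g, hg, rfl⟩
  obtain ⟨z, h | h⟩ := exists_of_affProj_eq_one hg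
  · exact (show (g : C (n + 1)) ∈ hadSubgroup (n + 1) by rw [h]; exact wl_mem_hadSubgroup z)
  · exact (show (g : C (n + 1)) ∈ hadSubgroup (n + 1) by
      rw [h]; exact mul_mem (wl_mem_hadSubgroup z) tv_y1_mem_hadSubgroup)

end

section

variable {n : ℕ}

/-! ## The embedding of the Clifford group of the last `n` qubits -/

/-- The Kronecker product of an operator on the first qubit and an operator on the others. -/
def consTensor (B : Matrix (Fin 2) (Fin 2) ℂ) (A : QMat n) : QMat (n + 1) :=
  Matrix.of fun a b => B (a 0) (b 0) * A (Fin.tail a) (Fin.tail b)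

lemma consTensor_mul (B B' : Matrix (Fin 2) (Fin 2) ℂ) (A A' : QMat n) :
    consTensor B A * consTensor B' A' = consTensor (B * B') (A * A') := by
  ext a b
  simp only [consTensor, Matrix.mul_apply, Matrix.of_apply]
  rw [← (Fin.consEquiv fun _ => Fin 2).sum_comp, Fintype.sum_prod_type, Finset.sum_mul_sum]
  refine Finset.sum_congr rfl fun i _ => Finset.sum_congr rfl fun c _ => ?_
  change B (a 0) i * A (Fin.tail a) c * (B' i (b 0) * A' c (Fin.tail b)) = _
  ring

lemma star_consTensor (B : Matrix (Fin 2) (Fin 2) ℂ) (A : QMat n) :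
    star (consTensor B A) = consTensor (star B) (star A) := by
  ext a b
  simp [consTensor, Matrix.star_apply]

lemma tensor_succ (A : Fin (n + 1) → Matrix (Fin 2) (Fin 2) ℂ) :
    tensor A = consTensor (A 0) (tensor fun k => A k.succ) := by
  ext a b
  simp only [tensor, consTensor, Matrix.of_apply, Fin.prod_univ_succ]
  rfl

lemma consTensor_one_one : consTensor 1 (1 : QMat n) = 1 := by
  rw [← tensor_one, ← tensor_one, tensor_succ]

lemma consTensor_smul (c : ℂ) (B : Matrix (Fin 2) (Fin 2) ℂ) (A : QMat n) :
    consTensor B (c • A) = c • consTensor B A := by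
  ext a b
  simp only [consTensor, Matrix.of_apply, Matrix.smul_apply, smul_eq_mul]
  ring

lemma idTensor_eq (A : QMat n) : idTensor A = consTensor 1 A := by
  ext a b
  simp [idTensor, consTensor, Matrix.one_apply]

/-- The homomorphism `U ↦ I ⊗ U`. -/
def idHom (n : ℕ) : QU n →* QU (n + 1) where
  toFun U := ⟨consTensor 1 (U : QMat n), by
    rw [Matrix.mem_unitaryGroup_iff, star_consTensor, consTensor_mul, unitary_mul_star, star_one,
      one_mul, consTensor_one_one]⟩
  map_one' := Subtype.ext consTensor_one_one
  map_mul' U T := Subtype.ext (by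
    change consTensor 1 ((U : QMat n) * (T : QMat n)) = consTensor 1 _ * consTensor 1 _
    rw [consTensor_mul, one_mul])

lemma idHom_conj_mem {U : QU n} (hU : ∀ h ∈ pauliGroup n, U * h * U⁻¹ ∈ pauliGroup n) :
    ∀ h ∈ pauliGroup (n + 1), idHom n U * h * (idHom n U)⁻¹ ∈ pauliGroup (n + 1) := by
  rintro _ ⟨B, hB, rfl⟩
  obtain ⟨B', hB', e⟩ := hU _ ⟨fun k => B k.succ, fun k _ => hB k.succ trivial, rfl⟩
  refine ⟨Fin.cons (B 0) B', fun k _ => ?_, Subtype.ext ?_⟩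
  · cases k using Fin.cases with
    | zero => exact hB 0 trivial
    | succ k => exact hB' k trivial
  · have e' := congrArg Subtype.val e
    change tensor _ = (U : QMat n) * tensor _ * star (U : QMat n) at e'
    change tensor _ = consTensor 1 (U : QMat n) * tensor _ * star (consTensor 1 (U : QMat n))
    rw [tensor_succ, tensor_succ, star_consTensor, consTensor_mul, consTensor_mul, star_one,
      one_mul, mul_one, ← e']
    rfl

lemma idHom_mem {U : QU n} (hU : U ∈ cliff n) : idHom n U ∈ cliff (n + 1) := by
  have h1 : ∀ h ∈ pauliGroup n, U * h * U⁻¹ ∈ pauliGroup n :=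
    fun h hh => (Subgroup.mem_normalizer_iff.mp hU h).mp hh
  have h2 : ∀ h ∈ pauliGroup n, U⁻¹ * h * U⁻¹⁻¹ ∈ pauliGroup n :=
    fun h hh => (Subgroup.mem_normalizer_iff.mp (inv_mem hU) h).mp hh
  refine mem_cliff_of_forall (idHom_conj_mem h1) fun h hh => ?_
  have := idHom_conj_mem h2 h hh
  rwa [map_inv, inv_inv] at this

/-- The class `[I ⊗ U]`. -/
noncomputable def idClass (U : cliff n) : C (n + 1) :=
  ((⟨idHom n U, idHom_mem U.2⟩ : cliff (n + 1)) : C (n + 1))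

lemma classOf_idTensor (U : cliff n) : classOf (idTensor ((U : QU n) : QMat n)) = {idClass U} := by
  rw [idTensor_eq]
  exact classOf_coe ⟨idHom n U, idHom_mem U.2⟩

lemma weylU_succ (x : V (n + 1)) : (weylU x : QMat (n + 1))
    = consTensor (weylOne (x (Sum.inl 0)) (x (Sum.inr 0)) : Matrix (Fin 2) (Fin 2) ℂ)
      (weylU (rest n x) : QMat n) := tensor_succ _

lemma act_idClass (U : cliff n) {x y : V (n + 1)} (hl : y (Sum.inl 0) = x (Sum.inl 0))
    (hr : y (Sum.inr 0) = x (Sum.inr 0)) (h : rest n y = act (U : C n) (rest n x)) :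
    act (idClass U) x = y := by
  refine (sgn_unique (⟨idHom n U, idHom_mem U.2⟩ : cliff (n + 1)) x y
    (sgn (U : C n) (rest n x)) ?_).1
  change consTensor 1 ((U : QU n) : QMat n) * _ = _ • (_ * consTensor 1 ((U : QU n) : QMat n))
  rw [weylU_succ, weylU_succ, consTensor_mul, consTensor_mul, mul_weylU, hl, hr, h, one_mul, mul_one,
    consTensor_smul]

lemma idClass_mem_IN (U : cliff n) : idClass U ∈ IN (n + 1) := by
  rw [mem_IN]
  exact act_idClass U rfl rfl (by rw [rest_y1, act_zero])

/-- `I ⊗ U` fixes `f1`, so its translation part is zero and its linear part is that of `U`. -/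
lemma affProj_idClass (U : cliff n) : affProj n ⟨idClass U, idClass_mem_IN U⟩
    = SemidirectProduct.inr (cliffSymp n (U : C n)) := by
  refine SemidirectProduct.ext ?_ ?_
  · rw [affProj_left, act_idClass U (y := f1 n) rfl rfl (by rw [rest_f1, act_zero]), rest_f1]
    rfl
  · rw [affProj_right, SemidirectProduct.right_inr]
    refine symp_ext fun x => ?_
    have e : act (idClass U) (emb n x) = emb n (act (U : C n) x) :=
      act_idClass U rfl rfl (by rw [rest_emb, rest_emb])
    rw [restSymp_mulVec, cliffSymp_mulVec]
    change rest n (act (idClass U) _) = _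
    rw [e, rest_emb]

/-! ## The generator `M` -/

/-- The vector of the Weyl operator `X₂`. -/
def x2 (n : ℕ) : V (n + 1) := Pi.single (Sum.inr 1) 1

/-- A second qubit exists only for `n ≥ 1`; in `Fin 1` the index 1 wraps around to 0. -/
lemma zero_ne_one_fin [NeZero n] : (0 : Fin (n + 1)) ≠ 1 := by
  have : Nontrivial (Fin (n + 1)) := Fin.nontrivial_iff_two_le.mpr
    (Nat.succ_le_succ (Nat.one_le_iff_ne_zero.mpr (NeZero.ne n)))
  exact zero_ne_one

/-- The permutation of basis vectors underlying the gate `CX_{1,2}`. -/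
def cnotPerm (a : Fin (n + 1) → Fin 2) : Fin (n + 1) → Fin 2 := Function.update a 1 (a 1 + a 0)

lemma cnotPerm_one (a : Fin (n + 1) → Fin 2) : cnotPerm a 1 = a 1 + a 0 :=
  Function.update_self _ _ _

lemma cnotPerm_of_ne (a : Fin (n + 1) → Fin 2) {k : Fin (n + 1)} (hk : k ≠ 1) :
    cnotPerm a k = a k := Function.update_of_ne hk _ _

lemma cnotPerm_cnotPerm [NeZero n] (a : Fin (n + 1) → Fin 2) : cnotPerm (cnotPerm a) = a := by
  have h : ∀ i j : Fin 2, i + j + j = i := by decide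
  funext k
  by_cases hk : k = 1
  · subst hk
    rw [cnotPerm_one, cnotPerm_one, cnotPerm_of_ne a zero_ne_one_fin, h]
  · rw [cnotPerm_of_ne _ hk, cnotPerm_of_ne _ hk]

lemma cnot_apply (a b : Fin (n + 1) → Fin 2) :
    cnot (0 : Fin (n + 1)) 1 a b = if a = cnotPerm b then 1 else 0 := rfl

lemma cnot_mul_apply [NeZero n] (A : QMat (n + 1)) (a b : Fin (n + 1) → Fin 2) :
    (cnot (0 : Fin (n + 1)) 1 * A) a b = A (cnotPerm a) b := by
  rw [Matrix.mul_apply, Finset.sum_eq_single (cnotPerm a)]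
  · rw [cnot_apply, cnotPerm_cnotPerm, if_pos rfl, one_mul]
  · intro c _ hc
    rw [cnot_apply, if_neg, zero_mul]
    rintro rfl
    exact hc (cnotPerm_cnotPerm c).symm
  · simp

lemma mul_cnot_apply [NeZero n] (A : QMat (n + 1)) (a b : Fin (n + 1) → Fin 2) :
    (A * cnot (0 : Fin (n + 1)) 1) a b = A a (cnotPerm b) := by
  rw [Matrix.mul_apply, Finset.sum_eq_single (cnotPerm b)]
  · rw [cnot_apply, if_pos rfl, mul_one]
  · intro c _ hc
    rw [cnot_apply, if_neg hc, mul_zero]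
  · simp

lemma cnot_mul_self [NeZero n] : cnot (0 : Fin (n + 1)) 1 * cnot 0 1 = 1 := by
  ext a b
  rw [cnot_mul_apply, cnot_apply, Matrix.one_apply]
  congr 1
  refine propext ⟨fun h => ?_, fun h => by rw [h]⟩
  rw [← cnotPerm_cnotPerm a, h, cnotPerm_cnotPerm]

lemma onQubit_mul_onQubit_apply [NeZero n] (A B : Matrix (Fin 2) (Fin 2) ℂ)
    (a b : Fin (n + 1) → Fin 2) :
    (onQubit (0 : Fin (n + 1)) A * onQubit 1 B : QMat (n + 1)) a b = A (a 0) (b 0) * (B (a 1) (b 1)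
      * ∏ k ∈ (Finset.univ.erase 0).erase 1, (1 : Matrix (Fin 2) (Fin 2) ℂ) (a k) (b k)) := by
  rw [onQubit, onQubit, tensor_mul]
  simp only [tensor, Matrix.of_apply]
  have h01 := zero_ne_one_fin (n := n)
  rw [← Finset.mul_prod_erase _ _ (Finset.mem_univ 0),
    ← Finset.mul_prod_erase _ _ (Finset.mem_erase.mpr ⟨h01.symm, Finset.mem_univ 1⟩)]
  simp only [Function.update_self, Function.update_of_ne h01, Function.update_of_ne h01.symm,
    mul_one, one_mul]
  congr 2
  refine Finset.prod_congr rfl fun k hk => ?_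
  have h1 := Finset.ne_of_mem_erase hk
  have h0 := Finset.ne_of_mem_erase (Finset.mem_of_mem_erase hk)
  rw [Function.update_of_ne h0, Function.update_of_ne h1, one_mul]

/-- The gate permutes basis vectors and changes only the second coordinate, so intertwining reduces
to an identity of two-qubit entries. -/
lemma cnot_intertwine [NeZero n] {A B B' : Matrix (Fin 2) (Fin 2) ℂ}
    (h : ∀ i j k l : Fin 2, A i k * B (j + i) l = A i k * B' j (l + k)) :
    cnot (0 : Fin (n + 1)) 1 * (onQubit 0 A * onQubit 1 B)
      = onQubit 0 A * onQubit 1 B' * cnot 0 1 := by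
  ext a b
  rw [cnot_mul_apply, mul_cnot_apply, onQubit_mul_onQubit_apply, onQubit_mul_onQubit_apply,
    ← mul_assoc, ← mul_assoc, cnotPerm_one, cnotPerm_one, cnotPerm_of_ne a zero_ne_one_fin,
    cnotPerm_of_ne b zero_ne_one_fin, h]
  congr 1
  refine Finset.prod_congr rfl fun k hk => ?_
  rw [cnotPerm_of_ne a (Finset.ne_of_mem_erase hk), cnotPerm_of_ne b (Finset.ne_of_mem_erase hk)]

lemma weylU_y1_add_x2 [NeZero n] : (weylU (y1 (n + 1) + x2 n) : QMat (n + 1))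
    = (weylU (y1 (n + 1)) : QMat (n + 1)) * (weylU (x2 n) : QMat (n + 1)) := by
  rw [coe_weylU, coe_weylU, coe_weylU, tensor_mul]
  congr 1
  funext k
  by_cases hk : k = 0
  · subst hk
    have h01 := zero_ne_one_fin (n := n)
    simp [y1, x2, h01, weylOne_zero]
  · simp [y1, hk, weylOne_zero]

/-- Conjugation by the gate fixes `X₂` and sends `Y₁X₂` to `Y₁`. Hence `M = (X₂ + iY₁)/√2`, which is
`X₂` times the transvection unitary of `Y₁X₂`. -/
lemma matM_eq [NeZero n] : matM n
    = (weylU (x2 n) : QMat (n + 1)) * (tvU (y1 (n + 1) + x2 n) : QMat (n + 1)) := by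
  have hX : cnot (0 : Fin (n + 1)) 1 * onQubit 1 matX = onQubit 1 matX * cnot 0 1 := by
    have := cnot_intertwine (n := n) (A := 1) (B := matX) (B' := matX) (by
      intro i j k l
      revert i j k l
      simp +decide [Fin.forall_fin_two, matX])
    rwa [onQubit_one, one_mul] at this
  have hY : cnot (0 : Fin (n + 1)) 1 * (onQubit 0 matY * onQubit 1 matX)
      = onQubit 0 matY * cnot 0 1 := by
    have := cnot_intertwine (n := n) (A := matY) (B := matX) (B' := 1) (by
      intro i j k l
      revert i j k l
      simp +decide [Fin.forall_fin_two, matX, matY, Matrix.one_apply])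
    rwa [onQubit_one, mul_one] at this
  have hxy : om (x2 n) (y1 (n + 1)) = 0 := by
    have h01 := zero_ne_one_fin (n := n)
    rw [om_y1]; simp [x2, h01]
  have hc := weylU_comm (x2 n) (y1 (n + 1))
  rw [hxy, sg_zero, Units.val_one, one_smul] at hc
  have hM : matM n = ((Real.sqrt 2 : ℝ) : ℂ)⁻¹ • ((weylU (x2 n) : QMat (n + 1))
      + Complex.I • (weylU (y1 (n + 1)) : QMat (n + 1))) := by
    rw [matM, onQubit_mul, onQubit_ZH, coe_tvU, ← onQubit_matY, x2, ← onQubit_matX, smul_mul_assoc,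
      mul_smul_comm, smul_mul_assoc, add_mul, one_mul, smul_mul_assoc, mul_add, mul_smul_comm, hX, hY,
      add_mul, smul_mul_assoc, mul_assoc, mul_assoc, cnot_mul_self, mul_one, mul_one]
  rw [hM, coe_tvU, mul_smul_comm, mul_add, mul_one, mul_smul_comm, weylU_y1_add_x2, ← mul_assoc, hc,
    mul_assoc, weylU_sq, mul_one]

lemma classOf_matM [NeZero n] : classOf (matM n) = {wl (x2 n) * tv (y1 (n + 1) + x2 n)} := by
  rw [matM_eq]
  exact classOf_coe (⟨weylU (x2 n), weylU_mem _⟩ *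
    ⟨tvU (y1 (n + 1) + x2 n), tvU_mem _⟩ : cliff (n + 1))

lemma om_x2_y1 [NeZero n] : om (x2 n) (y1 (n + 1)) = 0 := by
  have h01 := zero_ne_one_fin (n := n)
  rw [om_y1]
  simp [x2, h01]

lemma matM_mem_IN [NeZero n] : wl (x2 n) * tv (y1 (n + 1) + x2 n) ∈ IN (n + 1) :=
  mul_mem (wl_mem_IN _) (tv_y1_mem (by rw [om_add_left, om_self, om_x2_y1, add_zero]))

/-- The transvection moves `f1` by `y1 + x2`, whose image modulo the first qubit is a nonzero basis
vector. `M` is the only listed generator with a nonzero translation part. -/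
lemma affProj_matM_left_ne_zero [NeZero n] :
    (affProj n ⟨_, matM_mem_IN⟩).left ≠ Multiplicative.ofAdd 0 := by
  have h : om (f1 n) (y1 (n + 1) + x2 n) = 1 := by
    rw [om_add_right, om_f1_y1, om_comm, f1, om_single_inl, x2]
    simp [zero_ne_one_fin (n := n)]
  have e : rest n (act (wl (x2 n) * tv (y1 (n + 1) + x2 n)) (f1 n)) = rest n (x2 n) := by
    rw [act_mul, act_wl, act_tv, h, one_smul, map_add, map_add, rest_f1, rest_y1, zero_add, zero_add]
  intro h0
  have h1 := congrFun (e.symm.trans (Multiplicative.ofAdd.injective h0)) (Sum.inr 0)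
  rw [rest_inr, x2, Fin.succ_zero_eq_one', Pi.single_eq_same] at h1
  exact one_ne_zero h1

/-! ## Generation of the inertia group -/

lemma matM_mem_genIN [NeZero n] : wl (x2 n) * tv (y1 (n + 1) + x2 n) ∈ genIN n :=
  Subgroup.subset_closure (Or.inl (Or.inl (Or.inl (by rw [classOf_matM]; rfl))))

lemma matH_mem_genIN : wl (Pi.single (Sum.inl 0) 1) * tv (y1 (n + 1)) ∈ genIN n :=
  Subgroup.subset_closure (Or.inl (Or.inl (Or.inr (by rw [classOf_matH]; rfl))))

lemma matX_mem_genIN : wl (Pi.single (Sum.inr 0) 1) ∈ genIN n :=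
  Subgroup.subset_closure (Or.inl (Or.inr (by rw [onQubit_matX, classOf_weylU]; rfl)))

lemma idClass_mem_genIN (U : cliff n) : idClass U ∈ genIN n :=
  Subgroup.subset_closure (Or.inr (Set.mem_iUnion.mpr ⟨U, by rw [classOf_idTensor]; rfl⟩))

lemma idClass_weylU (x : V n) : idClass ⟨weylU x, weylU_mem x⟩ = wl (emb n x) := by
  rw [wl_eq_mk, idClass]
  congr 2
  refine Subtype.ext ?_
  rw [weylU_succ, emb_inl_zero, emb_inr_zero, rest_emb, weylOne_zero]
  rfl

/-- `[Z₁]` is the conjugate of `[X₁]` by `[H₁]`, and the Weyl classes of the other qubits are among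
the `[I ⊗ A]`. -/
lemma wl_mem_genIN (x : V (n + 1)) : wl x ∈ genIN n := by
  have hZ : wl (Pi.single (Sum.inl 0) 1 : V (n + 1)) ∈ genIN n := by
    have h := mul_mem (mul_mem matH_mem_genIN matX_mem_genIN) (inv_mem (matH_mem_genIN (n := n)))
    rw [← wl_act, act_mul, act_wl, act_tv] at h
    have e : (Pi.single (Sum.inr 0) 1 + om (Pi.single (Sum.inr 0) 1) (y1 (n + 1)) • y1 (n + 1)
        : V (n + 1)) = Pi.single (Sum.inl 0) 1 := by
      rw [om_y1, Pi.single_eq_same, Pi.single_eq_of_ne (by simp), zero_add, one_smul, y1,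
        add_left_comm, add_self_eq_zero, add_zero]
    rwa [e] at h
  have hemb : ∀ y : V n, wl (emb n y) ∈ genIN n := fun y => by
    rw [← idClass_weylU]
    exact idClass_mem_genIN _
  refine wl_mem_of_forall (fun s => ?_) x
  have hs : ∀ s : Fin n ⊕ Fin n, (Pi.single (Sum.map Fin.succ Fin.succ s) 1 : V (n + 1))
      = emb n (Pi.single s 1) := by
    intro s
    funext r
    rcases s with i | i <;> rcases r with k | k <;> cases k using Fin.cases <;>
      simp [emb, Pi.single_apply]
  rcases s with k | k <;> cases k using Fin.cases with
  | zero => first | exact hZ | exact matX_mem_genIN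
  | succ k => first
    | exact hs (Sum.inl k) ▸ hemb _
    | exact hs (Sum.inr k) ▸ hemb _

lemma tv_y1_mem_genIN : tv (y1 (n + 1)) ∈ genIN n :=
  (Subgroup.mul_mem_cancel_left _ (wl_mem_genIN _)).mp matH_mem_genIN

lemma genIN_le [NeZero n] : genIN n ≤ IN (n + 1) := by
  rw [genIN, Subgroup.closure_le]
  rintro g (((hg | hg) | hg) | hg)
  · rw [classOf_matM] at hg
    rw [Set.mem_singleton_iff.mp hg]; exact matM_mem_IN
  · rw [classOf_matH] at hg
    rw [Set.mem_singleton_iff.mp hg]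
    exact mul_mem (wl_mem_IN _) (tv_y1_mem (om_self _))
  · rw [onQubit_matX, classOf_weylU] at hg
    rw [Set.mem_singleton_iff.mp hg]; exact wl_mem_IN _
  · obtain ⟨U, hg⟩ := Set.mem_iUnion.mp hg
    rw [classOf_idTensor] at hg
    rw [Set.mem_singleton_iff.mp hg]; exact idClass_mem_IN U

/-- The classes `[I ⊗ A]` cover the symplectic factor, `M` adds one nonzero translation, and
conjugation by the transitive symplectic group yields all others. -/
lemma map_affProj_genIN [NeZero n] : ((genIN n).subgroupOf (IN (n + 1))).map (affProj n) = ⊤ := by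
  set T := ((genIN n).subgroupOf (IN (n + 1))).map (affProj n)
  have hr : ∀ Γ : Sp n, (SemidirectProduct.inr Γ : AffSp n) ∈ T := by
    intro Γ
    obtain ⟨g, rfl⟩ := cliffSymp_surjective Γ
    obtain ⟨U, rfl⟩ := QuotientGroup.mk_surjective g
    exact ⟨⟨idClass U, idClass_mem_IN U⟩, idClass_mem_genIN U, affProj_idClass U⟩
  obtain ⟨w, hw0, hw⟩ : ∃ w : V n, w ≠ 0 ∧
      (SemidirectProduct.inl (Multiplicative.ofAdd w) : AffSp n) ∈ T := by
    set m := affProj n ⟨_, matM_mem_IN⟩ with hm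
    have hmT : m ∈ T := ⟨_, matM_mem_genIN, rfl⟩
    refine ⟨m.left.toAdd, fun h => affProj_matM_left_ne_zero (congrArg Multiplicative.ofAdd h), ?_⟩
    have e : m * (SemidirectProduct.inr m.right)⁻¹ = SemidirectProduct.inl m.left := by
      rw [mul_inv_eq_iff_eq_mul, SemidirectProduct.inl_left_mul_inr_right]
    have h := mul_mem hmT (inv_mem (hr m.right))
    rwa [e] at h
  have hl : ∀ v : V n, (SemidirectProduct.inl (Multiplicative.ofAdd v) : AffSp n) ∈ T := by
    intro v
    by_cases hv : v = 0
    · subst hv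
      rw [ofAdd_zero, map_one]
      exact one_mem _
    · obtain ⟨g, hg⟩ := exists_act_eq_of_ne_zero hw0 hv
      have h := mul_mem (mul_mem (hr (cliffSymp n g)) hw) (inv_mem (hr (cliffSymp n g)))
      rw [← map_inv, ← SemidirectProduct.inl_aut] at h
      have e : sympAct n (cliffSymp n g) (Multiplicative.ofAdd w) = Multiplicative.ofAdd v := by
        rw [← hg, ← cliffSymp_mulVec]
        rfl
      rwa [e] at h
  rw [eq_top_iff]
  intro s _
  rw [← SemidirectProduct.inl_left_mul_inr_right s]
  exact mul_mem (hl s.left.toAdd) (hr s.right)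

lemma isAffineProjection_affProj [NeZero n] : IsAffineProjection (affProj n) := by
  refine ⟨fun s => ?_, ker_affProj⟩
  have hs : s ∈ ((genIN n).subgroupOf (IN (n + 1))).map (affProj n) := by
    rw [map_affProj_genIN]; trivial
  obtain ⟨g, -, hg⟩ := hs
  exact ⟨g, hg⟩

/-- The generated subgroup maps onto the image of `affProj` and contains its kernel. -/
lemma IN_eq_genIN [NeZero n] : IN (n + 1) = genIN n := by
  refine le_antisymm (fun g hg => ?_) genIN_le
  have hs : affProj n ⟨g, hg⟩ ∈ ((genIN n).subgroupOf (IN (n + 1))).map (affProj n) := by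
    rw [map_affProj_genIN]; trivial
  obtain ⟨h, hh, e⟩ := hs
  have h1 : affProj n (⟨g, hg⟩ * h⁻¹) = 1 := by rw [map_mul, map_inv, e, mul_inv_cancel]
  have h2 : g * (h : C (n + 1))⁻¹ ∈ genIN n := by
    obtain ⟨z, hz | hz⟩ := exists_of_affProj_eq_one h1
    · exact (show g * (h : C (n + 1))⁻¹ = _ from hz) ▸ wl_mem_genIN z
    · exact (show g * (h : C (n + 1))⁻¹ = _ from hz) ▸ mul_mem (wl_mem_genIN z) tv_y1_mem_genIN
  exact (Subgroup.mul_mem_cancel_right _ (inv_mem (show (h : C (n + 1)) ∈ genIN n from hh))).mp h2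

end

section

variable {n : ℕ}

/-! ## Lifting of irreducible characters -/

lemma projPauli_le_IN [NeZero n] : projPauli n ≤ IN n := le_inertiaSubgroup _ _

lemma ExtendsSigma1.apply [NeZero n] {τ : IN n →* ℂˣ} (hτ : ExtendsSigma1 τ) (x : projPauli n) :
    τ ⟨x, projPauli_le_IN x.2⟩ = sigma1 n x := DFunLike.congr_fun hτ x

section Lift

variable {π : IN (n + 1) →* AffSp n} {σ' : IN (n + 1) →* ℂˣ}

lemma IsAffineProjection.apply_projPauli (hπ : IsAffineProjection π) {g : C (n + 1)}
    (hg : g ∈ projPauli (n + 1)) (h : g ∈ IN (n + 1)) : π ⟨g, h⟩ = 1 := by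
  obtain ⟨x, rfl⟩ := exists_wl_of_mem hg
  have hx := wl_mem_hadSubgroup x
  rw [← hπ.2] at hx
  obtain ⟨k, hk, e⟩ := hx
  rw [← show k = ⟨wl x, h⟩ from Subtype.ext e]
  exact hk

/-- The character of `IN_{n+1}` inflated from `Sp(2n,2) ⋉ ℤ₂²ⁿ` and twisted by `σ₁'` is afforded by
an irreducible representation lying over `σ₁`. -/
lemma exists_inflated_rep [NeZero n] (hπ : IsAffineProjection π) (hσ : ExtendsSigma1 σ')
    {ψ : AffSp n → ℂ} (hψ : IsIrrChar ψ) : ∃ (W : Type) (_ : AddCommGroup W) (_ : Module ℂ W)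
      (_ : FiniteDimensional ℂ W) (ρ : Representation ℂ (IN (n + 1)) W), ρ.IsIrreducible ∧
      ρ.character = (fun g => ψ (π g) * (σ' g : ℂ)) ∧
      ∀ x : projPauli (n + 1), ρ ⟨x, projPauli_le_IN x.2⟩
        = (sigma1 (n + 1) x : ℂ) • 1 := by
  have : Finite (AffSp n) := Finite.of_surjective π hπ.1
  obtain ⟨W, _, _, _, ρ, hρ, rfl⟩ := (isIrrChar_iff ψ).mp hψ
  have h1 := isIrreducible_comp ρ π hπ.1
  refine ⟨W, inferInstance, inferInstance, inferInstance,
    linTwist (ρ.comp π : Representation ℂ (IN (n + 1)) W) σ', isIrreducible_linTwist _ _, ?_, ?_⟩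
  · funext g
    exact character_linTwist _ _ g
  · intro x
    change (σ' _ : ℂ) • ρ (π _) = _
    rw [hπ.apply_projPauli x.2, map_one, hσ.apply]

lemma isIrrChar_indChar [NeZero n] (hπ : IsAffineProjection π) (hσ : ExtendsSigma1 σ')
    {ψ : AffSp n → ℂ} (hψ : IsIrrChar ψ) :
    IsIrrChar (indChar (IN (n + 1)) fun g => ψ (π g) * (σ' g : ℂ)) := by
  obtain ⟨W, _, _, _, ρ, hρ, hc, hN⟩ := exists_inflated_rep hπ hσ hψ
  rw [isIrrChar_iff, ← hc]
  refine ⟨_, inferInstance, inferInstance, inferInstance, indRep ρ, ?_, character_indRep ρ⟩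
  exact isIrreducible_indRep (H := IN (n + 1)) rfl projPauli_le_IN ρ hN

/-- Averaging against `sigma1` recovers the function on the inertia group; then the nonzero values
of `σ'` are cancelled and surjectivity of `π` gives every argument. -/
lemma indChar_inflated_injective [NeZero n] (hπ : IsAffineProjection π) (hσ : ExtendsSigma1 σ')
    {ψ ψ' : AffSp n → ℂ} (hψ : IsIrrChar ψ) (hψ' : IsIrrChar ψ')
    (h : indChar (IN (n + 1)) (fun g => ψ (π g) * (σ' g : ℂ))
      = indChar (IN (n + 1)) fun g => ψ' (π g) * (σ' g : ℂ)) : ψ = ψ' := by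
  have := Fintype.ofFinite (projPauli (n + 1))
  have average : ∀ {ψ : AffSp n → ℂ}, IsIrrChar ψ → ∀ g : IN (n + 1),
      ∑ x : projPauli (n + 1), (((sigma1 (n + 1) x)⁻¹ : ℂˣ) : ℂ)
        * indChar (IN (n + 1)) (fun g => ψ (π g) * (σ' g : ℂ)) (x * g)
      = Nat.card (projPauli (n + 1)) * (ψ (π g) * (σ' g : ℂ)) := by
    intro ψ hψ g
    obtain ⟨W, _, _, _, ρ, hρ, hc, hN⟩ := exists_inflated_rep hπ hσ hψ
    refine indChar_average (H := IN (n + 1)) (σ := sigma1 (n + 1)) rfl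
      projPauli_le_IN (fun g => ψ (π g) * (σ' g : ℂ)) ?_ ?_ g
    · intro x y
      change (fun g => ψ (π g) * (σ' g : ℂ)) _ = (fun g => ψ (π g) * (σ' g : ℂ)) _
      rw [← hc]
      have e := ρ.char_conj x y⁻¹
      rwa [inv_inv y] at e
    · intro x y
      rw [map_mul, map_mul, hπ.apply_projPauli x.2, one_mul, Units.val_mul, hσ.apply]
      ring
  funext s
  obtain ⟨g, rfl⟩ := hπ.1 s
  have h1 := average hψ g
  rw [h, average hψ' g] at h1
  have h2 := mul_left_cancel₀ (Nat.cast_ne_zero.mpr Nat.card_pos.ne') h1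
  exact (mul_right_cancel₀ (Units.ne_zero _) h2).symm

end Lift

end

end CliffordLift

open CliffordLift
theorem mainTheorem9 (n : ℕ) [NeZero n] :
    -- the objects of the construction exist and are the intended ones
    IN (n + 1) = genIN n ∧
    (∃ π : IN (n + 1) →* AffSp n, IsAffineProjection π) ∧
    (∃ σ' : IN (n + 1) →* ℂˣ, ExtendsSigma1 σ' ∧ IsSignChar σ') ∧
    (∃ (τ : IN n →* ℂˣ) (t : Sp n → C n),
      ExtendsSigma1 τ ∧ IsSignChar τ ∧ IsAdaptedSection τ t) ∧
    -- the lifting of irreducible characters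
    ∀ (π : IN (n + 1) →* AffSp n) (σ' : IN (n + 1) →* ℂˣ) (τ : IN n →* ℂˣ) (t : Sp n → C n),
      IsAffineProjection π → ExtendsSigma1 σ' → ExtendsSigma1 τ → IsAdaptedSection τ t →
        Function.Bijective (phi t) ∧
        (∀ χ : C n → ℂ, IsIrrChar χ → IsIrrChar (χ ∘ phi t)) ∧
        (∀ χ : C n → ℂ, IsIrrChar χ → IsIrrChar (liftChar π σ' t χ)) ∧
        Set.InjOn (liftChar π σ' t) {χ : C n → ℂ | IsIrrChar χ} := by
  refine ⟨IN_eq_genIN, ⟨affProj n, isAffineProjection_affProj⟩,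
    ⟨signChar (n + 1), extendsSigma1_signChar, isSignChar_signChar⟩, ?_, ?_⟩
  · obtain ⟨t, ht⟩ := exists_isAdaptedSection (n := n)
    exact ⟨signChar n, t, extendsSigma1_signChar, isSignChar_signChar, ht⟩
  · intro π σ' τ t hπ hσ hτ ht
    refine ⟨ht.phi_bijective, fun χ hχ => ht.isIrrChar_comp_phi hτ hχ,
      fun χ hχ => isIrrChar_indChar hπ hσ (ht.isIrrChar_comp_phi hτ hχ), ?_⟩
    intro χ hχ χ' hχ' h
    have h1 := indChar_inflated_injective hπ hσ (ht.isIrrChar_comp_phi hτ hχ)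
      (ht.isIrrChar_comp_phi hτ hχ') h
    exact ht.phi_bijective.surjective.injective_comp_right h1
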